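/- **Setting.** Let $\Lambda$ be a finite set of qubits and let $H=\sum_{\gamma\in\Gamma}H_\gamma$ be a finite sum of Hermitian operators on $(\mathbb C^2)^{\otimes\Lambda}$ with $\|H_\gamma\|\le 1$. The interaction degree of $H$ is at most $d\ge 1$ if for every $\gamma\in\Gamma$ there are at most $d$ indices $\gamma'\in\Gamma$ ($\gamma$ itself included) with $\operatorname{Supp}(H_\gamma)\cap\operatorname{Supp}(H_{\gamma'})\neq\emptyset$, where $\operatorname{Supp}(O)$ is the set of qubits on which $O$ acts non-trivially. For $\beta>0$ let $\rho_\beta=e^{-\beta H}/\operatorname{Tr}e^{-\beta H}$, and for $A\subseteq\Lambda$ let $\rho_{\beta,-A}=\operatorname{Tr}_A[\rho_\beta]\otimes\tau_A$, where $\tau_A$ is the maximally mixed state on $A$. Put $\sigma=1/\beta$, $\beta_0=\frac1{4d}$, and $$f(t)=e^{-\sigma^2t^2}\sqrt{\sigma\sqrt{2/\pi}},\qquad \hat f(\omega)=\frac{e^{-\omega^2/4\sigma^2}}{\sqrt{\sigma\sqrt{2\pi}}},\qquad \gamma(\omega)=\exp\!\big(-\beta\max(\omega+\tfrac{\beta\sigma^2}2,0)\big).$$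 For a self-adjoint operator $S$ let $\hat S(\omega)=\frac1{\sqrt{2\pi}}\int_{-\infty}^\infty e^{iHt}Se^{-iHt}e^{-i\omega t}f(t)\,dt$, and for a Bohr frequency $\nu$ (a difference of two eigenvalues of $H$) let $S_\nu=\sum_{E_2-E_1=\nu}P_{E_2}SP_{E_1}$, where $P_E$ is the spectral projector of $H$ for the eigenvalue $E$. The Lindbladian with jump $S$ and Metropolis weight $\gamma$ is $$\mathcal L_S[\cdot]=-i[B_S,\cdot]+\int_{-\infty}^{\infty}\gamma(\omega)\Big(\hat S(\omega)(\cdot)\hat S(\omega)^\dagger-\tfrac12\{\hat S(\omega)^\dagger\hat S(\omega),\cdot\}\Big)d\omega,$$ $$B_S=\frac i2\sum_{\nu_1,\nu_2}\tanh\!\Big(\frac{\beta(\nu_1-\nu_2)}4\Big)\,\alpha_{\nu_1\nu_2}\,S_{\nu_2}^\dagger S_{\nu_1},\qquad \alpha_{\nu_1\nu_2}=\int_{-\infty}^\infty\gamma(\omega)\hat f(\omega-\nu_1)\hat f(\omega-\nu_2)\,d\omega .$$ Finally let $$\mathcal L_A=\sum_{i\in A}\big(\mathcal L_{X_i}+\mathcal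 L_{Y_i}+\mathcal L_{Z_i}\big),\qquad \mathcal R_{A,t}[\cdot]=\frac1t\int_0^te^{s\mathcal L_A}[\cdot]\,ds\quad(t>0),$$ where $X_i,Y_i,Z_i$ are the Pauli matrices on the qubit $i$. **Theorem.** The Lindbladian $\mathcal L_A$ is KMS detailed balanced with respect to $\rho_\beta$: its Hilbert–Schmidt adjoint is symmetric for the inner product $\langle X,Y\rangle_{\rho_\beta}=\operatorname{Tr}[X^\dagger\rho_\beta^{1/2}Y\rho_\beta^{1/2}]$. Moreover, there are functions $r,r'$ of $(\beta,d)$ alone such that for all $H$ of interaction degree at most $d\ge1$, all $A\subseteq\Lambda$, all $\beta>0$ and all $t>0$, $$\big\|\mathcal R_{A,t}[\rho_{\beta,-A}]-\rho_\beta\big\|_1\le|A|^2\,2^{2|A|}\begin{cases}r(\beta,d)\;t^{-\frac{128\beta_0^4}{\beta^3(\beta+5\beta_0)}}&\text{if }\beta>4\beta_0,\\[4pt] r'(\beta,d)\;t^{-\frac{2\beta_0}{\beta+5\beta_0}}&\text{if }\beta\le4\beta_0,\end{cases}$$ where $\|\cdot\|_1$ is the trace norm. Consequently, for all $\beta>0$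 and $d\ge1$ there are numbers $r,\mu>0$ and $0<\lambda<1$, depending only on $\beta$ and $d$, such that for all such $H$, $A$ and $t$, $$\big\|\mathcal R_{A,t}[\rho_{\beta,-A}]-\rho_\beta\big\|_1\le r\,e^{\mu|A|}\,t^{-\lambda}.$$ -/

import Mathlib

open MeasureTheory
open scoped Matrix Matrix.Norms.L2Operator MatrixOrder

universe u v

namespace QuantumGibbs

noncomputable section

/-! ### Qubits, supports, partial trace

Matrices carry the operator norm on the Euclidean space (scope `Matrix.Norms.L2Operator`). -/

/-- Operators on the Hilbert space `⨂_{i ∈ Λ} ℂ²`, written in the computational basis, which is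
indexed by the configurations `Λ → Fin 2`. -/
abbrev Op (Λ : Type*) : Type _ := Matrix (Λ → Fin 2) (Λ → Fin 2) ℂ

section Qubits

variable {Λ : Type*} [Fintype Λ] [DecidableEq Λ]

/-- The single-qubit operator `M` acting on the qubit `i`, and as the identity elsewhere. -/
def siteOp (i : Λ) (M : Matrix (Fin 2) (Fin 2) ℂ) : Op Λ :=
  Matrix.of fun x y => if ∀ j, j ≠ i → x j = y j then M (x i) (y i) else 0

/-- The three Pauli matrices `X`, `Y`, `Z`. -/
def pauli : Fin 3 → Matrix (Fin 2) (Fin 2) ℂ :=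
  ![!![0, 1; 1, 0], !![0, -Complex.I; Complex.I, 0], !![1, 0; 0, -1]]

open Classical in
/-- The support of an operator: the qubits on which it acts non-trivially. It acts trivially on
the qubit `i` (that is, it is of the form `1 ⊗ O'` with the identity on the tensor factor `i`)
if and only if it commutes with all operators on that qubit. -/
def support (O : Op Λ) : Finset Λ :=
  Finset.univ.filter fun i => ∃ M : Matrix (Fin 2) (Fin 2) ℂ, ¬ Commute O (siteOp i M)

/-- The configuration on `Λ` that is `z` on `A` and `x` outside `A`. -/
def glue (A : Finset Λ) (z : {i // i ∈ A} → Fin 2) (x : {i // i ∉ A} → Fin 2) : Λ → Fin 2 :=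
  fun i => if h : i ∈ A then z ⟨i, h⟩ else x ⟨i, h⟩

/-- The partial trace `Tr_A`, an operator on the qubits outside `A`. -/
def partialTrace (A : Finset Λ) (M : Op Λ) : Op {i // i ∉ A} :=
  Matrix.of fun x y => ∑ z : {i // i ∈ A} → Fin 2, M (glue A z x) (glue A z y)

/-- The maximally mixed state `τ_A` on the qubits in `A`. -/
def maximallyMixed (A : Finset Λ) : Op {i // i ∈ A} := ((2 : ℂ) ^ A.card)⁻¹ • 1

/-- The tensor product of an operator outside `A` and an operator on `A`. -/
def tensorOp (A : Finset Λ) (N : Op {i // i ∉ A}) (T : Op {i // i ∈ A}) : Op Λ :=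
  Matrix.of fun x y => N (fun i => x i) (fun i => y i) * T (fun i => x i) (fun i => y i)

/-- `Tr_A[ρ] ⊗ τ_A`: the region `A` is discarded and replaced by the maximally mixed state. -/
def refresh (A : Finset Λ) (ρ : Op Λ) : Op Λ :=
  tensorOp A (partialTrace A ρ) (maximallyMixed A)

end Qubits

/-! ### Gibbs states, trace norm, KMS detailed balance -/

section Matrices

variable {n : Type*} [Fintype n] [DecidableEq n]

/-- The Gibbs state `e^{-βH} / Tr e^{-βH}`. -/
def gibbs (β : ℝ) (H : Matrix n n ℂ) : Matrix n n ℂ :=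
  (NormedSpace.exp ((-β : ℂ) • H)).trace⁻¹ • NormedSpace.exp ((-β : ℂ) • H)

/-- The trace norm `Tr |M|`. -/
def traceNorm (M : Matrix n n ℂ) : ℝ := (CFC.abs M).trace.re

/-- The KMS inner product `Tr[X† ρ^{1/2} Y ρ^{1/2}]`. -/
def kmsInner (ρ X Y : Matrix n n ℂ) : ℂ := (Xᴴ * CFC.sqrt ρ * Y * CFC.sqrt ρ).trace

/-- The adjoint of a superoperator for the Hilbert-Schmidt inner product `Tr[X† Y]`. -/
def hsAdjoint (L : Matrix n n ℂ →L[ℂ] Matrix n n ℂ) (X : Matrix n n ℂ) : Matrix n n ℂ :=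
  Matrix.of fun i j => star (Xᴴ * L (Matrix.single i j 1)).trace

theorem trace_hsAdjoint (L : Matrix n n ℂ →L[ℂ] Matrix n n ℂ) (X Y : Matrix n n ℂ) :
    ((hsAdjoint L X)ᴴ * Y).trace = (Xᴴ * L Y).trace := by
  conv_rhs => rw [Matrix.matrix_eq_sum_single Y]
  simp only [map_sum, Finset.mul_sum, Matrix.trace_sum]
  have key : ∀ i j, (Xᴴ * L (Matrix.single i j (Y i j))).trace
      = Y i j * (Xᴴ * L (Matrix.single i j 1)).trace := by
    intro i j
    have h1 : Matrix.single i j (Y i j) = Y i j • Matrix.single i j (1 : ℂ) := by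
      rw [Matrix.smul_single, smul_eq_mul, mul_one]
    rw [h1, map_smul, Matrix.mul_smul, Matrix.trace_smul, smul_eq_mul]
  simp only [key]
  rw [Finset.sum_comm]
  simp only [Matrix.trace, Matrix.diag_apply, Matrix.mul_apply, Matrix.conjTranspose_apply,
    hsAdjoint, Matrix.of_apply, star_star]
  exact Finset.sum_congr rfl fun j _ => Finset.sum_congr rfl fun i _ => mul_comm _ _

/-- A Lindbladian (in the Schrödinger picture) is KMS detailed balanced with respect to `ρ` if its
Heisenberg-picture adjoint is symmetric for the KMS inner product of `ρ`. -/
def IsKMSDetailedBalanced (ρ : Matrix n n ℂ) (L : Matrix n n ℂ →L[ℂ] Matrix n n ℂ) : Prop :=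
  ∀ X Y, kmsInner ρ X (hsAdjoint L Y) = kmsInner ρ (hsAdjoint L X) Y

/-! ### Operator Fourier transform and Bohr frequencies -/

/-- The Gaussian filter `f(t) = e^{-σ²t²} √(σ √(2/π))`. -/
def gaussFilter (σ t : ℝ) : ℝ :=
  Real.exp (-σ ^ 2 * t ^ 2) * Real.sqrt (σ * Real.sqrt (2 / Real.pi))

/-- Its Fourier transform `f̂(ω) = e^{-ω²/(4σ²)} / √(σ √(2π))`. -/
def filterHat (σ ω : ℝ) : ℝ :=
  Real.exp (-ω ^ 2 / (4 * σ ^ 2)) / Real.sqrt (σ * Real.sqrt (2 * Real.pi))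

/-- The Metropolis weight `γ(ω) = exp(-β max(ω + βσ²/2, 0))`. -/
def metropolis (β σ ω : ℝ) : ℝ := Real.exp (-β * max (ω + β * σ ^ 2 / 2) 0)

/-- The Heisenberg evolution `A(t) = e^{iHt} A e^{-iHt}`. -/
def heisenberg (H A : Matrix n n ℂ) (t : ℝ) : Matrix n n ℂ :=
  NormedSpace.exp ((Complex.I * t) • H) * A * NormedSpace.exp ((-(Complex.I * t)) • H)

/-- The operator Fourier transform
`Â(ω) = (2π)^{-1/2} ∫ e^{iHt} A e^{-iHt} e^{-iωt} f(t) dt`. -/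
def oft (σ : ℝ) (H A : Matrix n n ℂ) (ω : ℝ) : Matrix n n ℂ :=
  ((Real.sqrt (2 * Real.pi))⁻¹ : ℂ) •
    ∫ t : ℝ, (Complex.exp (-(Complex.I * ω * t)) * (gaussFilter σ t : ℂ)) • heisenberg H A t

/-- The set of energies (eigenvalues) of a Hamiltonian. -/
def energies {H : Matrix n n ℂ} (hH : H.IsHermitian) : Finset ℝ :=
  Finset.univ.image hH.eigenvalues

/-- The projector `P_E = ∑_{i : E_i = E} |ψ_i⟩⟨ψ_i|` onto the eigenspace of energy `E`. -/
def energyProj {H : Matrix n n ℂ} (hH : H.IsHermitian) (E : ℝ) : Matrix n n ℂ :=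
  ∑ i ∈ Finset.univ.filter (fun i => hH.eigenvalues i = E),
    Matrix.vecMulVec (hH.eigenvectorBasis i) (star (hH.eigenvectorBasis i : n → ℂ))

/-- The set of Bohr frequencies, that is, of energy differences. -/
def bohr {H : Matrix n n ℂ} (hH : H.IsHermitian) : Finset ℝ :=
  (energies hH ×ˢ energies hH).image fun p => p.2 - p.1

/-- The part `A_ν = ∑_{E₂ - E₁ = ν} P_{E₂} A P_{E₁}` of `A` that raises the energy by `ν`. -/
def bohrPart {H : Matrix n n ℂ} (hH : H.IsHermitian) (A : Matrix n n ℂ) (ν : ℝ) :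
    Matrix n n ℂ :=
  ∑ p ∈ (energies hH ×ˢ energies hH).filter (fun p => p.2 - p.1 = ν),
    energyProj hH p.2 * A * energyProj hH p.1

/-! ### The Lindbladian -/

/-- The coefficients `α_{ν₁ν₂} = ∫ γ(ω) f̂(ω - ν₁) f̂(ω - ν₂) dω` of the transition part
`∫ γ(ω) Â(ω) (·) Â(ω)† dω = ∑ α_{ν₁ν₂} A_{ν₁} (·) A_{ν₂}†`. -/
def transitionCoeff (β σ ν₁ ν₂ : ℝ) : ℝ :=
  ∫ ω : ℝ, metropolis β σ ω * filterHat σ (ω - ν₁) * filterHat σ (ω - ν₂)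

/-- The Hamiltonian `B` of the coherent part,
`B = ∑_{ν₁,ν₂} (i/2) tanh(β(ν₁ - ν₂)/4) α_{ν₁ν₂} A_{ν₂}† A_{ν₁}`.
For a self-adjoint jump it is, up to an irrelevant multiple of the identity, the only Hermitian
matrix that makes the Lindbladian below exactly KMS detailed balanced. -/
def coherent (β σ : ℝ) {H : Matrix n n ℂ} (hH : H.IsHermitian) (A : Matrix n n ℂ) :
    Matrix n n ℂ :=
  ∑ ν₁ ∈ bohr hH, ∑ ν₂ ∈ bohr hH,
    (Complex.I / 2 * (Real.tanh (β * (ν₁ - ν₂) / 4) * transitionCoeff β σ ν₁ ν₂ : ℝ)) •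
      ((bohrPart hH A ν₂)ᴴ * bohrPart hH A ν₁)

/-- The superoperator `X ↦ a X b`. -/
def sandwich (a b : Matrix n n ℂ) : Matrix n n ℂ →L[ℂ] Matrix n n ℂ :=
  ContinuousLinearMap.mulLeftRight ℂ (Matrix n n ℂ) a b

/-- The Lindbladian with the single jump `A`,
`-i[B, ·] + ∫ γ(ω) (Â(ω) (·) Â(ω)† - ½ {Â(ω)† Â(ω), ·}) dω`, in the Schrödinger picture. -/
def lindbladian (β σ : ℝ) {H : Matrix n n ℂ} (hH : H.IsHermitian) (A : Matrix n n ℂ) :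
    Matrix n n ℂ →L[ℂ] Matrix n n ℂ :=
  (-Complex.I) • (sandwich (coherent β σ hH A) 1 - sandwich 1 (coherent β σ hH A)) +
    ∫ ω : ℝ, (metropolis β σ ω : ℂ) •
      (sandwich (oft σ H A ω) (oft σ H A ω)ᴴ -
        (1 / 2 : ℂ) • (sandwich ((oft σ H A ω)ᴴ * oft σ H A ω) 1 +
          sandwich 1 ((oft σ H A ω)ᴴ * oft σ H A ω)))

/-- The time average `(1/t) ∫_0^t e^{sL} ds` of the semigroup generated by `L`, applied to `ρ`. -/
def timeAverage (L : Matrix n n ℂ →L[ℂ] Matrix n n ℂ) (t : ℝ) (ρ : Matrix n n ℂ) :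
    Matrix n n ℂ :=
  ((1 / t : ℝ) : ℂ) • ∫ s in (0 : ℝ)..t, (NormedSpace.exp ((s : ℂ) • L)) ρ

end Matrices

/-! ### Hamiltonians with bounded interaction degree -/

/-- A Hamiltonian on the qubits `Λ`, given as a sum of terms `H_γ` of operator norm at most one,
indexed by a finite set `Γ`. -/
structure LocalHamiltonian (Λ Γ : Type*) [Fintype Λ] [DecidableEq Λ] where
  /-- The terms `H_γ`. -/
  term : Γ → Op Λ
  isHermitian : ∀ γ, (term γ).IsHermitian
  norm_le_one : ∀ γ, ‖term γ‖ ≤ 1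

namespace LocalHamiltonian

variable {Λ Γ : Type*} [Fintype Λ] [DecidableEq Λ] [Fintype Γ]

/-- The Hamiltonian `H = ∑_γ H_γ`. -/
def total (h : LocalHamiltonian Λ Γ) : Op Λ := ∑ γ, h.term γ

theorem total_isHermitian (h : LocalHamiltonian Λ Γ) : h.total.IsHermitian := by
  unfold total Matrix.IsHermitian
  rw [Matrix.conjTranspose_sum]
  exact Finset.sum_congr rfl fun γ _ => h.isHermitian γ

/-- The degree of `γ` in the interaction graph: the number of terms `γ'` (among them `γ` itself,
since the graph has self-loops) whose support meets the support of `H_γ`. -/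
def degree (h : LocalHamiltonian Λ Γ) (γ : Γ) : ℕ :=
  (Finset.univ.filter fun γ' => (support (h.term γ) ∩ support (h.term γ')).Nonempty).card

/-- `L_A`: the sum of the Lindbladians of the jumps `X_i`, `Y_i`, `Z_i` with `i ∈ A`, with the
Metropolis weight and the energy width `σ = 1/β`. -/
def generator (h : LocalHamiltonian Λ Γ) (β : ℝ) (A : Finset Λ) : Op Λ →L[ℂ] Op Λ :=
  ∑ i ∈ A, ∑ k : Fin 3, lindbladian β (1 / β) h.total_isHermitian (siteOp i (pauli k))

/-- The recovery error `‖R_{A,t}[Tr_A[ρ_β] ⊗ τ_A] - ρ_β‖₁`, where `R_{A,t}` is the time average of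
the semigroup generated by `L_A`. -/
def recoveryError (h : LocalHamiltonian Λ Γ) (β : ℝ) (A : Finset Λ) (t : ℝ) : ℝ :=
  traceNorm (timeAverage (h.generator β A) t (refresh A (gibbs β h.total)) - gibbs β h.total)

end LocalHamiltonian

/-- The reference inverse temperature `β₀ = 1/(4d)`. -/
def beta₀ (d : ℕ) : ℝ := 1 / (4 * d)

end

end QuantumGibbs

open QuantumGibbs

/-!
The theorem says that erasing a region `A` of a Gibbs state at any temperature is repaired, up to a
power of `1/t`, by running the detailed-balanced dynamics with jumps in `A` for a random time in
`[0, t]`. The argument runs in the Heisenberg picture, for an observable `O` with `‖O‖ ≤ 1` and its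
time average `X`.

*Detailed balance.* In Bohr components the coherent term combines with the dissipative one
(`lindbladian_eq_sum`), and the KMS form of the Heisenberg generator becomes
`-∑ h_{ν₁ν₂} ⟨[A_{ν₂}, Y], [A_{ν₁}, X]⟩` with a symmetric matrix `h`
(`kmsInner_heisenbergGenerator`). This gives KMS symmetry and stationarity of the Gibbs state.

*Time averages nearly commute with the jumps.* The Heisenberg semigroup is a contraction
(`isDissipative_heisenbergGenerator`), so `‖L'(X)‖ ≤ 2/t` and the Dirichlet form of `X` is at most
`2/t` for each jump (`LocalHamiltonian.dirichletForm_timeAverage_le`). The matrix `h` is an integral of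
Gram matrices, because `sech` is a characteristic function; hence the Dirichlet form bounds the KMS norm
of the commutator of `X` with the part of a jump in a window of Bohr frequencies
(`sq_kmsNorm_commutator_window_le`). Outside the window a jump `a` is exponentially small, since
`e^{κH} a e^{-κH}` is bounded for `|κ| ≤ β₀ = 1/(4d)`: the cluster bound
`LocalHamiltonian.norm_adjointAction_pow_le` makes the series in `κ` geometric. Optimising the width of
the window yields `‖[a, X]‖ ≤ C t^{-2β₀/(β + 5β₀)}` in the KMS norm (`exists_kmsNorm_commutator_le`).

*Recovery.* By duality the recovery error is `|Tr[X†(ρ' - ρ)]|` for some such `X`, where `ρ'` is the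
erased state. Erasure is a mixture of conjugations by Pauli strings of length at most `|A|`
(`refresh_mem_convexHull`), and undoing a string one factor at a time produces at most `|A|` terms
`Tr[Q ρ R [a, X]]` with `Q`, `R` products of jumps (`LocalHamiltonian.recoveryError_le`). If `β/4 ≤ β₀`,
the factors `ρ^{1/4}` can be moved past `Q` and `R`, and the KMS bound on the commutator applies. If
`β/4 > β₀`, then `Q` and `R` are cut off to a frequency window, whose width is balanced against the
cutoff error; this degrades the exponent (`norm_trace_mul_gibbs_mul_mul_le_window`).
-/


namespace QuantumGibbs

/-! ### The hyperbolic secant as a characteristic function -/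

/-- The hyperbolic secant of `β v / 4`, where `v` is a difference of Bohr frequencies. -/
noncomputable def sech (β v : ℝ) : ℝ := (Real.cosh (β * v / 4))⁻¹

/-- The hyperbolic secant is the characteristic function of a probability measure, namely of the
image of the arcsine law `dx / (π √(x(1 - x)))` under `x ↦ (b / 4π) log (x / (1 - x))`: the integral
is a beta integral, evaluated by the reflection formula of the Gamma function. -/
theorem exists_measure_sech (b : ℝ) :
    ∃ μ : Measure ℝ, IsProbabilityMeasure μ ∧
      ∀ v : ℝ, ∫ t : ℝ, Complex.exp (Complex.I * v * t) ∂μ = (sech b v : ℝ) := by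
  unfold sech
  have : IsProbabilityMeasure (ProbabilityTheory.betaMeasure (1 / 2) (1 / 2)) :=
    ProbabilityTheory.isProbabilityMeasureBeta (by norm_num) (by norm_num)
  set ℓ : ℝ → ℝ := fun x => b / (4 * Real.pi) * (Real.log x - Real.log (1 - x)) with hℓ
  have hℓm : Measurable ℓ := by fun_prop
  refine ⟨(ProbabilityTheory.betaMeasure (1 / 2) (1 / 2)).map ℓ,
    Measure.isProbabilityMeasure_map hℓm.aemeasurable, fun v => ?_⟩
  rw [integral_map hℓm.aemeasurable (by fun_prop)]
  have hpi : (0 : ℝ) < Real.pi := Real.pi_pos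
  have hbeta : ProbabilityTheory.beta (1 / 2) (1 / 2) = Real.pi := by
    rw [ProbabilityTheory.beta, Real.Gamma_one_half_eq]
    norm_num [Real.mul_self_sqrt hpi.le]
  rw [ProbabilityTheory.betaMeasure, integral_withDensity_eq_integral_toReal_smul
    (by unfold ProbabilityTheory.betaPDF; fun_prop)
    (by simp [ProbabilityTheory.betaPDF])]
  set τ : ℝ := b * v / (4 * Real.pi) with hτ
  have hint : ∀ x : ℝ, (ProbabilityTheory.betaPDF (1 / 2) (1 / 2) x).toReal •
      Complex.exp (Complex.I * v * (ℓ x : ℝ)) = (Set.Ioo (0 : ℝ) 1).indicator (fun x : ℝ =>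
        (1 / Real.pi : ℂ) * ((x : ℂ) ^ ((1 / 2 + τ * Complex.I : ℂ) - 1) *
          (1 - (x : ℂ)) ^ ((1 / 2 - τ * Complex.I : ℂ) - 1))) x := by
    intro x
    by_cases hx : x ∈ Set.Ioo (0 : ℝ) 1
    · rw [Set.indicator_of_mem hx, ProbabilityTheory.betaPDF_of_pos_lt_one hx.1 hx.2, hbeta]
      have h1x : (0 : ℝ) < 1 - x := by linarith [hx.2]
      have hx0 := hx.1
      rw [ENNReal.toReal_ofReal (by positivity), Complex.real_smul]
      rw [Complex.cpow_def_of_ne_zero (by exact_mod_cast hx0.ne'),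
        Complex.cpow_def_of_ne_zero (by exact_mod_cast h1x.ne')]
      rw [show (1 - (x : ℂ)) = ((1 - x : ℝ) : ℂ) by push_cast; ring,
        ← Complex.ofReal_log hx0.le, ← Complex.ofReal_log h1x.le,
        Real.rpow_def_of_pos hx0, Real.rpow_def_of_pos h1x]
      push_cast
      rw [mul_assoc, mul_assoc, ← Complex.exp_add, ← Complex.exp_add, ← Complex.exp_add]
      congr 2
      rw [hℓ, hτ]
      push_cast
      field_simp
      ring
    · rw [Set.indicator_of_notMem hx, ProbabilityTheory.betaPDF_eq,
        if_neg (show ¬ (0 < x ∧ x < 1) from hx)]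
      simp
  simp_rw [hint]
  rw [integral_indicator measurableSet_Ioo, integral_const_mul, ← integral_Ioc_eq_integral_Ioo,
    ← intervalIntegral.integral_of_le zero_le_one]
  change _ * Complex.betaIntegral _ _ = _
  have h1 := Complex.Gamma_mul_Gamma_eq_betaIntegral (s := 1 / 2 + τ * Complex.I)
    (t := 1 / 2 - τ * Complex.I) (by simp) (by simp)
  have h2 := Complex.Gamma_mul_Gamma_one_sub (1 / 2 + τ * Complex.I)
  rw [show (1 / 2 + τ * Complex.I : ℂ) + (1 / 2 - τ * Complex.I) = 1 by ring, Complex.Gamma_one,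
    one_mul] at h1
  rw [show (1 - (1 / 2 + τ * Complex.I) : ℂ) = 1 / 2 - τ * Complex.I by ring, h1] at h2
  rw [h2, show (Real.pi * (1 / 2 + τ * Complex.I) : ℂ) =
      (Real.pi * τ) * Complex.I + Real.pi / 2 by ring,
    Complex.sin_add_pi_div_two, Complex.cos_mul_I]
  have : (Real.pi * τ : ℂ) = ((b * v / 4 : ℝ) : ℂ) := by
    rw [hτ]; push_cast; field_simp
  rw [this, ← Complex.ofReal_cosh, Complex.ofReal_inv]
  field_simp

/-! ### The Gaussian filter and the transition coefficients -/

theorem filterHat_eq_integral {σ : ℝ} (hσ : 0 < σ) (ω : ℝ) :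
    (filterHat σ ω : ℂ) = ((Real.sqrt (2 * Real.pi))⁻¹ : ℂ) *
      ∫ t : ℝ, Complex.exp (-(Complex.I * ω * t)) * (gaussFilter σ t : ℂ) := by
  have h := fourierIntegral_gaussian (b := ((σ ^ 2 : ℝ) : ℂ)) 
    (by rw [Complex.ofReal_re]; positivity) (-ω)
  have h1 : ∀ t : ℝ, Complex.exp (-(Complex.I * ω * t)) * (gaussFilter σ t : ℂ) =
      (Real.sqrt (σ * Real.sqrt (2 / Real.pi)) : ℂ) *
      (Complex.exp (Complex.I * (-ω : ℂ) * t) * Complex.exp (-((σ ^ 2 : ℝ) : ℂ) * t ^ 2)) := by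
    intro t
    rw [gaussFilter]
    push_cast
    rw [show -(Complex.I * ω * t) = Complex.I * (-ω : ℂ) * t by ring]
    ring
  simp_rw [h1]
  rw [integral_const_mul, h, filterHat]
  have hp := Real.pi_pos
  have h2 : ((Real.pi / ((σ ^ 2 : ℝ) : ℂ)) ^ (1 / 2 : ℂ)) = (Real.sqrt Real.pi / σ : ℝ) := by
    rw [← Complex.ofReal_div, show (1 / 2 : ℂ) = ((1 / 2 : ℝ) : ℂ) by push_cast; ring,
      ← Complex.ofReal_cpow (by positivity), ← Real.sqrt_eq_rpow, Real.sqrt_div hp.le,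
      Real.sqrt_sq hσ.le]
  rw [h2, show (-(-ω : ℂ) ^ 2 / (4 * ((σ ^ 2 : ℝ) : ℂ))) = ((-ω ^ 2 / (4 * σ ^ 2) : ℝ) : ℂ) by
    push_cast; ring, ← Complex.ofReal_exp]
  rw [← Complex.ofReal_inv]
  norm_cast
  have h3 : Real.sqrt (σ * Real.sqrt (2 / Real.pi)) * Real.sqrt (σ * Real.sqrt (2 * Real.pi)) =
      σ * Real.sqrt 2 := by
    rw [← Real.sqrt_mul (by positivity),
      show σ * Real.sqrt (2 / Real.pi) * (σ * Real.sqrt (2 * Real.pi)) =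
        σ ^ 2 * (Real.sqrt (2 / Real.pi) * Real.sqrt (2 * Real.pi)) by ring,
      ← Real.sqrt_mul (by positivity), show (2 / Real.pi * (2 * Real.pi)) = 2 ^ 2 by
        field_simp, Real.sqrt_sq (by norm_num), Real.sqrt_mul (by positivity),
      Real.sqrt_sq hσ.le]
  have h4 : Real.sqrt (2 * Real.pi) = Real.sqrt 2 * Real.sqrt Real.pi :=
    Real.sqrt_mul (by norm_num) _
  have h5 : 0 < Real.sqrt (σ * Real.sqrt (2 * Real.pi)) := by positivity
  have h6 : 0 < Real.sqrt Real.pi := by positivity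
  have h7 : 0 < Real.sqrt 2 := by positivity
  rw [div_eq_iff h5.ne']
  calc Real.exp (-ω ^ 2 / (4 * σ ^ 2)) = Real.exp (-ω ^ 2 / (4 * σ ^ 2)) *
        ((Real.sqrt (2 * Real.pi))⁻¹ * (Real.sqrt Real.pi / σ) * (σ * Real.sqrt 2)) := by
        rw [h4]; field_simp
    _ = _ := by rw [← h3]; ring

theorem integrable_gaussFilter {σ : ℝ} (hσ : 0 < σ) : Integrable (gaussFilter σ) := by
  unfold gaussFilter
  exact (integrable_exp_neg_mul_sq (b := σ ^ 2) (by positivity)).mul_const _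

theorem gaussFilter_nonneg (σ t : ℝ) : 0 ≤ gaussFilter σ t := by
  unfold gaussFilter; positivity

theorem continuous_gaussFilter (σ : ℝ) : Continuous (gaussFilter σ) := by
  unfold gaussFilter; fun_prop

theorem continuous_filterHat (σ : ℝ) : Continuous (filterHat σ) := by
  unfold filterHat; fun_prop

theorem filterHat_nonneg (σ ω : ℝ) : 0 ≤ filterHat σ ω := by
  unfold filterHat; positivity

theorem filterHat_neg (σ ω : ℝ) : filterHat σ (-ω) = filterHat σ ω := by
  unfold filterHat; simp

theorem filterHat_le (σ ω : ℝ) : filterHat σ ω ≤ filterHat σ 0 := by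
  unfold filterHat
  exact div_le_div_of_nonneg_right (Real.exp_le_exp.2 (div_le_div_of_nonneg_right
    (by nlinarith [sq_nonneg ω]) (by positivity))) (by positivity)

theorem integrable_filterHat {σ : ℝ} (hσ : 0 < σ) : Integrable (filterHat σ) := by
  unfold filterHat
  refine Integrable.div_const ?_ _
  have := integrable_exp_neg_mul_sq (b := (4 * σ ^ 2)⁻¹) (by positivity)
  refine this.congr (Filter.Eventually.of_forall fun x => ?_)
  simp only
  congr 1
  ring

/-- An exponential weight shifts the Gaussian: this is how imaginary-time evolution acts on the
filter. -/
theorem exp_mul_filterHat {σ : ℝ} (hσ : 0 < σ) (κ v : ℝ) :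
    Real.exp (κ * v) * filterHat σ v =
      Real.exp (σ ^ 2 * κ ^ 2) * filterHat σ (v - 2 * σ ^ 2 * κ) := by
  unfold filterHat
  rw [← mul_div_assoc, ← mul_div_assoc, ← Real.exp_add, ← Real.exp_add]
  congr 2
  field_simp
  ring

/-- The coefficient `∫ e^{-β|x|/2} f̂(x - ν₁) f̂(x - ν₂) dx`, in which the Metropolis weight is
replaced by an even function; up to the factors of `transitionCoeff_eq` it is the transition
coefficient. -/
noncomputable def symmCoeff (β σ ν₁ ν₂ : ℝ) : ℝ :=
  ∫ x : ℝ, Real.exp (-β * |x| / 2) * filterHat σ (x - ν₁) * filterHat σ (x - ν₂)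

theorem symmCoeff_comm (β σ ν₁ ν₂ : ℝ) : symmCoeff β σ ν₁ ν₂ = symmCoeff β σ ν₂ ν₁ := by
  unfold symmCoeff; congr 1; ext x; ring

theorem symmCoeff_neg (β σ ν₁ ν₂ : ℝ) : symmCoeff β σ (-ν₁) (-ν₂) = symmCoeff β σ ν₁ ν₂ := by
  unfold symmCoeff
  rw [← integral_neg_eq_self]
  congr 1; ext x
  rw [abs_neg, ← filterHat_neg σ (x - ν₁), ← filterHat_neg σ (x - ν₂)]
  congr 3 <;> ring

theorem integrable_mul_filterHat_mul_filterHat {σ : ℝ} (hσ : 0 < σ) {w : ℝ → ℝ} (hw : Continuous w)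
    (h0 : ∀ x, 0 ≤ w x) (h1 : ∀ x, w x ≤ 1) (ν₁ ν₂ : ℝ) :
    Integrable fun x => w x * filterHat σ (x - ν₁) * filterHat σ (x - ν₂) := by
  have hc := continuous_filterHat σ
  refine Integrable.mono' (((integrable_filterHat hσ).comp_sub_right ν₁).mul_const (filterHat σ 0))
    (Continuous.aestronglyMeasurable (by fun_prop)) (Filter.Eventually.of_forall fun x => ?_)
  have a := filterHat_nonneg σ (x - ν₁)
  have b := filterHat_nonneg σ (x - ν₂)
  rw [Real.norm_of_nonneg (mul_nonneg (mul_nonneg (h0 x) a) b)]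
  have := filterHat_le σ (x - ν₂)
  calc _ ≤ 1 * filterHat σ (x - ν₁) * filterHat σ 0 := by gcongr; exact h1 x
    _ = _ := by ring

theorem integrable_symmCoeff {β σ : ℝ} (hβ : 0 < β) (hσ : 0 < σ) (ν₁ ν₂ : ℝ) :
    Integrable fun x => Real.exp (-β * |x| / 2) * filterHat σ (x - ν₁) * filterHat σ (x - ν₂) := by
  refine integrable_mul_filterHat_mul_filterHat hσ (by fun_prop) (fun x => (Real.exp_pos _).le)
    (fun x => Real.exp_le_one_iff.2 ?_) ν₁ ν₂
  have := abs_nonneg x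
  nlinarith

theorem metropolis_nonneg (β σ ω : ℝ) : 0 ≤ metropolis β σ ω := (Real.exp_pos _).le

theorem metropolis_le_one {β : ℝ} (hβ : 0 < β) (σ ω : ℝ) : metropolis β σ ω ≤ 1 := by
  unfold metropolis
  refine Real.exp_le_one_iff.2 ?_
  have := le_max_right (ω + β * σ ^ 2 / 2) 0
  nlinarith

theorem continuous_metropolis (β σ : ℝ) : Continuous (metropolis β σ) := by
  unfold metropolis; fun_prop

theorem integrable_transitionCoeff {β σ : ℝ} (hβ : 0 < β) (hσ : 0 < σ) (ν₁ ν₂ : ℝ) :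
    Integrable fun x => metropolis β σ x * filterHat σ (x - ν₁) * filterHat σ (x - ν₂) :=
  integrable_mul_filterHat_mul_filterHat hσ (continuous_metropolis β σ) (metropolis_nonneg β σ)
    (metropolis_le_one hβ σ) ν₁ ν₂

/-- After a shift by `βσ²/2` the Metropolis weight is `e^{-β max(x, 0)} = e^{-βx/2} e^{-β|x|/2}`. -/
theorem transitionCoeff_eq {β σ : ℝ} (hσ : 0 < σ) (ν₁ ν₂ : ℝ) :
    transitionCoeff β σ ν₁ ν₂ = Real.exp (-(β ^ 2 * σ ^ 2 / 8)) *
      Real.exp (-β * (ν₁ + ν₂) / 4) * symmCoeff β σ ν₁ ν₂ := by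
  unfold transitionCoeff symmCoeff
  rw [← integral_const_mul]
  rw [← integral_add_right_eq_self _ (-(β * σ ^ 2 / 2))]
  congr 1; ext x
  unfold metropolis filterHat
  rw [show x + -(β * σ ^ 2 / 2) + β * σ ^ 2 / 2 = x by ring]
  have hm : max x 0 = (x + |x|) / 2 := by
    rcases le_total x 0 with h | h
    · rw [max_eq_right h, abs_of_nonpos h]; ring
    · rw [max_eq_left h, abs_of_nonneg h]; ring
  rw [hm]
  simp only [div_eq_mul_inv (Real.exp _)]
  rw [show ∀ a b c d : ℝ, a * (b * c) * (d * c) = a * b * d * (c * c) by intros; ring]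
  rw [show ∀ e f a b c d : ℝ, e * f * (a * (b * c) * (d * c)) =
    e * f * a * b * d * (c * c) by intros; ring]
  congr 1
  simp only [← Real.exp_add]
  congr 1
  field_simp
  ring

/-! ### The Bohr decomposition -/

section Bohr

variable {n : Type*} [Fintype n] [DecidableEq n] {H : Matrix n n ℂ}

theorem exp_smul_mul_exp_smul (H : Matrix n n ℂ) (z w : ℂ) :
    NormedSpace.exp (z • H) * NormedSpace.exp (w • H) = NormedSpace.exp ((z + w) • H) := by
  rw [add_smul, Matrix.exp_add_of_commute _ _ ((Commute.refl H).smul_left z |>.smul_right w)]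

theorem exp_smul_mul_exp_neg_smul (H : Matrix n n ℂ) (z : ℂ) :
    NormedSpace.exp (z • H) * NormedSpace.exp ((-z) • H) = 1 := by
  rw [exp_smul_mul_exp_smul, add_neg_cancel, zero_smul, NormedSpace.exp_zero]

theorem conjTranspose_exp_smul (hH : H.IsHermitian) (z : ℂ) :
    (NormedSpace.exp (z • H))ᴴ = NormedSpace.exp ((star z) • H) := by
  rw [← Matrix.exp_conjTranspose, Matrix.conjTranspose_smul, hH.eq]

theorem exp_smul_mul_of_mul_eq {P : Matrix n n ℂ} {E : ℂ} (h : H * P = E • P) (z : ℂ) :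
    NormedSpace.exp (z • H) * P = Complex.exp (z * E) • P := by
  have hpow : ∀ k : ℕ, (z • H) ^ k * P = (z * E) ^ k • P := by
    intro k
    induction k with
    | zero => simp
    | succ k ih =>
      rw [pow_succ, mul_assoc, Matrix.smul_mul, h, smul_smul, Matrix.mul_smul, ih, smul_smul]
      congr 1; ring
  have h1 := (NormedSpace.exp_series_hasSum_exp' (𝕂 := ℂ) (z • H)).mul_right P
  have h2 := (NormedSpace.exp_series_hasSum_exp' (𝕂 := ℂ) (z * E)).smul_const P
  rw [← Complex.exp_eq_exp_ℂ] at h2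
  have h3 : (fun k : ℕ => ((k.factorial : ℂ)⁻¹ • (z • H) ^ k) * P) =
      fun k : ℕ => ((k.factorial : ℂ)⁻¹ • (z * E) ^ k) • P := by
    funext k
    rw [Matrix.smul_mul, hpow, smul_assoc]
  rw [h3] at h1
  exact h1.unique h2

theorem conjTranspose_energyProj (hH : H.IsHermitian) (E : ℝ) :
    (energyProj hH E)ᴴ = energyProj hH E := by
  unfold energyProj
  rw [Matrix.conjTranspose_sum]
  refine Finset.sum_congr rfl fun i _ => ?_
  rw [Matrix.conjTranspose_vecMulVec, star_star]

theorem mul_energyProj (hH : H.IsHermitian) (E : ℝ) :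
    H * energyProj hH E = (E : ℂ) • energyProj hH E := by
  unfold energyProj
  rw [Finset.mul_sum, Finset.smul_sum]
  refine Finset.sum_congr rfl fun i hi => ?_
  rw [Matrix.mul_vecMulVec, hH.mulVec_eigenvectorBasis, ← (Finset.mem_filter.1 hi).2]
  ext a b
  simp [Matrix.vecMulVec_apply, mul_assoc]

theorem sum_energyProj (hH : H.IsHermitian) : ∑ E ∈ energies hH, energyProj hH E = 1 := by
  unfold energyProj energies
  rw [Finset.sum_fiberwise_of_maps_to (fun i _ => Finset.mem_image_of_mem _ (Finset.mem_univ i))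
    (fun i => Matrix.vecMulVec (hH.eigenvectorBasis i) (star (hH.eigenvectorBasis i : n → ℂ)))]
  have h : (hH.eigenvectorUnitary : Matrix n n ℂ) * (hH.eigenvectorUnitary : Matrix n n ℂ)ᴴ = 1 :=
    Unitary.mul_star_self_of_mem hH.eigenvectorUnitary.2
  rw [← h]
  ext a b
  simp [Matrix.sum_apply, Matrix.vecMulVec_apply, Matrix.mul_apply,
    Matrix.IsHermitian.eigenvectorUnitary_apply]

theorem exp_smul_mul_energyProj (hH : H.IsHermitian) (E : ℝ) (z : ℂ) :
    NormedSpace.exp (z • H) * energyProj hH E = Complex.exp (z * E) • energyProj hH E :=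
  exp_smul_mul_of_mul_eq (mul_energyProj hH E) z

theorem energyProj_mul_exp_smul (hH : H.IsHermitian) (E : ℝ) (z : ℂ) :
    energyProj hH E * NormedSpace.exp (z • H) = Complex.exp (z * E) • energyProj hH E := by
  have h := congrArg Matrix.conjTranspose (exp_smul_mul_energyProj hH E (star z))
  rw [Matrix.conjTranspose_mul, conjTranspose_exp_smul hH, star_star,
    conjTranspose_energyProj, Matrix.conjTranspose_smul, conjTranspose_energyProj] at h
  rw [h]
  congr 1
  rw [Complex.star_def, ← Complex.exp_conj]
  simp

theorem neg_mem_bohr (hH : H.IsHermitian) {ν : ℝ} (h : ν ∈ bohr hH) : -ν ∈ bohr hH := by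
  unfold bohr at *
  simp only [Finset.mem_image, Finset.mem_product, Prod.exists] at *
  obtain ⟨a, b, ⟨ha, hb⟩, rfl⟩ := h
  exact ⟨b, a, ⟨hb, ha⟩, by ring⟩

theorem sum_bohr_neg (hH : H.IsHermitian) {M : Type*} [AddCommMonoid M] (f : ℝ → M) :
    ∑ ν ∈ bohr hH, f (-ν) = ∑ ν ∈ bohr hH, f ν :=
  Finset.sum_nbij' (fun ν => -ν) (fun ν => -ν) (fun _ h => neg_mem_bohr hH h)
    (fun _ h => neg_mem_bohr hH h) (by simp) (by simp) (by simp)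

theorem sum_bohrPart (hH : H.IsHermitian) (A : Matrix n n ℂ) :
    ∑ ν ∈ bohr hH, bohrPart hH A ν = A := by
  unfold bohrPart bohr
  rw [Finset.sum_fiberwise_of_maps_to (fun p hp => Finset.mem_image_of_mem _ hp)
    (fun p : ℝ × ℝ => energyProj hH p.2 * A * energyProj hH p.1), Finset.sum_product_right]
  simp_rw [← Finset.mul_sum, ← Finset.sum_mul, sum_energyProj, one_mul, mul_one]

theorem exp_mul_bohrPart (hH : H.IsHermitian) (A : Matrix n n ℂ) (ν : ℝ) (z : ℂ) :
    NormedSpace.exp (z • H) * bohrPart hH A ν =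
      Complex.exp (z * ν) • (bohrPart hH A ν * NormedSpace.exp (z • H)) := by
  unfold bohrPart
  rw [Finset.mul_sum, Finset.sum_mul, Finset.smul_sum]
  refine Finset.sum_congr rfl fun p hp => ?_
  rw [← mul_assoc, ← mul_assoc, exp_smul_mul_energyProj, mul_assoc _ _ (NormedSpace.exp _),
    energyProj_mul_exp_smul, ← (Finset.mem_filter.1 hp).2, Matrix.smul_mul, Matrix.smul_mul,
    Matrix.mul_smul, smul_smul, ← Complex.exp_add]
  congr 2
  push_cast; ring

theorem exp_mul_bohrPart_mul_exp (hH : H.IsHermitian) (A : Matrix n n ℂ) (ν : ℝ) (z : ℂ) :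
    NormedSpace.exp (z • H) * bohrPart hH A ν * NormedSpace.exp ((-z) • H) =
      Complex.exp (z * ν) • bohrPart hH A ν := by
  rw [exp_mul_bohrPart, Matrix.smul_mul, mul_assoc, exp_smul_mul_exp_neg_smul, mul_one]

theorem conjTranspose_bohrPart (hH : H.IsHermitian) (A : Matrix n n ℂ) (ν : ℝ) :
    (bohrPart hH A ν)ᴴ = bohrPart hH Aᴴ (-ν) := by
  unfold bohrPart
  rw [Matrix.conjTranspose_sum]
  refine Finset.sum_nbij' Prod.swap Prod.swap ?_ ?_ (by simp) (by simp) ?_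
  · intro p hp
    simp only [Finset.mem_filter, Finset.mem_product, Prod.fst_swap, Prod.snd_swap] at *
    exact ⟨hp.1.symm, by linarith [hp.2]⟩
  · intro p hp
    simp only [Finset.mem_filter, Finset.mem_product, Prod.fst_swap, Prod.snd_swap] at *
    exact ⟨hp.1.symm, by linarith [hp.2]⟩
  · intro p _
    simp [Matrix.conjTranspose_mul, conjTranspose_energyProj, mul_assoc]

theorem exp_mul_mul_exp_eq_sum (hH : H.IsHermitian) (A : Matrix n n ℂ) (z : ℂ) :
    NormedSpace.exp (z • H) * A * NormedSpace.exp ((-z) • H) =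
      ∑ ν ∈ bohr hH, Complex.exp (z * ν) • bohrPart hH A ν := by
  conv_lhs => rw [← sum_bohrPart hH A]
  rw [Finset.mul_sum, Finset.sum_mul]
  exact Finset.sum_congr rfl fun ν _ => exp_mul_bohrPart_mul_exp hH A ν z

theorem exp_mul_sum_bohrPart_mul_exp (hH : H.IsHermitian) (A : Matrix n n ℂ) (c : ℝ → ℂ) (z : ℂ) :
    NormedSpace.exp (z • H) * (∑ ν ∈ bohr hH, c ν • bohrPart hH A ν) *
      NormedSpace.exp ((-z) • H) =
      ∑ ν ∈ bohr hH, (c ν * Complex.exp (z * ν)) • bohrPart hH A ν := by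
  rw [Finset.mul_sum, Finset.sum_mul]
  refine Finset.sum_congr rfl fun ν _ => ?_
  rw [Matrix.mul_smul, Matrix.smul_mul, exp_mul_bohrPart_mul_exp, smul_smul]

theorem integrable_phase_mul_gaussFilter {σ : ℝ} (hσ : 0 < σ) (ω : ℝ) :
    Integrable fun t : ℝ => Complex.exp (-(Complex.I * ω * t)) * (gaussFilter σ t : ℂ) := by
  refine (integrable_gaussFilter hσ).mono' (Continuous.aestronglyMeasurable ?_)
    (Filter.Eventually.of_forall fun t => ?_)
  · have := continuous_gaussFilter σ
    fun_prop
  · rw [norm_mul, Complex.norm_exp, Complex.norm_of_nonneg (gaussFilter_nonneg σ t)]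
    simp

theorem heisenberg_eq_sum (hH : H.IsHermitian) (A : Matrix n n ℂ) (t : ℝ) :
    heisenberg H A t = ∑ ν ∈ bohr hH, Complex.exp (Complex.I * t * ν) • bohrPart hH A ν :=
  exp_mul_mul_exp_eq_sum hH A _

theorem oft_eq_sum {σ : ℝ} (hσ : 0 < σ) (hH : H.IsHermitian) (A : Matrix n n ℂ) (ω : ℝ) :
    oft σ H A ω = ∑ ν ∈ bohr hH, (filterHat σ (ω - ν) : ℂ) • bohrPart hH A ν := by
  unfold oft
  simp_rw [heisenberg_eq_sum hH, Finset.smul_sum, smul_smul]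
  have he : ∀ (ν t : ℝ), Complex.exp (-(Complex.I * ω * t)) * (gaussFilter σ t : ℂ) *
      Complex.exp (Complex.I * t * ν) =
      Complex.exp (-(Complex.I * (ω - ν : ℝ) * t)) * (gaussFilter σ t : ℂ) := by
    intro ν t
    rw [mul_right_comm, ← Complex.exp_add]
    congr 2; push_cast; ring
  simp_rw [he]
  rw [integral_finsetSum _ fun ν _ => (integrable_phase_mul_gaussFilter hσ _).smul_const _,
    Finset.smul_sum]
  refine Finset.sum_congr rfl fun ν _ => ?_
  rw [integral_smul_const, smul_smul, ← filterHat_eq_integral hσ]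

theorem exp_I_mem_unitary (hH : H.IsHermitian) (t : ℝ) :
    NormedSpace.exp ((Complex.I * t) • H) ∈ unitary (Matrix n n ℂ) := by
  have h1 : star (NormedSpace.exp ((Complex.I * t) • H)) =
      NormedSpace.exp ((-(Complex.I * t)) • H) := by
    rw [Matrix.star_eq_conjTranspose, conjTranspose_exp_smul hH]
    congr 2; simp
  rw [Unitary.mem_iff, h1]
  refine ⟨?_, exp_smul_mul_exp_neg_smul H _⟩
  have := exp_smul_mul_exp_neg_smul H (-(Complex.I * t))
  rwa [neg_neg] at this

theorem norm_heisenberg (hH : H.IsHermitian) (A : Matrix n n ℂ) (t : ℝ) :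
    ‖heisenberg H A t‖ = ‖A‖ := by
  unfold heisenberg
  have h1 := exp_I_mem_unitary hH t
  have h2 := exp_I_mem_unitary hH (-t)
  rw [show (-(Complex.I * t)) = Complex.I * ((-t : ℝ) : ℂ) by push_cast; ring,
    CStarRing.norm_mul_mem_unitary _ h2, CStarRing.norm_mem_unitary_mul _ h1]

/-- The operator Fourier transform is bounded by the norm of the operator times `f̂(0)`, since the
filter is nonnegative with `f̂(0) = (2π)^{-1/2} ∫ f`. -/
theorem norm_oft_le {σ : ℝ} (hσ : 0 < σ) (hH : H.IsHermitian) (A : Matrix n n ℂ) (ω : ℝ) :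
    ‖oft σ H A ω‖ ≤ filterHat σ 0 * ‖A‖ := by
  have h0 : filterHat σ 0 = (Real.sqrt (2 * Real.pi))⁻¹ * ∫ t : ℝ, gaussFilter σ t := by
    have := filterHat_eq_integral hσ 0
    simp only [Complex.ofReal_zero, mul_zero, zero_mul, neg_zero, Complex.exp_zero, one_mul,
      integral_complex_ofReal] at this
    exact_mod_cast this
  unfold oft
  rw [norm_smul, h0, mul_assoc]
  have h1 : ‖((Real.sqrt (2 * Real.pi))⁻¹ : ℂ)‖ = (Real.sqrt (2 * Real.pi))⁻¹ := by
    rw [norm_inv, Complex.norm_of_nonneg (Real.sqrt_nonneg _)]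
  rw [h1]
  refine mul_le_mul_of_nonneg_left ?_ (by positivity)
  rw [← integral_mul_const]
  refine norm_integral_le_of_norm_le ((integrable_gaussFilter hσ).mul_const _)
    (Filter.Eventually.of_forall fun t => ?_)
  rw [norm_smul, norm_heisenberg hH, norm_mul, Complex.norm_exp,
    Complex.norm_of_nonneg (gaussFilter_nonneg σ t)]
  simp

end Bohr

/-! ### The coefficients of the generator -/

section Coefficients

/-- The coefficients `h_{ν₁ν₂} = ½ e^{-β²σ²/8} sech(β(ν₁ - ν₂)/4) ∫ e^{-β|x|/2} f̂(x - ν₁) f̂(x - ν₂) dx`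
of the Dirichlet form; see `kmsInner_heisenbergGenerator`. -/
noncomputable def dirichletCoeff (β σ ν₁ ν₂ : ℝ) : ℝ :=
  Real.exp (-(β ^ 2 * σ ^ 2 / 8)) / 2 * (Real.cosh (β * (ν₁ - ν₂) / 4))⁻¹ * symmCoeff β σ ν₁ ν₂

theorem dirichletCoeff_comm (β σ ν₁ ν₂ : ℝ) :
    dirichletCoeff β σ ν₁ ν₂ = dirichletCoeff β σ ν₂ ν₁ := by
  unfold dirichletCoeff
  rw [symmCoeff_comm, ← Real.cosh_neg]
  congr 4; ring

theorem dirichletCoeff_neg (β σ ν₁ ν₂ : ℝ) :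
    dirichletCoeff β σ (-ν₁) (-ν₂) = dirichletCoeff β σ ν₁ ν₂ := by
  unfold dirichletCoeff
  rw [symmCoeff_neg, ← Real.cosh_neg]
  congr 4; ring

/-- The hyperbolic tangent in the coherent term turns half of the transition coefficient into
`h_{ν₁ν₂} e^{-βν₁/2}`, because `1 - tanh x = e^{-x} sech x`. -/
theorem transitionCoeff_mul_one_sub_tanh {β σ : ℝ} (hσ : 0 < σ) (ν₁ ν₂ : ℝ) :
    transitionCoeff β σ ν₁ ν₂ * (1 - Real.tanh (β * (ν₁ - ν₂) / 4)) / 2 =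
      dirichletCoeff β σ ν₁ ν₂ * Real.exp (-β * ν₁ / 2) := by
  rw [transitionCoeff_eq hσ, dirichletCoeff]
  have hc := (Real.cosh_pos (β * (ν₁ - ν₂) / 4)).ne'
  have h1 : 1 - Real.tanh (β * (ν₁ - ν₂) / 4) =
      Real.exp (-(β * (ν₁ - ν₂) / 4)) * (Real.cosh (β * (ν₁ - ν₂) / 4))⁻¹ := by
    rw [Real.tanh_eq_sinh_div_cosh, ← Real.cosh_sub_sinh]; field_simp
  rw [h1, show -β * ν₁ / 2 = -β * (ν₁ + ν₂) / 4 + -(β * (ν₁ - ν₂) / 4) by ring, Real.exp_add]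
  ring

theorem transitionCoeff_mul_one_add_tanh {β σ : ℝ} (hσ : 0 < σ) (ν₁ ν₂ : ℝ) :
    transitionCoeff β σ ν₁ ν₂ * (1 + Real.tanh (β * (ν₁ - ν₂) / 4)) / 2 =
      dirichletCoeff β σ ν₁ ν₂ * Real.exp (-β * ν₂ / 2) := by
  rw [transitionCoeff_eq hσ, dirichletCoeff]
  have hc := (Real.cosh_pos (β * (ν₁ - ν₂) / 4)).ne'
  have h1 : 1 + Real.tanh (β * (ν₁ - ν₂) / 4) =
      Real.exp (β * (ν₁ - ν₂) / 4) * (Real.cosh (β * (ν₁ - ν₂) / 4))⁻¹ := by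
    rw [Real.tanh_eq_sinh_div_cosh, ← Real.cosh_add_sinh]; field_simp
  rw [h1, show -β * ν₂ / 2 = -β * (ν₁ + ν₂) / 4 + (β * (ν₁ - ν₂) / 4) by ring, Real.exp_add]
  ring

theorem transitionCoeff_eq_dirichletCoeff {β σ : ℝ} (hσ : 0 < σ) (ν₁ ν₂ : ℝ) :
    transitionCoeff β σ ν₁ ν₂ =
      dirichletCoeff β σ ν₁ ν₂ * (Real.exp (-β * ν₁ / 2) + Real.exp (-β * ν₂ / 2)) := by
  rw [mul_add, ← transitionCoeff_mul_one_sub_tanh hσ, ← transitionCoeff_mul_one_add_tanh hσ]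
  ring

end Coefficients

/-! ### The Lindbladian in the two pictures -/

section Generator

variable {n : Type*} [Fintype n] [DecidableEq n] {H : Matrix n n ℂ}

@[simp]
theorem sandwich_apply (a b X : Matrix n n ℂ) : sandwich a b X = a * X * b := rfl

/-- The Lindbladian in Bohr components: with `ε_j = e^{-βν_j/2}` it is
`∑ h_{ν₁ν₂} ((ε₁ + ε₂) A_{ν₁} (·) A_{ν₂}† - ε₁ A_{ν₂}† A_{ν₁} (·) - ε₂ (·) A_{ν₂}† A_{ν₁})`, the
coherent term being absorbed into the asymmetry of the last two terms. -/
theorem lindbladian_eq_sum {β σ : ℝ} (hβ : 0 < β) (hσ : 0 < σ) (hH : H.IsHermitian)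
    (A : Matrix n n ℂ) :
    lindbladian β σ hH A = ∑ ν₁ ∈ bohr hH, ∑ ν₂ ∈ bohr hH,
      ((dirichletCoeff β σ ν₁ ν₂ : ℝ) : ℂ) •
      (((Real.exp (-β * ν₁ / 2) + Real.exp (-β * ν₂ / 2) : ℝ) : ℂ) •
          sandwich (bohrPart hH A ν₁) (bohrPart hH A ν₂)ᴴ
        - ((Real.exp (-β * ν₁ / 2) : ℝ) : ℂ) •
          sandwich ((bohrPart hH A ν₂)ᴴ * bohrPart hH A ν₁) 1
        - ((Real.exp (-β * ν₂ / 2) : ℝ) : ℂ) •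
          sandwich 1 ((bohrPart hH A ν₂)ᴴ * bohrPart hH A ν₁)) := by
  set T : ℝ → ℝ → (Matrix n n ℂ →L[ℂ] Matrix n n ℂ) := fun ν₁ ν₂ =>
    sandwich (bohrPart hH A ν₁) (bohrPart hH A ν₂)ᴴ - (1 / 2 : ℂ) •
      (sandwich ((bohrPart hH A ν₂)ᴴ * bohrPart hH A ν₁) 1 +
        sandwich 1 ((bohrPart hH A ν₂)ᴴ * bohrPart hH A ν₁)) with hT
  have h1 : ∀ ω : ℝ, (metropolis β σ ω : ℂ) •
      (sandwich (oft σ H A ω) (oft σ H A ω)ᴴ -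
        (1 / 2 : ℂ) • (sandwich ((oft σ H A ω)ᴴ * oft σ H A ω) 1 +
          sandwich 1 ((oft σ H A ω)ᴴ * oft σ H A ω))) =
      ∑ ν₁ ∈ bohr hH, ∑ ν₂ ∈ bohr hH,
        ((metropolis β σ ω * filterHat σ (ω - ν₁) * filterHat σ (ω - ν₂) : ℝ) : ℂ) • T ν₁ ν₂ := by
    intro ω
    have hs : (oft σ H A ω)ᴴ =
        ∑ ν ∈ bohr hH, (filterHat σ (ω - ν) : ℂ) • (bohrPart hH A ν)ᴴ := by
      rw [oft_eq_sum hσ hH, Matrix.conjTranspose_sum]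
      refine Finset.sum_congr rfl fun ν _ => ?_
      rw [Matrix.conjTranspose_smul]; simp
    have e1 : ∀ X : Matrix n n ℂ, oft σ H A ω * X * (oft σ H A ω)ᴴ =
        ∑ ν₁ ∈ bohr hH, ∑ ν₂ ∈ bohr hH,
          ((filterHat σ (ω - ν₁) * filterHat σ (ω - ν₂) : ℝ) : ℂ) •
            (bohrPart hH A ν₁ * X * (bohrPart hH A ν₂)ᴴ) := by
      intro X
      rw [hs, oft_eq_sum hσ hH]
      simp only [Finset.sum_mul, Finset.mul_sum, Matrix.smul_mul, Matrix.mul_smul, smul_smul]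
      rw [Finset.sum_comm]
      push_cast
      simp only [mul_comm]
    have e2 : (oft σ H A ω)ᴴ * oft σ H A ω =
        ∑ ν₁ ∈ bohr hH, ∑ ν₂ ∈ bohr hH,
          ((filterHat σ (ω - ν₁) * filterHat σ (ω - ν₂) : ℝ) : ℂ) •
            ((bohrPart hH A ν₂)ᴴ * bohrPart hH A ν₁) := by
      rw [hs, oft_eq_sum hσ hH]
      simp only [Finset.sum_mul, Finset.mul_sum, Matrix.smul_mul, Matrix.mul_smul, smul_smul]
      push_cast
      rfl
    ext1 X
    simp only [hT, smul_apply, sub_apply,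
      add_apply, sum_apply, sandwich_apply, e1, e2,
      Finset.smul_sum, Finset.sum_mul, Finset.mul_sum, ← Finset.sum_sub_distrib,
      ← Finset.sum_add_distrib, one_mul, mul_one, Matrix.smul_mul, Matrix.mul_smul]
    refine Finset.sum_congr rfl fun ν₁ _ => Finset.sum_congr rfl fun ν₂ _ => ?_
    push_cast
    module
  have h2 : (∫ ω : ℝ, (metropolis β σ ω : ℂ) •
      (sandwich (oft σ H A ω) (oft σ H A ω)ᴴ -
        (1 / 2 : ℂ) • (sandwich ((oft σ H A ω)ᴴ * oft σ H A ω) 1 +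
          sandwich 1 ((oft σ H A ω)ᴴ * oft σ H A ω)))) =
      ∑ ν₁ ∈ bohr hH, ∑ ν₂ ∈ bohr hH, (transitionCoeff β σ ν₁ ν₂ : ℂ) • T ν₁ ν₂ := by
    simp_rw [h1]
    have hi : ∀ ν₁ ν₂ : ℝ, Integrable fun ω : ℝ =>
        ((metropolis β σ ω * filterHat σ (ω - ν₁) * filterHat σ (ω - ν₂) : ℝ) : ℂ) • T ν₁ ν₂ :=
      fun ν₁ ν₂ => (integrable_transitionCoeff hβ hσ ν₁ ν₂).ofReal.smul_const (T ν₁ ν₂)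
    rw [integral_finsetSum _ fun ν₁ _ => integrable_finsetSum _ fun ν₂ _ => hi ν₁ ν₂]
    refine Finset.sum_congr rfl fun ν₁ _ => ?_
    rw [integral_finsetSum _ fun ν₂ _ => hi ν₁ ν₂]
    refine Finset.sum_congr rfl fun ν₂ _ => ?_
    rw [integral_smul_const, integral_complex_ofReal]
    rfl
  unfold lindbladian
  rw [h2]
  ext1 X
  simp only [coherent, hT, smul_apply, sub_apply,
    add_apply, sum_apply, sandwich_apply,
    Finset.smul_sum, Finset.sum_mul, Finset.mul_sum, ← Finset.sum_sub_distrib,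
    ← Finset.sum_add_distrib, one_mul, mul_one, Matrix.smul_mul, Matrix.mul_smul]
  refine Finset.sum_congr rfl fun ν₁ _ => Finset.sum_congr rfl fun ν₂ _ => ?_
  have c1 : ((dirichletCoeff β σ ν₁ ν₂ : ℝ) : ℂ) * ((Real.exp (-β * ν₁ / 2) : ℝ) : ℂ) =
      (transitionCoeff β σ ν₁ ν₂ : ℂ) * (1 - (Real.tanh (β * (ν₁ - ν₂) / 4) : ℝ)) / 2 := by
    have := transitionCoeff_mul_one_sub_tanh (β := β) hσ ν₁ ν₂
    exact_mod_cast this.symm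
  have c2 : ((dirichletCoeff β σ ν₁ ν₂ : ℝ) : ℂ) * ((Real.exp (-β * ν₂ / 2) : ℝ) : ℂ) =
      (transitionCoeff β σ ν₁ ν₂ : ℂ) * (1 + (Real.tanh (β * (ν₁ - ν₂) / 4) : ℝ)) / 2 := by
    have := transitionCoeff_mul_one_add_tanh (β := β) hσ ν₁ ν₂
    exact_mod_cast this.symm
  simp only [smul_sub, smul_add, smul_smul, Complex.ofReal_add, mul_add, c1, c2, Complex.ofReal_mul]
  have hI : ∀ x : ℂ, -Complex.I * (Complex.I / 2 * x) = x / 2 := by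
    intro x
    linear_combination (-x / 2) * Complex.I_sq
  simp only [hI]
  module

/-- The Lindbladian in the Heisenberg picture, in Bohr components; it is the Hilbert–Schmidt adjoint
of `lindbladian β σ hH A` by `isTraceAdjoint_lindbladian`. -/
noncomputable def heisenbergGenerator (β σ : ℝ) (hH : H.IsHermitian) (A : Matrix n n ℂ) :
    Matrix n n ℂ →L[ℂ] Matrix n n ℂ :=
  ∑ ν₁ ∈ bohr hH, ∑ ν₂ ∈ bohr hH, ((dirichletCoeff β σ ν₁ ν₂ : ℝ) : ℂ) •
      (((Real.exp (-β * ν₁ / 2) + Real.exp (-β * ν₂ / 2) : ℝ) : ℂ) •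
          sandwich (bohrPart hH A ν₂)ᴴ (bohrPart hH A ν₁)
        - ((Real.exp (-β * ν₂ / 2) : ℝ) : ℂ) •
          sandwich ((bohrPart hH A ν₂)ᴴ * bohrPart hH A ν₁) 1
        - ((Real.exp (-β * ν₁ / 2) : ℝ) : ℂ) •
          sandwich 1 ((bohrPart hH A ν₂)ᴴ * bohrPart hH A ν₁))

theorem heisenbergGenerator_one (β σ : ℝ) (hH : H.IsHermitian) (A : Matrix n n ℂ) :
    heisenbergGenerator β σ hH A 1 = 0 := by
  simp only [heisenbergGenerator, smul_apply, sub_apply,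
    sum_apply, sandwich_apply, mul_one, one_mul]
  refine Finset.sum_eq_zero fun ν₁ _ => Finset.sum_eq_zero fun ν₂ _ => ?_
  push_cast
  module

/-- `L'` is the adjoint of `L` for the Hilbert–Schmidt inner product `Tr[X† Y]`. -/
def IsTraceAdjoint (L L' : Matrix n n ℂ →L[ℂ] Matrix n n ℂ) : Prop :=
  ∀ X Y, ((L' X)ᴴ * Y).trace = (Xᴴ * L Y).trace

theorem IsTraceAdjoint.add {L₁ L₁' L₂ L₂' : Matrix n n ℂ →L[ℂ] Matrix n n ℂ}
    (h₁ : IsTraceAdjoint L₁ L₁') (h₂ : IsTraceAdjoint L₂ L₂') :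
    IsTraceAdjoint (L₁ + L₂) (L₁' + L₂') := by
  intro X Y
  simp [Matrix.conjTranspose_add, add_mul, mul_add, Matrix.trace_add, h₁ X Y, h₂ X Y]

theorem IsTraceAdjoint.zero :
    IsTraceAdjoint (0 : Matrix n n ℂ →L[ℂ] Matrix n n ℂ) 0 := by
  intro X Y; simp

theorem IsTraceAdjoint.sum {ι : Type*} {s : Finset ι}
    {L L' : ι → (Matrix n n ℂ →L[ℂ] Matrix n n ℂ)}
    (h : ∀ i ∈ s, IsTraceAdjoint (L i) (L' i)) :
    IsTraceAdjoint (∑ i ∈ s, L i) (∑ i ∈ s, L' i) := by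
  classical
  induction s using Finset.induction_on with
  | empty => simpa using IsTraceAdjoint.zero
  | insert a s ha ih =>
    rw [Finset.sum_insert ha, Finset.sum_insert ha]
    exact (h a (Finset.mem_insert_self a s)).add
      (ih fun i hi => h i (Finset.mem_insert_of_mem hi))

omit [DecidableEq n] in
open scoped ComplexOrder in
theorem eq_of_forall_trace_mul_eq {P Q : Matrix n n ℂ}
    (h : ∀ Y : Matrix n n ℂ, (Pᴴ * Y).trace = (Qᴴ * Y).trace) : P = Q := by
  have h1 : ((P - Q)ᴴ * (P - Q)).trace = 0 := by
    rw [Matrix.conjTranspose_sub, sub_mul, Matrix.trace_sub, h, sub_self]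
  exact sub_eq_zero.1 (Matrix.trace_conjTranspose_mul_self_eq_zero_iff.1 h1)

theorem IsTraceAdjoint.hsAdjoint_eq {L L' : Matrix n n ℂ →L[ℂ] Matrix n n ℂ}
    (h : IsTraceAdjoint L L') (X : Matrix n n ℂ) : hsAdjoint L X = L' X :=
  eq_of_forall_trace_mul_eq fun Y => by rw [trace_hsAdjoint, h X Y]

theorem isTraceAdjoint_lindbladian {β σ : ℝ} (hβ : 0 < β) (hσ : 0 < σ) (hH : H.IsHermitian)
    (A : Matrix n n ℂ) :
    IsTraceAdjoint (lindbladian β σ hH A) (heisenbergGenerator β σ hH A) := by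
  intro X Y
  rw [lindbladian_eq_sum hβ hσ, heisenbergGenerator]
  simp only [smul_apply, sub_apply,
    sum_apply, sandwich_apply, mul_one, one_mul, Matrix.conjTranspose_sum,
    Finset.sum_mul, Finset.mul_sum, Matrix.trace_sum, Matrix.conjTranspose_smul,
    Matrix.conjTranspose_sub, Matrix.conjTranspose_mul, Matrix.conjTranspose_conjTranspose,
    Matrix.smul_mul, Matrix.mul_smul, sub_mul, mul_sub, Matrix.trace_smul, Matrix.trace_sub,
    smul_sub, Complex.star_def, Complex.conj_ofReal]
  conv_rhs => rw [Finset.sum_comm]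
  refine Finset.sum_congr rfl fun ν₁ _ => Finset.sum_congr rfl fun ν₂ _ => ?_
  rw [dirichletCoeff_comm β σ ν₂ ν₁, add_comm (Real.exp (-β * ν₂ / 2))]
  have t1 : ((bohrPart hH A ν₁)ᴴ * (Xᴴ * bohrPart hH A ν₂) * Y).trace =
      (Xᴴ * (bohrPart hH A ν₂ * Y * (bohrPart hH A ν₁)ᴴ)).trace := by
    rw [mul_assoc, Matrix.trace_mul_comm]; simp only [mul_assoc]
  have t2 : ((bohrPart hH A ν₁)ᴴ * bohrPart hH A ν₂ * Xᴴ * Y).trace =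
      (Xᴴ * (Y * ((bohrPart hH A ν₁)ᴴ * bohrPart hH A ν₂))).trace := by
    rw [mul_assoc, Matrix.trace_mul_comm]; simp only [mul_assoc]
  rw [t1, t2]
  simp only [mul_assoc]

end Generator

/-! ### The Hilbert–Schmidt norm -/

section Frobenius

variable {n : Type*} [Fintype n]

/-- The Hilbert–Schmidt norm `(∑ |M_{ij}|²)^{1/2}`. -/
noncomputable def hsNorm (M : Matrix n n ℂ) : ℝ :=
  ‖(WithLp.toLp 2 (fun p : n × n => M p.1 p.2) : EuclideanSpace ℂ (n × n))‖

theorem hsNorm_nonneg (M : Matrix n n ℂ) : 0 ≤ hsNorm M := norm_nonneg _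

theorem hsNorm_add_le (M N : Matrix n n ℂ) : hsNorm (M + N) ≤ hsNorm M + hsNorm N := by
  unfold hsNorm
  refine le_trans (le_of_eq ?_) (norm_add_le _ _)
  rfl

theorem hsNorm_smul (c : ℂ) (M : Matrix n n ℂ) : hsNorm (c • M) = ‖c‖ * hsNorm M := by
  unfold hsNorm
  rw [← norm_smul]
  rfl

theorem sq_hsNorm (M : Matrix n n ℂ) : hsNorm M ^ 2 = ∑ i, ∑ j, ‖M i j‖ ^ 2 := by
  unfold hsNorm
  rw [EuclideanSpace.norm_sq_eq, Fintype.sum_prod_type]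

theorem trace_conjTranspose_mul_eq_inner (M N : Matrix n n ℂ) :
    (Mᴴ * N).trace = inner ℂ
      (WithLp.toLp 2 (fun p : n × n => M p.1 p.2) : EuclideanSpace ℂ (n × n))
      (WithLp.toLp 2 (fun p : n × n => N p.1 p.2) : EuclideanSpace ℂ (n × n)) := by
  rw [PiLp.inner_apply, Fintype.sum_prod_type, Finset.sum_comm]
  simp [Matrix.trace, Matrix.mul_apply, mul_comm]

theorem trace_conjTranspose_mul_self (M : Matrix n n ℂ) :
    (Mᴴ * M).trace = ((hsNorm M ^ 2 : ℝ) : ℂ) := by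
  rw [trace_conjTranspose_mul_eq_inner, inner_self_eq_norm_sq_to_K]
  simp [hsNorm]

theorem norm_trace_conjTranspose_mul_le (M N : Matrix n n ℂ) :
    ‖(Mᴴ * N).trace‖ ≤ hsNorm M * hsNorm N := by
  rw [trace_conjTranspose_mul_eq_inner]
  exact norm_inner_le_norm _ _

theorem hsNorm_conjTranspose (M : Matrix n n ℂ) : hsNorm Mᴴ = hsNorm M := by
  rw [← sq_eq_sq₀ (hsNorm_nonneg _) (hsNorm_nonneg _), sq_hsNorm, sq_hsNorm, Finset.sum_comm]
  simp

theorem norm_trace_mul_le (M N : Matrix n n ℂ) : ‖(M * N).trace‖ ≤ hsNorm M * hsNorm N := by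
  have := norm_trace_conjTranspose_mul_le Mᴴ N
  rwa [Matrix.conjTranspose_conjTranspose, hsNorm_conjTranspose] at this

variable [DecidableEq n]

theorem hsNorm_mul_le_left (M N : Matrix n n ℂ) : hsNorm (M * N) ≤ ‖M‖ * hsNorm N := by
  refine le_of_sq_le_sq ?_ (mul_nonneg (norm_nonneg _) (hsNorm_nonneg _))
  rw [mul_pow, sq_hsNorm, sq_hsNorm, Finset.sum_comm, Finset.sum_comm (f := fun i j => ‖N i j‖ ^ 2),
    Finset.mul_sum]
  refine Finset.sum_le_sum fun j _ => ?_
  have h := Matrix.l2_opNorm_mulVec M (WithLp.toLp 2 (fun i => N i j))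
  have h2 := pow_le_pow_left₀ (norm_nonneg _) h 2
  rw [mul_pow, EuclideanSpace.norm_sq_eq, EuclideanSpace.norm_sq_eq] at h2
  exact h2

theorem hsNorm_mul_le_right (M N : Matrix n n ℂ) : hsNorm (M * N) ≤ hsNorm M * ‖N‖ := by
  rw [← hsNorm_conjTranspose, Matrix.conjTranspose_mul]
  refine (hsNorm_mul_le_left _ _).trans (le_of_eq ?_)
  rw [Matrix.l2_opNorm_conjTranspose, hsNorm_conjTranspose, mul_comm]

end Frobenius

/-! ### Powers of the Gibbs state and the KMS norm -/

section Gibbs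

variable {n : Type*} [Fintype n] [DecidableEq n] {H : Matrix n n ℂ}

/-- The partition function `Tr e^{-βH}` of a Hermitian `H`, written as `‖e^{-βH/2}‖²` in the
Hilbert–Schmidt norm, which makes its positivity evident. -/
noncomputable def partitionFunction (β : ℝ) (H : Matrix n n ℂ) : ℝ :=
  hsNorm (NormedSpace.exp ((-β / 2 : ℂ) • H)) ^ 2

theorem trace_exp_eq_partitionFunction (hH : H.IsHermitian) (β : ℝ) :
    (NormedSpace.exp ((-β : ℂ) • H)).trace = (partitionFunction β H : ℂ) := by
  rw [partitionFunction, ← trace_conjTranspose_mul_self, conjTranspose_exp_smul hH,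
    exp_smul_mul_exp_smul]
  congr 3
  simp

theorem partitionFunction_pos [Nonempty n] (β : ℝ) (H : Matrix n n ℂ) :
    0 < partitionFunction β H := by
  unfold partitionFunction
  have h : hsNorm (NormedSpace.exp ((-β / 2 : ℂ) • H)) ≠ 0 := by
    intro h0
    have h1 := exp_smul_mul_exp_neg_smul H (-β / 2 : ℂ)
    have h2 := hsNorm_mul_le_right (NormedSpace.exp ((-β / 2 : ℂ) • H))
      (NormedSpace.exp ((-(-β / 2 : ℂ)) • H))
    rw [h1, h0, zero_mul] at h2
    have h3 := sq_hsNorm (1 : Matrix n n ℂ)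
    rw [le_antisymm h2 (hsNorm_nonneg _)] at h3
    have i := Classical.arbitrary n
    have h4 := (Finset.sum_eq_zero_iff_of_nonneg
      (fun i _ => Finset.sum_nonneg fun j _ => sq_nonneg ‖(1 : Matrix n n ℂ) i j‖)).1
      (h3.symm.trans (by norm_num)) i (Finset.mem_univ i)
    have h5 := (Finset.sum_eq_zero_iff_of_nonneg
      (fun j _ => sq_nonneg ‖(1 : Matrix n n ℂ) i j‖)).1 h4 i (Finset.mem_univ i)
    simp at h5
  positivity

/-- The real power `ρ^θ = Z^{-θ} e^{-βθH}` of the Gibbs state. -/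
noncomputable def gibbsPow (β : ℝ) (H : Matrix n n ℂ) (θ : ℝ) : Matrix n n ℂ :=
  ((partitionFunction β H ^ (-θ) : ℝ) : ℂ) • NormedSpace.exp ((-(β * θ : ℝ) : ℂ) • H)

theorem gibbsPow_one (hH : H.IsHermitian) (β : ℝ) : gibbsPow β H 1 = gibbs β H := by
  rw [gibbsPow, gibbs, trace_exp_eq_partitionFunction hH, mul_one, Real.rpow_neg_one,
    Complex.ofReal_inv]

theorem gibbsPow_mul_gibbsPow [Nonempty n] (β : ℝ) (H : Matrix n n ℂ) (θ₁ θ₂ : ℝ) :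
    gibbsPow β H θ₁ * gibbsPow β H θ₂ = gibbsPow β H (θ₁ + θ₂) := by
  unfold gibbsPow
  rw [Matrix.smul_mul, Matrix.mul_smul, smul_smul, exp_smul_mul_exp_smul, ← Complex.ofReal_mul,
    ← Real.rpow_add (partitionFunction_pos β H)]
  congr 3
  · ring
  · push_cast; ring

theorem conjTranspose_gibbsPow (hH : H.IsHermitian) (β θ : ℝ) :
    (gibbsPow β H θ)ᴴ = gibbsPow β H θ := by
  unfold gibbsPow
  rw [Matrix.conjTranspose_smul, conjTranspose_exp_smul hH]
  simp

theorem gibbsPow_nonneg [Nonempty n] (hH : H.IsHermitian) (β θ : ℝ) : 0 ≤ gibbsPow β H θ := by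
  have h : gibbsPow β H θ = star (gibbsPow β H (θ / 2)) * gibbsPow β H (θ / 2) := by
    rw [Matrix.star_eq_conjTranspose, conjTranspose_gibbsPow hH, gibbsPow_mul_gibbsPow β H,
      add_halves]
  rw [h]
  exact star_mul_self_nonneg _

theorem sqrt_gibbs [Nonempty n] (hH : H.IsHermitian) (β : ℝ) :
    CFC.sqrt (gibbs β H) = gibbsPow β H (1 / 2) := by
  refine CFC.sqrt_unique ?_ (gibbsPow_nonneg hH β _)
  rw [gibbsPow_mul_gibbsPow β H, ← gibbsPow_one hH]
  norm_num

theorem hsNorm_gibbsPow_half [Nonempty n] (hH : H.IsHermitian) (β : ℝ) :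
    hsNorm (gibbsPow β H (1 / 2)) = 1 := by
  have h := trace_conjTranspose_mul_self (gibbsPow β H (1 / 2))
  rw [conjTranspose_gibbsPow hH, gibbsPow_mul_gibbsPow β H, add_halves, gibbsPow_one hH, gibbs,
    Matrix.trace_smul, smul_eq_mul, inv_mul_cancel₀] at h
  · have h1 : hsNorm (gibbsPow β H (1 / 2)) ^ 2 = 1 := by exact_mod_cast h.symm
    exact (pow_eq_one_iff_of_nonneg (hsNorm_nonneg _) two_ne_zero).1 h1
  · rw [trace_exp_eq_partitionFunction hH]
    exact_mod_cast (partitionFunction_pos β H).ne'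

theorem gibbsPow_mul_bohrPart (hH : H.IsHermitian) (A : Matrix n n ℂ) (β θ ν : ℝ) :
    gibbsPow β H θ * bohrPart hH A ν =
      ((Real.exp (-β * ν * θ) : ℝ) : ℂ) • (bohrPart hH A ν * gibbsPow β H θ) := by
  unfold gibbsPow
  rw [Matrix.smul_mul, exp_mul_bohrPart, Matrix.mul_smul, smul_comm]
  congr 1
  push_cast; ring_nf

/-- Conjugation by a power of the Gibbs state is evolution in imaginary time. -/
theorem gibbsPow_mul_mul_gibbsPow_neg [Nonempty n] (β : ℝ) (H A : Matrix n n ℂ) (θ : ℝ) :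
    gibbsPow β H θ * A * gibbsPow β H (-θ) =
      NormedSpace.exp ((-(β * θ : ℝ) : ℂ) • H) * A *
        NormedSpace.exp ((-(-(β * θ : ℝ) : ℂ)) • H) := by
  unfold gibbsPow
  rw [Matrix.smul_mul, Matrix.smul_mul, Matrix.mul_smul, smul_smul, ← Complex.ofReal_mul,
    ← Real.rpow_add (partitionFunction_pos β H), add_neg_cancel, Real.rpow_zero,
    Complex.ofReal_one, one_smul]
  congr 3
  push_cast; ring

/-- The KMS norm `‖ρ^{1/4} X ρ^{1/4}‖₂`, the norm of the KMS inner product of the Gibbs state. -/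
noncomputable def kmsNorm (β : ℝ) (H X : Matrix n n ℂ) : ℝ :=
  hsNorm (gibbsPow β H (1 / 4) * X * gibbsPow β H (1 / 4))

theorem kmsNorm_nonneg (β : ℝ) (H X : Matrix n n ℂ) : 0 ≤ kmsNorm β H X := hsNorm_nonneg _

theorem kmsNorm_add_le (β : ℝ) (H X Y : Matrix n n ℂ) :
    kmsNorm β H (X + Y) ≤ kmsNorm β H X + kmsNorm β H Y := by
  unfold kmsNorm
  rw [mul_add, add_mul]
  exact hsNorm_add_le _ _

theorem kmsInner_gibbs_eq [Nonempty n] (hH : H.IsHermitian) (β : ℝ) (X Y : Matrix n n ℂ) :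
    kmsInner (gibbs β H) X Y =
      ((gibbsPow β H (1 / 4) * X * gibbsPow β H (1 / 4))ᴴ *
        (gibbsPow β H (1 / 4) * Y * gibbsPow β H (1 / 4))).trace := by
  have hq : gibbsPow β H (1 / 2) = gibbsPow β H (1 / 4) * gibbsPow β H (1 / 4) := by
    rw [gibbsPow_mul_gibbsPow β H]; norm_num
  unfold kmsInner
  rw [sqrt_gibbs hH, Matrix.conjTranspose_mul, Matrix.conjTranspose_mul,
    conjTranspose_gibbsPow hH, hq]
  rw [← mul_assoc, Matrix.trace_mul_comm]
  simp only [mul_assoc]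

theorem norm_kmsInner_le [Nonempty n] (hH : H.IsHermitian) (β : ℝ) (X Y : Matrix n n ℂ) :
    ‖kmsInner (gibbs β H) X Y‖ ≤ kmsNorm β H X * kmsNorm β H Y := by
  rw [kmsInner_gibbs_eq hH]
  exact norm_trace_conjTranspose_mul_le _ _

theorem kmsInner_self [Nonempty n] (hH : H.IsHermitian) (β : ℝ) (X : Matrix n n ℂ) :
    kmsInner (gibbs β H) X X = ((kmsNorm β H X ^ 2 : ℝ) : ℂ) := by
  rw [kmsInner_gibbs_eq hH, trace_conjTranspose_mul_self]
  rfl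

theorem star_kmsInner [Nonempty n] (hH : H.IsHermitian) (β : ℝ) (X Y : Matrix n n ℂ) :
    star (kmsInner (gibbs β H) X Y) = kmsInner (gibbs β H) Y X := by
  rw [kmsInner_gibbs_eq hH, kmsInner_gibbs_eq hH, ← Matrix.trace_conjTranspose,
    Matrix.conjTranspose_mul, Matrix.conjTranspose_conjTranspose]

/-- The KMS norm is dominated by the operator norm. -/
theorem kmsNorm_le_norm [Nonempty n] (hH : H.IsHermitian) (β : ℝ) (X : Matrix n n ℂ) :
    kmsNorm β H X ≤ ‖X‖ := by
  refine le_of_sq_le_sq ?_ (norm_nonneg _)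
  have h := kmsInner_self hH β X
  have h1 : ‖kmsInner (gibbs β H) X X‖ = kmsNorm β H X ^ 2 := by
    rw [h, Complex.norm_of_nonneg (sq_nonneg _)]
  rw [← h1, kmsInner, sqrt_gibbs hH]
  set s := gibbsPow β H (1 / 2) with hs
  have h2 : Xᴴ * s * X * s = (s * X)ᴴ * (X * s) := by
    rw [Matrix.conjTranspose_mul, hs, conjTranspose_gibbsPow hH]; simp only [mul_assoc]
  rw [h2]
  refine (norm_trace_conjTranspose_mul_le _ _).trans ?_
  have hs1 : hsNorm s = 1 := hsNorm_gibbsPow_half hH β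
  have h3 := hsNorm_mul_le_right s X
  have h4 := hsNorm_mul_le_left X s
  rw [hs1] at h3 h4
  rw [sq]
  have := hsNorm_nonneg (s * X)
  have := hsNorm_nonneg (X * s)
  exact mul_le_mul (by linarith) (by linarith) (by assumption) (norm_nonneg _)

theorem kmsInner_sub_right (ρ X Y Z : Matrix n n ℂ) :
    kmsInner ρ X (Y - Z) = kmsInner ρ X Y - kmsInner ρ X Z := by
  simp [kmsInner, mul_sub, sub_mul, Matrix.trace_sub]

theorem kmsInner_smul_right (ρ X Y : Matrix n n ℂ) (c : ℂ) :
    kmsInner ρ X (c • Y) = c * kmsInner ρ X Y := by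
  simp [kmsInner, Matrix.trace_smul]

theorem kmsInner_sum_right {ι : Type*} (s : Finset ι) (ρ X : Matrix n n ℂ)
    (Y : ι → Matrix n n ℂ) : kmsInner ρ X (∑ i ∈ s, Y i) = ∑ i ∈ s, kmsInner ρ X (Y i) := by
  simp [kmsInner, Finset.mul_sum, Finset.sum_mul, Matrix.trace_sum]

theorem norm_trace_mul_gibbs_mul_mul_le [Nonempty n] (hH : H.IsHermitian) (β : ℝ)
    (Q R Y : Matrix n n ℂ) : ‖(Q * gibbs β H * R * Y).trace‖ ≤ ‖Q‖ * ‖R‖ * ‖Y‖ := by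
  have h1 : Q * gibbs β H * R * Y =
      (Q * gibbsPow β H (1 / 2)) * (gibbsPow β H (1 / 2) * (R * Y)) := by
    have hg : gibbs β H = gibbsPow β H (1 / 2) * gibbsPow β H (1 / 2) := by
      rw [gibbsPow_mul_gibbsPow β H, add_halves, gibbsPow_one hH]
    rw [hg]
    simp only [mul_assoc]
  rw [h1]
  refine (norm_trace_mul_le _ _).trans ?_
  have h3 := hsNorm_mul_le_right (gibbsPow β H (1 / 2)) (R * Y)
  have h4 := hsNorm_mul_le_left Q (gibbsPow β H (1 / 2))
  rw [hsNorm_gibbsPow_half hH] at h3 h4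
  rw [mul_one] at h4
  rw [one_mul] at h3
  rw [mul_assoc]
  exact mul_le_mul h4 (h3.trans (norm_mul_le _ _)) (hsNorm_nonneg _) (norm_nonneg _)

/-- Splitting `ρ = ρ^{1/4} ρ^{1/2} ρ^{1/4}` and moving `ρ^{1/4}` past `Q` and past `R` costs an
imaginary-time evolution of each by `β/4`, and leaves the KMS norm of `Y`. -/
theorem norm_trace_mul_gibbs_mul_mul_le_kmsNorm [Nonempty n] (hH : H.IsHermitian) (β : ℝ)
    (Q R Y : Matrix n n ℂ) : ‖(Q * gibbs β H * R * Y).trace‖ ≤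
      ‖NormedSpace.exp (((β / 4 : ℝ) : ℂ) • H) * Q * NormedSpace.exp ((-((β / 4 : ℝ) : ℂ)) • H)‖ *
      ‖NormedSpace.exp (((-(β / 4) : ℝ) : ℂ) • H) * R *
        NormedSpace.exp ((-((-(β / 4) : ℝ) : ℂ)) • H)‖ * kmsNorm β H Y := by
  have hQ := gibbsPow_mul_mul_gibbsPow_neg β H Q (-(1 / 4))
  have hR := gibbsPow_mul_mul_gibbsPow_neg β H R (1 / 4)
  rw [neg_neg, show ((-((β * -(1 / 4) : ℝ) : ℂ))) = ((β / 4 : ℝ) : ℂ) by push_cast; ring] at hQ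
  rw [show ((-((β * (1 / 4) : ℝ) : ℂ))) = ((-(β / 4) : ℝ) : ℂ) by push_cast; ring] at hR
  rw [← hQ, ← hR]
  have hinv : gibbsPow β H (-(1 / 4)) * gibbsPow β H (1 / 4) = 1 := by
    rw [gibbsPow_mul_gibbsPow β H, neg_add_cancel]
    simp [gibbsPow]
  have hinv' : gibbsPow β H (1 / 4) * gibbsPow β H (-(1 / 4)) = 1 := by
    rw [gibbsPow_mul_gibbsPow β H, add_neg_cancel]
    simp [gibbsPow]
  have hg : gibbs β H = gibbsPow β H (1 / 4) * gibbsPow β H (1 / 2) * gibbsPow β H (1 / 4) := by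
    rw [gibbsPow_mul_gibbsPow β H, gibbsPow_mul_gibbsPow β H, ← gibbsPow_one hH]; norm_num
  have h1 : (Q * gibbs β H * R * Y).trace =
      ((gibbsPow β H (-(1 / 4)) * Q * gibbsPow β H (1 / 4)) * gibbsPow β H (1 / 2) *
        (gibbsPow β H (1 / 4) * R * gibbsPow β H (-(1 / 4))) *
        (gibbsPow β H (1 / 4) * Y * gibbsPow β H (1 / 4))).trace := by
    have : (gibbsPow β H (-(1 / 4)) * Q * gibbsPow β H (1 / 4)) * gibbsPow β H (1 / 2) *
        (gibbsPow β H (1 / 4) * R * gibbsPow β H (-(1 / 4))) *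
        (gibbsPow β H (1 / 4) * Y * gibbsPow β H (1 / 4)) =
        gibbsPow β H (-(1 / 4)) * (Q * (gibbsPow β H (1 / 4) * gibbsPow β H (1 / 2) *
        gibbsPow β H (1 / 4)) * R * (gibbsPow β H (-(1 / 4)) * gibbsPow β H (1 / 4)) * Y *
        gibbsPow β H (1 / 4)) := by
      simp only [mul_assoc]
    rw [this, Matrix.trace_mul_comm (gibbsPow β H (-(1 / 4))), ← hg, hinv, mul_one,
      mul_assoc _ _ (gibbsPow β H (-(1 / 4))), hinv', mul_one]
  rw [h1]
  refine (norm_trace_mul_le _ _).trans ?_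
  refine mul_le_mul_of_nonneg_right ?_ (hsNorm_nonneg _)
  refine (hsNorm_mul_le_right _ _).trans (mul_le_mul_of_nonneg_right ?_ (norm_nonneg _))
  refine (hsNorm_mul_le_left _ _).trans (le_of_eq ?_)
  rw [hsNorm_gibbsPow_half hH, mul_one]

end Gibbs

/-! ### KMS symmetry of the generator -/

section Dirichlet

variable {n : Type*} [Fintype n] [DecidableEq n] {H : Matrix n n ℂ}

/-- For a Hermitian jump the KMS form of the generator is a quadratic form in the commutators with
the Bohr components of the jump. As the coefficients are symmetric, this is detailed balance. -/
theorem kmsInner_heisenbergGenerator [Nonempty n] (β σ : ℝ)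
    (hH : H.IsHermitian) {A : Matrix n n ℂ} (hA : A.IsHermitian) (X Y : Matrix n n ℂ) :
    kmsInner (gibbs β H) Y (heisenbergGenerator β σ hH A X) =
      -∑ ν₁ ∈ bohr hH, ∑ ν₂ ∈ bohr hH, (dirichletCoeff β σ ν₁ ν₂ : ℂ) *
        kmsInner (gibbs β H) (bohrPart hH A ν₂ * Y - Y * bohrPart hH A ν₂)
          (bohrPart hH A ν₁ * X - X * bohrPart hH A ν₁) := by
  set ρ := gibbs β H with hρ
  set s := gibbsPow β H (1 / 2) with hs
  set a : ℝ → Matrix n n ℂ := bohrPart hH A with ha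
  have hsq : CFC.sqrt ρ = s := sqrt_gibbs hH β
  have hadj : ∀ ν, (a ν)ᴴ = a (-ν) := fun ν => by
    rw [ha, conjTranspose_bohrPart, hA.eq]
  have hcomm : ∀ ν, s * a ν = ((Real.exp (-β * ν / 2) : ℝ) : ℂ) • (a ν * s) := fun ν => by
    rw [hs, ha, gibbsPow_mul_bohrPart]
    congr 4; ring
  have hcomm' : ∀ ν, (a ν)ᴴ * s = ((Real.exp (-β * ν / 2) : ℝ) : ℂ) • (s * (a ν)ᴴ) := fun ν => by
    have := congrArg Matrix.conjTranspose (hcomm ν)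
    rw [Matrix.conjTranspose_mul, Matrix.conjTranspose_smul, Matrix.conjTranspose_mul, hs,
      conjTranspose_gibbsPow hH, Complex.star_def, Complex.conj_ofReal] at this
    exact this
  have hexp : ∀ ν, ((Real.exp (-β * ν / 2) : ℝ) : ℂ) * ((Real.exp (-β * (-ν) / 2) : ℝ) : ℂ) = 1 := by
    intro ν
    rw [← Complex.ofReal_mul, ← Real.exp_add, show -β * ν / 2 + -β * -ν / 2 = 0 by ring,
      Real.exp_zero, Complex.ofReal_one]
  have hcomm2 : ∀ ν, s * (a ν)ᴴ = ((Real.exp (-β * (-ν) / 2) : ℝ) : ℂ) • ((a ν)ᴴ * s) := fun ν => by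
    rw [hcomm', smul_smul, mul_comm, hexp, one_smul]
  have key : ∀ ν₁ ν₂, kmsInner ρ (a ν₂ * Y - Y * a ν₂) (a ν₁ * X - X * a ν₁) =
      ((Real.exp (-β * ν₂ / 2) : ℝ) : ℂ) *
        kmsInner ρ Y ((a ν₂)ᴴ * a ν₁ * X - (a ν₂)ᴴ * X * a ν₁) +
      ((Real.exp (-β * (-ν₂) / 2) : ℝ) : ℂ) *
        kmsInner ρ Y (X * a ν₁ * a (-ν₂) - a ν₁ * X * a (-ν₂)) := by
    intro ν₁ ν₂
    rw [← kmsInner_smul_right, ← kmsInner_smul_right, ← hadj]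
    unfold kmsInner
    rw [hsq, Matrix.conjTranspose_sub, Matrix.conjTranspose_mul, Matrix.conjTranspose_mul]
    have e1 : Yᴴ * (a ν₂)ᴴ * s = ((Real.exp (-β * ν₂ / 2) : ℝ) : ℂ) • (Yᴴ * s * (a ν₂)ᴴ) := by
      rw [mul_assoc, hcomm', Matrix.mul_smul, mul_assoc]
    have e2 : ∀ W : Matrix n n ℂ, ((a ν₂)ᴴ * Yᴴ * s * W * s).trace =
        ((Real.exp (-β * (-ν₂) / 2) : ℝ) : ℂ) * (Yᴴ * s * (W * (a ν₂)ᴴ) * s).trace := by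
      intro W
      rw [show (a ν₂)ᴴ * Yᴴ * s * W * s = (a ν₂)ᴴ * (Yᴴ * s * W * s) by simp only [mul_assoc],
        Matrix.trace_mul_comm, mul_assoc _ s, hcomm2, Matrix.mul_smul, Matrix.trace_smul,
        smul_eq_mul]
      simp only [mul_assoc]
    rw [sub_mul, sub_mul, sub_mul, Matrix.trace_sub, e2, e1]
    simp only [Matrix.smul_mul, Matrix.mul_smul, Matrix.trace_smul, sub_mul, mul_sub,
      Matrix.trace_sub, smul_eq_mul, smul_sub, mul_assoc]
    ring
  have hsum : ∑ ν₁ ∈ bohr hH, ∑ ν₂ ∈ bohr hH, (dirichletCoeff β σ ν₁ ν₂ : ℂ) *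
      (((Real.exp (-β * (-ν₂) / 2) : ℝ) : ℂ) *
        kmsInner ρ Y (X * a ν₁ * a (-ν₂) - a ν₁ * X * a (-ν₂))) =
      ∑ ν₁ ∈ bohr hH, ∑ ν₂ ∈ bohr hH, (dirichletCoeff β σ ν₁ ν₂ : ℂ) *
      (((Real.exp (-β * ν₁ / 2) : ℝ) : ℂ) *
        kmsInner ρ Y (X * (a ν₂)ᴴ * a ν₁ - (a ν₂)ᴴ * X * a ν₁)) := by
    rw [Finset.sum_comm, ← sum_bohr_neg hH]
    refine Finset.sum_congr rfl fun ν₁ _ => ?_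
    rw [← sum_bohr_neg hH]
    refine Finset.sum_congr rfl fun ν₂ _ => ?_
    rw [neg_neg, hadj, dirichletCoeff_neg, dirichletCoeff_comm]
  simp only [key, mul_add, Finset.sum_add_distrib]
  rw [hsum, ← Finset.sum_add_distrib, ← Finset.sum_neg_distrib, heisenbergGenerator]
  simp only [smul_apply, sub_apply, sum_apply, sandwich_apply, mul_one, one_mul,
    kmsInner_sum_right, kmsInner_smul_right, kmsInner_sub_right]
  refine Finset.sum_congr rfl fun ν₁ _ => ?_
  rw [← Finset.sum_add_distrib, ← Finset.sum_neg_distrib]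
  refine Finset.sum_congr rfl fun ν₂ _ => ?_
  simp only [← ha, mul_assoc]
  push_cast
  ring

theorem kmsInner_heisenbergGenerator_symm [Nonempty n] (β σ : ℝ)
    (hH : H.IsHermitian) {A : Matrix n n ℂ} (hA : A.IsHermitian) (X Y : Matrix n n ℂ) :
    kmsInner (gibbs β H) X (heisenbergGenerator β σ hH A Y) =
      kmsInner (gibbs β H) (heisenbergGenerator β σ hH A X) Y := by
  rw [← star_kmsInner hH β Y, kmsInner_heisenbergGenerator β σ hH hA,
    kmsInner_heisenbergGenerator β σ hH hA]
  simp only [star_neg, star_sum, star_mul', star_kmsInner hH, Complex.star_def, Complex.conj_ofReal]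
  rw [Finset.sum_comm]
  congr 1
  refine Finset.sum_congr rfl fun ν₁ _ => Finset.sum_congr rfl fun ν₂ _ => ?_
  rw [dirichletCoeff_comm]

end Dirichlet

/-! ### Positivity of the coefficient matrix -/

section Kernel

/-- The Cauchy–Schwarz inequality against the constant function one. -/
theorem sq_integral_le_measureReal_mul {α : Type*} [MeasurableSpace α] {m : Measure α}
    [IsFiniteMeasure m] {g : α → ℝ} (hg : Integrable g m) (hg2 : Integrable (fun x => g x ^ 2) m) :
    (∫ x, g x ∂m) ^ 2 ≤ m.real Set.univ * ∫ x, g x ^ 2 ∂m := by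
  set M := m.real Set.univ with hM
  set I := ∫ x, g x ∂m with hI
  set J := ∫ x, g x ^ 2 ∂m with hJ
  have h0 : 0 ≤ ∫ x, (M * g x - I) ^ 2 ∂m := integral_nonneg fun x => sq_nonneg _
  have h1 : ∫ x, (M * g x - I) ^ 2 ∂m = M * (M * J - I ^ 2) := by
    have : ∀ x, (M * g x - I) ^ 2 = M ^ 2 * g x ^ 2 - 2 * M * I * g x + I ^ 2 := fun x => by ring
    simp_rw [this]
    have h2 : Integrable (fun x => M ^ 2 * g x ^ 2 - 2 * M * I * g x) m :=
      (hg2.const_mul _).sub (hg.const_mul _)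
    rw [integral_add h2 (integrable_const _),
      integral_sub (hg2.const_mul _) (hg.const_mul _), integral_const_mul, integral_const_mul,
      integral_const, smul_eq_mul, ← hI, ← hJ, ← hM]
    ring
  rw [h1] at h0
  have hM0 : 0 ≤ M := measureReal_nonneg
  rcases hM0.eq_or_lt with h | h
  · have hm : m = 0 := by
      rw [← Measure.measure_univ_eq_zero]
      exact (measureReal_eq_zero_iff).1 (hM ▸ h.symm)
    have hI0 : I = 0 := by rw [hI, hm, integral_zero_measure]
    rw [hI0, ← h]; simp
  · have := nonneg_of_mul_nonneg_right h0 h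
    linarith

theorem sech_neg (β v : ℝ) : sech β (-v) = sech β v := by
  unfold sech; rw [← Real.cosh_neg]; congr 2; ring

theorem sech_pos (β v : ℝ) : 0 < sech β v := inv_pos.2 (Real.cosh_pos _)

theorem sech_le_one (β v : ℝ) : sech β v ≤ 1 := inv_le_one_of_one_le₀ (Real.one_le_cosh _)

theorem continuous_sech (β : ℝ) : Continuous (sech β) := by
  unfold sech
  exact Continuous.inv₀ (Real.continuous_cosh.comp (by fun_prop)) fun v => (Real.cosh_pos _).ne'

theorem integrable_phase {μ : Measure ℝ} [IsProbabilityMeasure μ] (v : ℝ) :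
    Integrable (fun t : ℝ => Complex.exp (Complex.I * v * t)) μ := by
  refine Integrable.of_bound (Continuous.aestronglyMeasurable (by fun_prop)) 1
    (Filter.Eventually.of_forall fun t => ?_)
  rw [Complex.norm_exp]; simp

/-- The matrix `sech(β(ν₁ - ν₂)/4)` is positive semidefinite, and its quadratic form dominates the
square of every linear form with coefficients `sech(β(u - ν)/4)`: both are integrals of the same
trigonometric polynomial against the measure of `exists_measure_sech`. -/
theorem exists_sech_form_eq (β : ℝ) (s : Finset ℝ) (a : ℝ → ℂ) :
    ∃ q : ℝ, 0 ≤ q ∧ ∑ ν₁ ∈ s, ∑ ν₂ ∈ s, (sech β (ν₁ - ν₂) : ℂ) * (a ν₁ * star (a ν₂)) = (q : ℂ) ∧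
      ∀ u : ℝ, ‖∑ ν ∈ s, (sech β (u - ν) : ℂ) * a ν‖ ^ 2 ≤ q := by
  obtain ⟨μ, hμ, hS⟩ := exists_measure_sech β
  set b : ℝ → ℂ := fun t => ∑ ν ∈ s, a ν * Complex.exp (Complex.I * ν * t) with hb
  have hbc : Continuous b := by rw [hb]; fun_prop
  have hbb : ∀ t, ‖b t‖ ≤ ∑ ν ∈ s, ‖a ν‖ := by
    intro t
    refine norm_sum_le_of_le _ fun ν _ => ?_
    rw [norm_mul, Complex.norm_exp]; simp
  have hbi : Integrable (fun t => ‖b t‖) μ :=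
    Integrable.of_bound hbc.norm.aestronglyMeasurable (∑ ν ∈ s, ‖a ν‖)
      (Filter.Eventually.of_forall fun t => by simpa using hbb t)
  have hbi2 : Integrable (fun t => ‖b t‖ ^ 2) μ :=
    Integrable.of_bound (hbc.norm.pow 2).aestronglyMeasurable ((∑ ν ∈ s, ‖a ν‖) ^ 2)
      (Filter.Eventually.of_forall fun t => by
        rw [norm_pow, norm_norm]
        exact pow_le_pow_left₀ (norm_nonneg _) (hbb t) 2)
  refine ⟨∫ t, ‖b t‖ ^ 2 ∂μ, integral_nonneg fun t => sq_nonneg _, ?_, fun u => ?_⟩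
  · rw [← integral_complex_ofReal]
    have h1 : ∀ t : ℝ, ((‖b t‖ ^ 2 : ℝ) : ℂ) = ∑ ν₁ ∈ s, ∑ ν₂ ∈ s,
        Complex.exp (Complex.I * (ν₁ - ν₂ : ℝ) * t) * (a ν₁ * star (a ν₂)) := by
      intro t
      rw [Complex.ofReal_pow, ← Complex.mul_conj', hb, map_sum, Finset.sum_mul_sum]
      refine Finset.sum_congr rfl fun ν₁ _ => Finset.sum_congr rfl fun ν₂ _ => ?_
      rw [map_mul, ← Complex.exp_conj, Complex.star_def, mul_mul_mul_comm, ← Complex.exp_add,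
        mul_comm]
      congr 2
      simp
      ring
    simp_rw [h1]
    have hi : ∀ ν₁ ν₂ : ℝ, Integrable (fun t : ℝ =>
        Complex.exp (Complex.I * (ν₁ - ν₂ : ℝ) * t) * (a ν₁ * star (a ν₂))) μ :=
      fun ν₁ ν₂ => (integrable_phase _).mul_const _
    rw [integral_finsetSum _ fun ν₁ _ => integrable_finsetSum _ fun ν₂ _ => hi ν₁ ν₂]
    refine Finset.sum_congr rfl fun ν₁ _ => ?_
    rw [integral_finsetSum _ fun ν₂ _ => hi ν₁ ν₂]
    refine Finset.sum_congr rfl fun ν₂ _ => ?_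
    rw [integral_mul_const, hS]
  · have h2 : ∑ ν ∈ s, (sech β (u - ν) : ℂ) * a ν =
        ∫ t : ℝ, Complex.exp (Complex.I * (-u : ℝ) * t) * b t ∂μ := by
      have h3 : ∀ t : ℝ, Complex.exp (Complex.I * (-u : ℝ) * t) * b t =
          ∑ ν ∈ s, Complex.exp (Complex.I * (-(u - ν) : ℝ) * t) * a ν := by
        intro t
        rw [hb, Finset.mul_sum]
        refine Finset.sum_congr rfl fun ν _ => ?_
        rw [mul_left_comm, ← Complex.exp_add, mul_comm]
        congr 2; push_cast; ring
      simp_rw [h3]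
      rw [integral_finsetSum _ fun ν _ => (integrable_phase _).mul_const _]
      refine Finset.sum_congr rfl fun ν _ => ?_
      rw [integral_mul_const, hS, sech_neg]
    rw [h2]
    have h4 : ‖∫ t : ℝ, Complex.exp (Complex.I * (-u : ℝ) * t) * b t ∂μ‖ ≤ ∫ t, ‖b t‖ ∂μ := by
      refine (norm_integral_le_integral_norm _).trans (le_of_eq ?_)
      congr 1; ext t
      rw [norm_mul, Complex.norm_exp]; simp
    refine (pow_le_pow_left₀ (norm_nonneg _) h4 2).trans ?_
    simpa using sq_integral_le_measureReal_mul hbi hbi2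

/-- The filter `f̂` with a hyperbolic secant weight, the profile that the windows below are built
from. -/
noncomputable def sechFilter (β σ v : ℝ) : ℝ := sech β v * filterHat σ v

theorem continuous_sechFilter (β σ : ℝ) : Continuous (sechFilter β σ) :=
  (continuous_sech β).mul (continuous_filterHat σ)

theorem sechFilter_pos {σ : ℝ} (hσ : 0 < σ) (β v : ℝ) : 0 < sechFilter β σ v := by
  refine mul_pos (sech_pos β v) ?_
  unfold filterHat
  positivity

theorem integrable_sechFilter {σ : ℝ} (hσ : 0 < σ) (β : ℝ) : Integrable (sechFilter β σ) := by
  refine (integrable_filterHat hσ).mono' (continuous_sechFilter β σ).aestronglyMeasurable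
    (Filter.Eventually.of_forall fun v => ?_)
  rw [Real.norm_of_nonneg (sechFilter_pos hσ β v).le, sechFilter]
  exact mul_le_of_le_one_left (filterHat_nonneg σ v) (sech_le_one β v)

/-- The indicator function of `[-Ω, Ω]` convolved with `sechFilter`. -/
noncomputable def windowWeight (β σ Ω ν : ℝ) : ℝ :=
  ∫ x in Set.Icc (-Ω) Ω, sechFilter β σ (x - ν)

/-- The quadratic form of the coefficients `h_{ν₁ν₂}` controls the linear form of the window. It is an
integral over `x` of quadratic forms as in `exists_sech_form_eq`, weighted with `e^{-β|x|/2}`, and the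
window sees only `|x| ≤ Ω`, where this weight is at least `e^{-βΩ/2}`. -/
theorem norm_sq_sum_windowWeight_le {β σ : ℝ} (hβ : 0 < β) (hσ : 0 < σ) {Ω : ℝ} (hΩ : 0 ≤ Ω)
    (s : Finset ℝ) (z : ℝ → ℂ) :
    ‖∑ ν ∈ s, (windowWeight β σ Ω ν : ℂ) * z ν‖ ^ 2 ≤
      4 * Ω * Real.exp (β * Ω / 2) * Real.exp (β ^ 2 * σ ^ 2 / 8) *
      (∑ ν₁ ∈ s, ∑ ν₂ ∈ s, (dirichletCoeff β σ ν₁ ν₂ : ℂ) * (z ν₁ * star (z ν₂))).re := by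
  choose q hq0 hq hqu using fun x : ℝ =>
    exists_sech_form_eq β s (fun ν => (filterHat σ (x - ν) : ℂ) * z ν)
  have hterm : ∀ x : ℝ, ((Real.exp (-β * |x| / 2) * q x : ℝ) : ℂ) = ∑ ν₁ ∈ s, ∑ ν₂ ∈ s,
      ((Real.exp (-β * |x| / 2) * filterHat σ (x - ν₁) * filterHat σ (x - ν₂) : ℝ) : ℂ) *
        ((sech β (ν₁ - ν₂) : ℂ) * (z ν₁ * star (z ν₂))) := by
    intro x
    rw [Complex.ofReal_mul, ← hq, Finset.mul_sum]
    refine Finset.sum_congr rfl fun ν₁ _ => ?_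
    rw [Finset.mul_sum]
    refine Finset.sum_congr rfl fun ν₂ _ => ?_
    rw [star_mul']
    simp only [Complex.star_def, Complex.conj_ofReal]
    push_cast
    ring
  have hint : ∀ ν₁ ν₂ : ℝ, Integrable fun x : ℝ =>
      ((Real.exp (-β * |x| / 2) * filterHat σ (x - ν₁) * filterHat σ (x - ν₂) : ℝ) : ℂ) *
        ((sech β (ν₁ - ν₂) : ℂ) * (z ν₁ * star (z ν₂))) := fun ν₁ ν₂ =>
    ((integrable_symmCoeff hβ hσ ν₁ ν₂).ofReal (𝕜 := ℂ)).mul_const _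
  have hqint : Integrable fun x : ℝ => Real.exp (-β * |x| / 2) * q x := by
    have : Integrable fun x : ℝ => ((Real.exp (-β * |x| / 2) * q x : ℝ) : ℂ) := by
      simp_rw [hterm]
      exact integrable_finsetSum _ fun ν₁ _ => integrable_finsetSum _ fun ν₂ _ => hint ν₁ ν₂
    exact this.re
  have hform : ∑ ν₁ ∈ s, ∑ ν₂ ∈ s, (dirichletCoeff β σ ν₁ ν₂ : ℂ) * (z ν₁ * star (z ν₂)) =
      ((Real.exp (-(β ^ 2 * σ ^ 2 / 8)) / 2 * ∫ x, Real.exp (-β * |x| / 2) * q x : ℝ) : ℂ) := by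
    rw [Complex.ofReal_mul, ← integral_complex_ofReal]
    simp_rw [hterm]
    rw [integral_finsetSum _ fun ν₁ _ => integrable_finsetSum _ fun ν₂ _ => hint ν₁ ν₂,
      Finset.mul_sum]
    refine Finset.sum_congr rfl fun ν₁ _ => ?_
    rw [integral_finsetSum _ fun ν₂ _ => hint ν₁ ν₂, Finset.mul_sum]
    refine Finset.sum_congr rfl fun ν₂ _ => ?_
    rw [integral_mul_const, integral_complex_ofReal, dirichletCoeff, symmCoeff, sech]
    push_cast
    ring
  rw [hform, Complex.ofReal_re]
  set G : ℝ → ℂ := fun x => ∑ ν ∈ s, (sechFilter β σ (x - ν) : ℂ) * z ν with hG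
  have hGc : Continuous G := by
    have := continuous_sechFilter β σ
    rw [hG]; fun_prop
  have hGq : ∀ x, ‖G x‖ ^ 2 ≤ q x := by
    intro x
    refine le_trans (le_of_eq ?_) (hqu x x)
    rw [hG]
    simp only [sechFilter]
    congr 2
    refine Finset.sum_congr rfl fun ν _ => ?_
    push_cast; ring
  have hsum : ∑ ν ∈ s, (windowWeight β σ Ω ν : ℂ) * z ν = ∫ x in Set.Icc (-Ω) Ω, G x := by
    rw [hG, integral_finsetSum]
    · refine Finset.sum_congr rfl fun ν _ => ?_
      rw [integral_mul_const, integral_complex_ofReal, windowWeight]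
    · intro ν _
      exact ((((integrable_sechFilter hσ β).comp_sub_right ν).ofReal (𝕜 := ℂ)).mul_const
        (z ν)).integrableOn
  rw [hsum]
  have hGi : Integrable (fun x => ‖G x‖) (volume.restrict (Set.Icc (-Ω) Ω)) :=
    hGc.norm.integrableOn_Icc
  have hGi2 : Integrable (fun x => ‖G x‖ ^ 2) (volume.restrict (Set.Icc (-Ω) Ω)) :=
    (hGc.norm.pow 2).integrableOn_Icc
  have h1 := pow_le_pow_left₀ (norm_nonneg _)
    (norm_integral_le_integral_norm (μ := volume.restrict (Set.Icc (-Ω) Ω)) G) 2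
  have h2 := sq_integral_le_measureReal_mul hGi hGi2
  have h3 : (volume.restrict (Set.Icc (-Ω) Ω)).real Set.univ = 2 * Ω := by
    rw [measureReal_restrict_apply_univ, Real.volume_real_Icc_of_le (by linarith)]; ring
  have h4 : ∫ x in Set.Icc (-Ω) Ω, ‖G x‖ ^ 2 ≤
      Real.exp (β * Ω / 2) * ∫ x, Real.exp (-β * |x| / 2) * q x := by
    rw [← integral_const_mul]
    refine (setIntegral_mono_on hGi2 (hqint.const_mul _).integrableOn measurableSet_Icc
      fun x hx => ?_).trans (setIntegral_le_integral (hqint.const_mul _)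
        (Filter.Eventually.of_forall fun x => ?_))
    · have h5 : |x| ≤ Ω := abs_le.2 hx
      rw [← mul_assoc, ← Real.exp_add]
      refine (hGq x).trans (le_mul_of_one_le_left (hq0 x) (Real.one_le_exp ?_))
      nlinarith
    · have := hq0 x
      positivity
  have h6 : Real.exp (β ^ 2 * σ ^ 2 / 8) * Real.exp (-(β ^ 2 * σ ^ 2 / 8)) = 1 := by
    rw [← Real.exp_add, add_neg_cancel, Real.exp_zero]
  calc _ ≤ 2 * Ω * ∫ x in Set.Icc (-Ω) Ω, ‖G x‖ ^ 2 := by rw [← h3]; exact h1.trans h2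
    _ ≤ 2 * Ω * (Real.exp (β * Ω / 2) * ∫ x, Real.exp (-β * |x| / 2) * q x) := by gcongr
    _ = 2 * Ω * (Real.exp (β * Ω / 2) * ∫ x, Real.exp (-β * |x| / 2) * q x) * 1 := by ring
    _ = _ := by rw [← h6]; ring

end Kernel

/-! ### The Dirichlet form controls commutators with windowed jumps -/

section DirichletForm

variable {n : Type*} [Fintype n] [DecidableEq n] {H : Matrix n n ℂ}

/-- The Dirichlet form `-Re ⟨X, L'(X)⟩` of the generator `L'` with the single jump `A`, for the KMS
inner product. -/
noncomputable def dirichletForm (β σ : ℝ) (hH : H.IsHermitian) (A X : Matrix n n ℂ) : ℝ :=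
  -(kmsInner (gibbs β H) X (heisenbergGenerator β σ hH A X)).re

/-- The part of `A` at Bohr frequencies in the window `[-Ω, Ω]`, with a smooth cutoff: the weights are
normalised so that they tend to one as `Ω → ∞`. -/
noncomputable def window (β σ : ℝ) (hH : H.IsHermitian) (Ω : ℝ) (A : Matrix n n ℂ) :
    Matrix n n ℂ :=
  ∑ ν ∈ bohr hH, ((windowWeight β σ Ω ν / ∫ x, sechFilter β σ x : ℝ) : ℂ) • bohrPart hH A ν

theorem integral_sechFilter_pos {σ : ℝ} (hσ : 0 < σ) (β : ℝ) : 0 < ∫ x, sechFilter β σ x := by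
  rw [integral_pos_iff_support_of_nonneg (fun x => (sechFilter_pos hσ β x).le)
    (integrable_sechFilter hσ β)]
  rw [Function.support_eq_univ fun x => (sechFilter_pos hσ β x).ne']
  simp

/-- `norm_sq_sum_windowWeight_le`, applied to each matrix element of `ρ^{1/4} [A_ν, X] ρ^{1/4}`. -/
theorem sq_kmsNorm_commutator_window_le [Nonempty n] {β σ : ℝ} (hβ : 0 < β) (hσ : 0 < σ)
    (hH : H.IsHermitian) {A : Matrix n n ℂ} (hA : A.IsHermitian) {Ω : ℝ} (hΩ : 0 ≤ Ω)
    (X : Matrix n n ℂ) :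
    (∫ x, sechFilter β σ x) ^ 2 *
      kmsNorm β H (window β σ hH Ω A * X - X * window β σ hH Ω A) ^ 2 ≤
      4 * Ω * Real.exp (β * Ω / 2) * Real.exp (β ^ 2 * σ ^ 2 / 8) * dirichletForm β σ hH A X := by
  set c := ∫ x, sechFilter β σ x with hc
  have hc0 : 0 < c := integral_sechFilter_pos hσ β
  set q := gibbsPow β H (1 / 4) with hq
  set Z : ℝ → Matrix n n ℂ := fun ν =>
    q * (bohrPart hH A ν * X - X * bohrPart hH A ν) * q with hZ
  have h1 : (c : ℂ) • (q * (window β σ hH Ω A * X - X * window β σ hH Ω A) * q) =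
      ∑ ν ∈ bohr hH, (windowWeight β σ Ω ν : ℂ) • Z ν := by
    rw [window, Finset.sum_mul, Finset.mul_sum, ← Finset.sum_sub_distrib, Finset.mul_sum,
      Finset.sum_mul, Finset.smul_sum]
    refine Finset.sum_congr rfl fun ν _ => ?_
    rw [hZ, Matrix.smul_mul, Matrix.mul_smul, ← smul_sub, Matrix.mul_smul, Matrix.smul_mul,
      smul_smul, ← Complex.ofReal_mul, mul_div_cancel₀ _ hc0.ne']
  have h2 : c ^ 2 * kmsNorm β H (window β σ hH Ω A * X - X * window β σ hH Ω A) ^ 2 =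
      hsNorm (∑ ν ∈ bohr hH, (windowWeight β σ Ω ν : ℂ) • Z ν) ^ 2 := by
    rw [← h1, hsNorm_smul, mul_pow, Complex.norm_of_nonneg hc0.le]
    rfl
  have h3 : dirichletForm β σ hH A X = ∑ i, ∑ j, (∑ ν₁ ∈ bohr hH, ∑ ν₂ ∈ bohr hH,
      (dirichletCoeff β σ ν₁ ν₂ : ℂ) * (Z ν₁ i j * star (Z ν₂ i j))).re := by
    rw [dirichletForm, kmsInner_heisenbergGenerator β σ hH hA, Complex.neg_re, neg_neg]
    simp only [← Complex.re_sum]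
    congr 1
    have h4 : ∀ ν₁ ν₂, kmsInner (gibbs β H) (bohrPart hH A ν₂ * X - X * bohrPart hH A ν₂)
        (bohrPart hH A ν₁ * X - X * bohrPart hH A ν₁) =
        ∑ i, ∑ j, Z ν₁ i j * star (Z ν₂ i j) := by
      intro ν₁ ν₂
      rw [kmsInner_gibbs_eq hH, Finset.sum_comm]
      simp only [Matrix.trace, Matrix.diag_apply, Matrix.mul_apply (M := _ᴴ),
        Matrix.conjTranspose_apply]
      exact Finset.sum_congr rfl fun i _ => Finset.sum_congr rfl fun j _ => mul_comm _ _
    simp only [h4, Finset.mul_sum]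
    calc _ = ∑ ν₁ ∈ bohr hH, ∑ i, ∑ ν₂ ∈ bohr hH, ∑ j,
          (dirichletCoeff β σ ν₁ ν₂ : ℂ) * (Z ν₁ i j * star (Z ν₂ i j)) :=
          Finset.sum_congr rfl fun _ _ => Finset.sum_comm
      _ = ∑ i, ∑ ν₁ ∈ bohr hH, ∑ ν₂ ∈ bohr hH, ∑ j,
          (dirichletCoeff β σ ν₁ ν₂ : ℂ) * (Z ν₁ i j * star (Z ν₂ i j)) := Finset.sum_comm
      _ = ∑ i, ∑ ν₁ ∈ bohr hH, ∑ j, ∑ ν₂ ∈ bohr hH,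
          (dirichletCoeff β σ ν₁ ν₂ : ℂ) * (Z ν₁ i j * star (Z ν₂ i j)) :=
          Finset.sum_congr rfl fun _ _ => Finset.sum_congr rfl fun _ _ => Finset.sum_comm
      _ = _ := Finset.sum_congr rfl fun _ _ => Finset.sum_comm
  rw [h2, h3, sq_hsNorm, Finset.mul_sum]
  refine Finset.sum_le_sum fun i _ => ?_
  rw [Finset.mul_sum]
  refine Finset.sum_le_sum fun j _ => ?_
  have h5 : (∑ ν ∈ bohr hH, (windowWeight β σ Ω ν : ℂ) • Z ν) i j =
      ∑ ν ∈ bohr hH, (windowWeight β σ Ω ν : ℂ) * Z ν i j := by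
    rw [Matrix.sum_apply]; rfl
  rw [h5]
  exact norm_sq_sum_windowWeight_le hβ hσ hΩ (bohr hH) fun ν => Z ν i j

theorem dirichletForm_nonneg [Nonempty n] {β σ : ℝ} (hβ : 0 < β) (hσ : 0 < σ)
    (hH : H.IsHermitian) {A : Matrix n n ℂ} (hA : A.IsHermitian) (X : Matrix n n ℂ) :
    0 ≤ dirichletForm β σ hH A X := by
  have h := sq_kmsNorm_commutator_window_le hβ hσ hH hA zero_le_one X
  exact nonneg_of_mul_nonneg_right ((by positivity : (0 : ℝ) ≤ _).trans h) (by positivity)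

end DirichletForm

/-! ### Frequency windows -/

section Window

variable {n : Type*} [Fintype n] [DecidableEq n] {H : Matrix n n ℂ}

theorem bohrPart_exp_mul_mul_exp (hH : H.IsHermitian) (A : Matrix n n ℂ) (z : ℂ) (ν : ℝ) :
    bohrPart hH (NormedSpace.exp (z • H) * A * NormedSpace.exp ((-z) • H)) ν =
      Complex.exp (z * ν) • bohrPart hH A ν := by
  unfold bohrPart
  rw [Finset.smul_sum]
  refine Finset.sum_congr rfl fun p hp => ?_
  rw [← (Finset.mem_filter.1 hp).2, ← mul_assoc, ← mul_assoc, energyProj_mul_exp_smul,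
    mul_assoc _ _ (energyProj hH p.1), exp_smul_mul_energyProj, Matrix.smul_mul, Matrix.smul_mul,
    Matrix.mul_smul, smul_smul, ← Complex.exp_add]
  congr 2
  push_cast; ring

/-- Multiplying the Bohr components by a translate of the hyperbolic secant, a characteristic
function, is a mixture of unitary conjugations; hence it does not increase the norm. -/
theorem norm_sum_sech_smul_bohrPart_le (hH : H.IsHermitian) (A : Matrix n n ℂ) (β u : ℝ)
    (c : ℝ → ℂ) :
    ‖∑ ν ∈ bohr hH, ((sech β (u - ν) : ℂ) * c ν) • bohrPart hH A ν‖ ≤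
      ‖∑ ν ∈ bohr hH, c ν • bohrPart hH A ν‖ := by
  obtain ⟨μ, hμ, hS⟩ := exists_measure_sech β
  set N := ∑ ν ∈ bohr hH, c ν • bohrPart hH A ν with hN
  have h1 : ∑ ν ∈ bohr hH, ((sech β (u - ν) : ℂ) * c ν) • bohrPart hH A ν =
      ∫ t : ℝ, Complex.exp (Complex.I * (-u : ℝ) * t) • heisenberg H N t ∂μ := by
    have h2 : ∀ t : ℝ, Complex.exp (Complex.I * (-u : ℝ) * t) • heisenberg H N t =
        ∑ ν ∈ bohr hH, Complex.exp (Complex.I * (-(u - ν) : ℝ) * t) • c ν • bohrPart hH A ν := by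
      intro t
      rw [heisenberg, hN, exp_mul_sum_bohrPart_mul_exp, Finset.smul_sum]
      refine Finset.sum_congr rfl fun ν _ => ?_
      rw [smul_smul, smul_smul, mul_left_comm, ← Complex.exp_add, mul_comm]
      congr 3; push_cast; ring
    simp_rw [h2]
    rw [integral_finsetSum _ fun ν _ => (integrable_phase _).smul_const _]
    refine Finset.sum_congr rfl fun ν _ => ?_
    rw [integral_smul_const, hS, sech_neg, smul_smul]
  rw [h1]
  refine (norm_integral_le_of_norm_le_const (C := ‖N‖) (Filter.Eventually.of_forall fun t => ?_)).trans
    (by simp)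
  rw [norm_smul, norm_heisenberg hH, Complex.norm_exp]
  simp

/-- The components of `A` near frequency `u`, evolved by imaginary time `θ`, have size
`e^{(θ - κ)u}` for every `κ` at which `A` itself has bounded imaginary-time evolution. -/
theorem norm_sum_sechFilter_smul_bohrPart_le {σ : ℝ} (hσ : 0 < σ) (hH : H.IsHermitian)
    (A : Matrix n n ℂ) (β u κ θ : ℝ) :
    ‖∑ ν ∈ bohr hH, ((sechFilter β σ (u - ν) : ℂ) * Complex.exp (θ * ν)) • bohrPart hH A ν‖ ≤
      Real.exp ((θ - κ) * u) * (Real.exp (σ ^ 2 * (θ - κ) ^ 2) * filterHat σ 0) *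
      ‖NormedSpace.exp ((κ : ℂ) • H) * A * NormedSpace.exp ((-(κ : ℂ)) • H)‖ := by
  set B := NormedSpace.exp ((κ : ℂ) • H) * A * NormedSpace.exp ((-(κ : ℂ)) • H) with hB
  set C : ℝ := Real.exp ((θ - κ) * u) * Real.exp (σ ^ 2 * (θ - κ) ^ 2) with hC
  set u' : ℝ := u - 2 * σ ^ 2 * (-(θ - κ)) with hu'
  have h1 : ∀ ν : ℝ, ((filterHat σ (u - ν) : ℂ) * Complex.exp (θ * ν)) =
      (C : ℂ) * ((filterHat σ (u' - ν) : ℂ) * Complex.exp (κ * ν)) := by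
    intro ν
    have h := exp_mul_filterHat hσ (-(θ - κ)) (u - ν)
    rw [show u - ν - 2 * σ ^ 2 * (-(θ - κ)) = u' - ν by rw [hu']; ring, neg_sq] at h
    have h2 : filterHat σ (u - ν) * Real.exp (θ * ν) =
        C * (filterHat σ (u' - ν) * Real.exp (κ * ν)) := by
      rw [hC]
      have e : Real.exp (θ * ν) =
          Real.exp ((θ - κ) * u) * Real.exp (-(θ - κ) * (u - ν)) * Real.exp (κ * ν) := by
        rw [← Real.exp_add, ← Real.exp_add]; congr 1; ring
      calc _ = Real.exp ((θ - κ) * u) * (Real.exp (-(θ - κ) * (u - ν)) * filterHat σ (u - ν)) *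
            Real.exp (κ * ν) := by rw [e]; ring
        _ = _ := by rw [h]; ring
    exact_mod_cast congrArg (fun x : ℝ => (x : ℂ)) h2
  have h2 : ∑ ν ∈ bohr hH, ((sechFilter β σ (u - ν) : ℂ) * Complex.exp (θ * ν)) • bohrPart hH A ν =
      ∑ ν ∈ bohr hH, ((sech β (u - ν) : ℂ) *
        ((filterHat σ (u - ν) : ℂ) * Complex.exp (θ * ν))) • bohrPart hH A ν := by
    refine Finset.sum_congr rfl fun ν _ => ?_
    rw [sechFilter]; push_cast; ring_nf
  rw [h2]
  refine (norm_sum_sech_smul_bohrPart_le hH A β u _).trans ?_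
  have h3 : ∑ ν ∈ bohr hH, ((filterHat σ (u - ν) : ℂ) * Complex.exp (θ * ν)) • bohrPart hH A ν =
      (C : ℂ) • oft σ H B u' := by
    rw [oft_eq_sum hσ hH, Finset.smul_sum]
    refine Finset.sum_congr rfl fun ν _ => ?_
    rw [h1, hB, bohrPart_exp_mul_mul_exp, smul_smul, smul_smul, mul_assoc]
  rw [h3, norm_smul, Complex.norm_of_nonneg (by positivity)]
  calc _ ≤ C * (filterHat σ 0 * ‖B‖) :=
        mul_le_mul_of_nonneg_left (norm_oft_le hσ hH B u') (by positivity)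
    _ = _ := by rw [hC]; ring

theorem norm_sum_sechFilter_smul_bohrPart_le_exp_abs {σ : ℝ} (hσ : 0 < σ) (hH : H.IsHermitian)
    {A : Matrix n n ℂ} {b M : ℝ} (hb : 0 ≤ b)
    (hM : ∀ κ : ℝ, |κ| ≤ b →
      ‖NormedSpace.exp ((κ : ℂ) • H) * A * NormedSpace.exp ((-(κ : ℂ)) • H)‖ ≤ M)
    (β u θ : ℝ) :
    ‖∑ ν ∈ bohr hH, ((sechFilter β σ (u - ν) : ℂ) * Complex.exp (θ * ν)) • bohrPart hH A ν‖ ≤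
      (Real.exp (σ ^ 2 * (|θ| + b) ^ 2) * filterHat σ 0 * M) * Real.exp ((|θ| - b) * |u|) := by
  have hf := filterHat_nonneg σ 0
  have key : ∀ κ : ℝ, |κ| ≤ b → (θ - κ) * u ≤ (|θ| - b) * |u| →
      ‖∑ ν ∈ bohr hH, ((sechFilter β σ (u - ν) : ℂ) * Complex.exp (θ * ν)) • bohrPart hH A ν‖ ≤
      (Real.exp (σ ^ 2 * (|θ| + b) ^ 2) * filterHat σ 0 * M) * Real.exp ((|θ| - b) * |u|) := by
    intro κ hκ hle
    refine (norm_sum_sechFilter_smul_bohrPart_le hσ hH A β u κ θ).trans ?_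
    have h1 : (θ - κ) ^ 2 ≤ (|θ| + b) ^ 2 := by
      rw [← sq_abs (θ - κ)]
      exact pow_le_pow_left₀ (abs_nonneg _) ((abs_sub _ _).trans (by linarith)) 2
    calc _ ≤ Real.exp ((|θ| - b) * |u|) *
          (Real.exp (σ ^ 2 * (|θ| + b) ^ 2) * filterHat σ 0) * M := by
          gcongr
          exact hM κ hκ
      _ = _ := by ring
  -- The best choice of `κ` is the endpoint of `[-b, b]` with the sign of `u`.
  rcases le_total 0 u with hu | hu
  · refine key b (by rw [abs_of_nonneg hb]) ?_
    rw [abs_of_nonneg hu]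
    nlinarith [le_abs_self θ]
  · refine key (-b) (by rw [abs_neg, abs_of_nonneg hb]) ?_
    rw [abs_of_nonpos hu]
    nlinarith [neg_abs_le θ]

theorem setIntegral_Icc_exp_mul_abs_le {a Ω : ℝ} (ha : 0 < a) (hΩ : 0 ≤ Ω) :
    ∫ x in Set.Icc (-Ω) Ω, Real.exp (a * |x|) ≤ 2 * Real.exp (a * Ω) / a := by
  have h1 : ∫ x in Set.Icc (-Ω) Ω, Real.exp (a * |x|) =
      ∫ x : ℝ, (fun y => (Set.Iic Ω).indicator (fun y => Real.exp (a * y)) y) |x| := by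
    rw [← integral_indicator measurableSet_Icc]
    congr 1; ext x
    simp only [Set.indicator, Set.mem_Icc, Set.mem_Iic, ← abs_le]
  rw [h1, integral_comp_abs, setIntegral_indicator measurableSet_Iic, Set.Ioi_inter_Iic,
    ← intervalIntegral.integral_of_le hΩ, intervalIntegral.integral_comp_mul_left _ ha.ne',
    integral_exp, smul_eq_mul, mul_zero, Real.exp_zero]
  have : 0 < a⁻¹ := by positivity
  rw [mul_div_assoc, div_eq_mul_inv]
  nlinarith

theorem setIntegral_compl_Icc_exp_neg_mul_abs {b Ω : ℝ} (hb : 0 < b) (hΩ : 0 ≤ Ω) :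
    IntegrableOn (fun x : ℝ => Real.exp (-b * |x|)) (Set.Icc (-Ω) Ω)ᶜ ∧
    ∫ x in (Set.Icc (-Ω) Ω)ᶜ, Real.exp (-b * |x|) = 2 * Real.exp (-b * Ω) / b := by
  have h0 : Integrable fun x : ℝ => Real.exp (-b * |x|) := by
    rw [← integrableOn_univ, ← Set.Iic_union_Ioi (a := (0 : ℝ))]
    refine IntegrableOn.union ((integrableOn_exp_mul_Iic hb 0).congr_fun (fun x hx => ?_)
      measurableSet_Iic) ((integrableOn_exp_mul_Ioi (neg_neg_of_pos hb) 0).congr_fun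
      (fun x hx => ?_) measurableSet_Ioi)
    · simp only [abs_of_nonpos (Set.mem_Iic.1 hx), neg_mul_neg]
    · simp only [abs_of_pos (Set.mem_Ioi.1 hx)]
  refine ⟨h0.integrableOn, ?_⟩
  have h1 : ∫ x in (Set.Icc (-Ω) Ω)ᶜ, Real.exp (-b * |x|) =
      ∫ x : ℝ, (fun y => (Set.Ioi Ω).indicator (fun y => Real.exp (-b * y)) y) |x| := by
    rw [← integral_indicator measurableSet_Icc.compl]
    congr 1; ext x
    simp only [Set.indicator, Set.mem_compl_iff, Set.mem_Icc, Set.mem_Ioi, ← abs_le, not_le]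
  rw [h1, integral_comp_abs, setIntegral_indicator measurableSet_Ioi, Set.Ioi_inter_Ioi,
    sup_eq_right.2 hΩ, integral_exp_mul_Ioi (by linarith)]
  field_simp

theorem integral_sechFilter_sub (β σ ν : ℝ) :
    ∫ x, sechFilter β σ (x - ν) = ∫ x, sechFilter β σ x :=
  integral_sub_right_eq_self _ ν

theorem exp_mul_window_mul_exp {σ : ℝ} (hσ : 0 < σ) (hH : H.IsHermitian) (A : Matrix n n ℂ)
    (β Ω : ℝ) (z : ℂ) :
    NormedSpace.exp (z • H) * window β σ hH Ω A * NormedSpace.exp ((-z) • H) =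
      ((∫ x, sechFilter β σ x : ℝ) : ℂ)⁻¹ • ∫ x in Set.Icc (-Ω) Ω,
        ∑ ν ∈ bohr hH, ((sechFilter β σ (x - ν) : ℂ) * Complex.exp (z * ν)) • bohrPart hH A ν := by
  have hi : ∀ ν : ℝ, Integrable (fun x => ((sechFilter β σ (x - ν) : ℂ) * Complex.exp (z * ν)) •
      bohrPart hH A ν) (volume.restrict (Set.Icc (-Ω) Ω)) := fun ν =>
    (((((integrable_sechFilter hσ β).comp_sub_right ν).ofReal (𝕜 := ℂ)).mul_const
      (Complex.exp (z * ν))).smul_const (bohrPart hH A ν)).integrableOn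
  rw [window, exp_mul_sum_bohrPart_mul_exp, integral_finsetSum _ fun ν _ => hi ν, Finset.smul_sum]
  refine Finset.sum_congr rfl fun ν _ => ?_
  rw [integral_smul_const, integral_mul_const, integral_complex_ofReal, smul_smul, windowWeight]
  congr 1
  push_cast
  ring

theorem sub_window_eq {σ : ℝ} (hσ : 0 < σ) (hH : H.IsHermitian) (A : Matrix n n ℂ) (β Ω : ℝ) :
    A - window β σ hH Ω A =
      ((∫ x, sechFilter β σ x : ℝ) : ℂ)⁻¹ • ∫ x in (Set.Icc (-Ω) Ω)ᶜ,
        ∑ ν ∈ bohr hH, ((sechFilter β σ (x - ν) : ℂ) * Complex.exp ((0 : ℝ) * ν)) •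
          bohrPart hH A ν := by
  have hc : (∫ x, sechFilter β σ x) ≠ 0 := (integral_sechFilter_pos hσ β).ne'
  have hi : ∀ ν : ℝ, Integrable (fun x => ((sechFilter β σ (x - ν) : ℂ) *
      Complex.exp ((0 : ℝ) * ν)) • bohrPart hH A ν) (volume.restrict (Set.Icc (-Ω) Ω)ᶜ) := fun ν =>
    (((((integrable_sechFilter hσ β).comp_sub_right ν).ofReal (𝕜 := ℂ)).mul_const
      (Complex.exp ((0 : ℝ) * ν))).smul_const (bohrPart hH A ν)).integrableOn
  rw [window, integral_finsetSum _ fun ν _ => hi ν, Finset.smul_sum]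
  nth_rewrite 1 [← sum_bohrPart hH A]
  rw [← Finset.sum_sub_distrib]
  refine Finset.sum_congr rfl fun ν _ => ?_
  rw [integral_smul_const, integral_mul_const, integral_complex_ofReal, smul_smul]
  have h := integral_add_compl (measurableSet_Icc (a := -Ω) (b := Ω))
    ((integrable_sechFilter hσ β).comp_sub_right ν)
  rw [integral_sechFilter_sub] at h
  have h2 : windowWeight β σ Ω ν / (∫ x, sechFilter β σ x) =
      1 - (∫ x, sechFilter β σ x)⁻¹ * ∫ x in (Set.Icc (-Ω) Ω)ᶜ, sechFilter β σ (x - ν) := by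
    rw [windowWeight]
    field_simp
    linarith
  rw [h2]
  simp only [Complex.ofReal_zero, zero_mul, Complex.exp_zero, mul_one]
  push_cast
  module

/-- A windowed operator has bounded imaginary-time evolution for all times, growing exponentially
with the width of the window beyond the time `b` that the operator itself tolerates. -/
theorem norm_exp_mul_window_mul_exp_le {σ : ℝ} (hσ : 0 < σ) (hH : H.IsHermitian)
    {A : Matrix n n ℂ} {b M : ℝ} (hb : 0 ≤ b) (hM0 : 0 ≤ M)
    (hM : ∀ κ : ℝ, |κ| ≤ b →
      ‖NormedSpace.exp ((κ : ℂ) • H) * A * NormedSpace.exp ((-(κ : ℂ)) • H)‖ ≤ M)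
    (β : ℝ) {θ Ω : ℝ} (hθ : b < |θ|) (hΩ : 0 ≤ Ω) :
    ‖NormedSpace.exp ((θ : ℂ) • H) * window β σ hH Ω A * NormedSpace.exp ((-(θ : ℂ)) • H)‖ ≤
      (∫ x, sechFilter β σ x)⁻¹ * (Real.exp (σ ^ 2 * (|θ| + b) ^ 2) * filterHat σ 0) *
        (2 / (|θ| - b)) * M * Real.exp ((|θ| - b) * Ω) := by
  have hc := integral_sechFilter_pos hσ β
  have hf := filterHat_nonneg σ 0
  rw [exp_mul_window_mul_exp hσ, norm_smul, norm_inv, Complex.norm_of_nonneg hc.le]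
  have h1 : Continuous fun x : ℝ => (Real.exp (σ ^ 2 * (|θ| + b) ^ 2) * filterHat σ 0 * M) *
      Real.exp ((|θ| - b) * |x|) := by fun_prop
  have h2 := norm_integral_le_of_norm_le (μ := volume.restrict (Set.Icc (-Ω) Ω))
    h1.integrableOn_Icc (Filter.Eventually.of_forall fun x =>
      norm_sum_sechFilter_smul_bohrPart_le_exp_abs hσ hH hb hM β x θ)
  rw [integral_const_mul] at h2
  have h3 := setIntegral_Icc_exp_mul_abs_le (sub_pos.2 hθ) hΩ
  calc _ ≤ (∫ x, sechFilter β σ x)⁻¹ * (Real.exp (σ ^ 2 * (|θ| + b) ^ 2) * filterHat σ 0 * M *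
        (2 * Real.exp ((|θ| - b) * Ω) / (|θ| - b))) := by
        refine mul_le_mul_of_nonneg_left (h2.trans ?_) (by positivity)
        exact mul_le_mul_of_nonneg_left h3 (by positivity)
    _ = _ := by ring

/-- An operator with bounded imaginary-time evolution up to time `b` has exponentially small
components outside a wide window. -/
theorem norm_sub_window_le {σ : ℝ} (hσ : 0 < σ) (hH : H.IsHermitian)
    {A : Matrix n n ℂ} {b M : ℝ} (hb : 0 < b)
    (hM : ∀ κ : ℝ, |κ| ≤ b →
      ‖NormedSpace.exp ((κ : ℂ) • H) * A * NormedSpace.exp ((-(κ : ℂ)) • H)‖ ≤ M)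
    (β : ℝ) {Ω : ℝ} (hΩ : 0 ≤ Ω) :
    ‖A - window β σ hH Ω A‖ ≤
      (∫ x, sechFilter β σ x)⁻¹ * (Real.exp (σ ^ 2 * b ^ 2) * filterHat σ 0) * (2 / b) * M *
        Real.exp (-b * Ω) := by
  have hc := integral_sechFilter_pos hσ β
  rw [sub_window_eq hσ hH A β, norm_smul, norm_inv, Complex.norm_of_nonneg hc.le]
  obtain ⟨h1, h2⟩ := setIntegral_compl_Icc_exp_neg_mul_abs hb hΩ
  have h3 : ∀ x : ℝ, ‖∑ ν ∈ bohr hH, ((sechFilter β σ (x - ν) : ℂ) *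
      Complex.exp ((0 : ℝ) * ν)) • bohrPart hH A ν‖ ≤
      (Real.exp (σ ^ 2 * b ^ 2) * filterHat σ 0 * M) * Real.exp (-b * |x|) := by
    intro x
    have := norm_sum_sechFilter_smul_bohrPart_le_exp_abs hσ hH hb.le hM β x 0
    rwa [abs_zero, zero_add, zero_sub] at this
  have h4 := norm_integral_le_of_norm_le (h1.const_mul _) (Filter.Eventually.of_forall h3)
  rw [integral_const_mul, h2] at h4
  calc _ ≤ (∫ x, sechFilter β σ x)⁻¹ * (Real.exp (σ ^ 2 * b ^ 2) * filterHat σ 0 * M *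
        (2 * Real.exp (-b * Ω) / b)) := mul_le_mul_of_nonneg_left h4 (by positivity)
    _ = _ := by ring

theorem kmsNorm_commutator_le_norm [Nonempty n] (hH : H.IsHermitian) (β : ℝ)
    (A X : Matrix n n ℂ) : kmsNorm β H (A * X - X * A) ≤ 2 * ‖A‖ * ‖X‖ := by
  refine (kmsNorm_le_norm hH β _).trans ((norm_sub_le _ _).trans ?_)
  have h1 := norm_mul_le A X
  have h2 := norm_mul_le X A
  linarith

/-- If the Dirichlet form of `X` for the jump `A` is at most `2/t`, then `X` nearly commutes with `A`
in the KMS norm, provided that `A` has bounded imaginary-time evolution. -/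
theorem exists_kmsNorm_commutator_le {β σ b M : ℝ} (hβ : 0 < β) (hσ : 0 < σ) (hb : 0 < b)
    (hM0 : 0 ≤ M) :
    ∃ C : ℝ, 0 ≤ C ∧ ∀ (n : Type u) [Fintype n] [DecidableEq n] [Nonempty n] (H : Matrix n n ℂ)
      (hH : H.IsHermitian) (A X : Matrix n n ℂ) (t : ℝ), A.IsHermitian → ‖X‖ ≤ 1 → 1 ≤ t →
      (∀ κ : ℝ, |κ| ≤ b →
        ‖NormedSpace.exp ((κ : ℂ) • H) * A * NormedSpace.exp ((-(κ : ℂ)) • H)‖ ≤ M) →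
      dirichletForm β σ hH A X ≤ 2 / t →
      kmsNorm β H (A * X - X * A) ≤ C * t ^ (-(2 * b / (β + 5 * b))) := by
  set c := ∫ x, sechFilter β σ x with hc
  have hc0 : 0 < c := integral_sechFilter_pos hσ β
  set C₁ : ℝ := c⁻¹ * (Real.exp (σ ^ 2 * b ^ 2) * filterHat σ 0) * (2 / b) * M with hC₁
  set C₂ : ℝ := Real.sqrt (16 / b * Real.exp (β ^ 2 * σ ^ 2 / 8) / c ^ 2) with hC₂
  have hf := filterHat_nonneg σ 0
  have hC₁0 : 0 ≤ C₁ := by positivity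
  refine ⟨C₂ + 2 * C₁, by positivity, ?_⟩
  intro n _ _ _ H hH A X t hA hX ht hM hD
  -- The windowed part contributes `(Ω e^{βΩ/2} / t)^{1/2}` and the rest `e^{-bΩ}`. With
  -- `Ω ≤ (2/b) e^{bΩ/2}` the two agree if `e^{(β + 5b)Ω/2} = t`.
  set Ω : ℝ := 2 * Real.log t / (β + 5 * b) with hΩdef
  have ht0 : 0 < t := by linarith
  have hΩ : 0 ≤ Ω := by
    have := Real.log_nonneg ht
    positivity
  have hΩt : Real.exp ((β + 5 * b) * Ω / 2) = t := by
    rw [hΩdef, show (β + 5 * b) * (2 * Real.log t / (β + 5 * b)) / 2 = Real.log t by field_simp,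
      Real.exp_log ht0]
  have hpow : t ^ (-(2 * b / (β + 5 * b))) = Real.exp (-b * Ω) := by
    rw [Real.rpow_def_of_pos ht0, hΩdef]
    congr 1; field_simp
  rw [hpow]
  set W := window β σ hH Ω A with hW
  have hsplit : A * X - X * A = (W * X - X * W) + ((A - W) * X - X * (A - W)) := by noncomm_ring
  have h1 : kmsNorm β H ((A - W) * X - X * (A - W)) ≤ 2 * (C₁ * Real.exp (-b * Ω)) := by
    refine (kmsNorm_commutator_le_norm hH β _ _).trans ?_
    have h2 := norm_sub_window_le hσ hH hb hM β hΩ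
    calc _ ≤ 2 * ‖A - W‖ * 1 := by gcongr
      _ ≤ _ := by rw [mul_one]; exact mul_le_mul_of_nonneg_left h2 (by norm_num)
  have h3 : kmsNorm β H (W * X - X * W) ≤ C₂ * Real.exp (-b * Ω) := by
    refine le_of_sq_le_sq ?_ (by positivity)
    have h4 := sq_kmsNorm_commutator_window_le hβ hσ hH hA hΩ X
    rw [← hc, ← hW] at h4
    have h5 : Ω ≤ 2 / b * Real.exp (b * Ω / 2) := by
      have := Real.add_one_le_exp (b * Ω / 2)
      calc Ω = 2 / b * (b * Ω / 2) := by field_simp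
        _ ≤ _ := by gcongr; linarith
    rw [mul_pow, hC₂, Real.sq_sqrt (by positivity), div_mul_eq_mul_div, le_div_iff₀ (by positivity),
      mul_comm _ (c ^ 2)]
    refine h4.trans ?_
    have h6 : 2 / t = 2 * Real.exp (-((β + 5 * b) * Ω / 2)) := by
      rw [Real.exp_neg, hΩt, div_eq_mul_inv]
    have hD0 := dirichletForm_nonneg hβ hσ hH hA X
    calc _ ≤ 4 * (2 / b * Real.exp (b * Ω / 2)) * Real.exp (β * Ω / 2) *
          Real.exp (β ^ 2 * σ ^ 2 / 8) * (2 / t) := by gcongr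
      _ = 16 / b * Real.exp (β ^ 2 * σ ^ 2 / 8) * (Real.exp (b * Ω / 2) * Real.exp (β * Ω / 2) *
          Real.exp (-((β + 5 * b) * Ω / 2))) := by rw [h6]; ring
      _ = _ := by
        rw [← Real.exp_add, ← Real.exp_add, ← Real.exp_nat_mul]
        congr 2
        push_cast; ring
  rw [hsplit]
  refine (kmsNorm_add_le _ _ _ _).trans ?_
  linarith

end Window

/-! ### Contraction semigroups -/

section Semigroup

variable {V : Type*} [NormedAddCommGroup V] [NormedSpace ℂ V] [CompleteSpace V]

omit [CompleteSpace V] in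
theorem norm_one_clm_le : ‖(1 : V →L[ℂ] V)‖ ≤ 1 := ContinuousLinearMap.norm_id_le

theorem norm_exp_clm_le (T : V →L[ℂ] V) : ‖NormedSpace.exp T‖ ≤ Real.exp ‖T‖ := by
  have h1 := NormedSpace.exp_series_hasSum_exp' (𝕂 := ℂ) T
  have h2 := NormedSpace.exp_series_hasSum_exp' (𝕂 := ℝ) ‖T‖
  rw [← Real.exp_eq_exp_ℝ] at h2
  rw [← h1.tsum_eq]
  refine tsum_of_norm_bounded h2 fun k => ?_
  rw [norm_smul, norm_inv, smul_eq_mul]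
  have h3 : ‖(k.factorial : ℂ)‖ = (k.factorial : ℝ) := by simp
  rw [h3]
  refine mul_le_mul_of_nonneg_left ?_ (by positivity)
  rcases Nat.eq_zero_or_pos k with rfl | hk
  · simpa using norm_one_clm_le
  · exact norm_pow_le' T hk

/-- The condition `‖1 + hL‖ ≤ 1 + O(h²)` for `h ≥ 0`, a convenient form of dissipativity for bounded
operators: it is stable under sums and generates contractions. -/
def IsDissipative (L : V →L[ℂ] V) : Prop :=
  ∃ c : ℝ, 0 ≤ c ∧ ∀ h : ℝ, 0 ≤ h → ‖(1 : V →L[ℂ] V) + (h : ℂ) • L‖ ≤ 1 + c * h ^ 2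

omit [CompleteSpace V] in
theorem IsDissipative.zero : IsDissipative (0 : V →L[ℂ] V) :=
  ⟨0, le_rfl, fun h _ => by simpa using norm_one_clm_le⟩

omit [CompleteSpace V] in
theorem IsDissipative.add {L₁ L₂ : V →L[ℂ] V} (h₁ : IsDissipative L₁) (h₂ : IsDissipative L₂) :
    IsDissipative (L₁ + L₂) := by
  obtain ⟨c₁, hc₁, H₁⟩ := h₁
  obtain ⟨c₂, hc₂, H₂⟩ := h₂
  refine ⟨2 * (c₁ + c₂), by positivity, fun h hh => ?_⟩
  have e : (1 : V →L[ℂ] V) + (h : ℂ) • (L₁ + L₂) =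
      (1 / 2 : ℂ) • (((1 : V →L[ℂ] V) + ((2 * h : ℝ) : ℂ) • L₁) +
        ((1 : V →L[ℂ] V) + ((2 * h : ℝ) : ℂ) • L₂)) := by
    push_cast
    module
  rw [e, norm_smul]
  have a := H₁ (2 * h) (by positivity)
  have b := H₂ (2 * h) (by positivity)
  have n := norm_add_le ((1 : V →L[ℂ] V) + ((2 * h : ℝ) : ℂ) • L₁)
    ((1 : V →L[ℂ] V) + ((2 * h : ℝ) : ℂ) • L₂)
  have hn : ‖(1 / 2 : ℂ)‖ = 1 / 2 := by norm_num
  rw [hn]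
  nlinarith

omit [CompleteSpace V] in
theorem IsDissipative.sum {ι : Type*} {s : Finset ι} {L : ι → V →L[ℂ] V}
    (h : ∀ i ∈ s, IsDissipative (L i)) : IsDissipative (∑ i ∈ s, L i) := by
  classical
  induction s using Finset.induction_on with
  | empty => simpa using IsDissipative.zero
  | insert a s ha ih =>
    rw [Finset.sum_insert ha]
    exact (h a (Finset.mem_insert_self a s)).add
      (ih fun i hi => h i (Finset.mem_insert_of_mem hi))

/-- A dissipative operator generates a contraction semigroup: for every `h > 0`,
`e^{sL} = e^{-s/h} e^{(s/h)(1 + hL)}` has norm at most `e^{csh}`, and `h` is arbitrary. -/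
theorem IsDissipative.norm_exp_le_one {L : V →L[ℂ] V} (hL : IsDissipative L) {s : ℝ}
    (hs : 0 ≤ s) : ‖NormedSpace.exp ((s : ℂ) • L)‖ ≤ 1 := by
  obtain ⟨c, hc, H⟩ := hL
  have key : ∀ h : ℝ, 0 < h → ‖NormedSpace.exp ((s : ℂ) • L)‖ ≤ Real.exp (c * s * h) := by
    intro h hh
    have hhc : (h : ℂ) ≠ 0 := by exact_mod_cast hh.ne'
    have e : (s : ℂ) • L = (-(s / h : ℝ) : ℂ) • (1 : V →L[ℂ] V) +
        ((s / h : ℝ) : ℂ) • ((1 : V →L[ℂ] V) + (h : ℂ) • L) := by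
      rw [smul_add, smul_smul, ← add_assoc, ← add_smul, neg_add_cancel, zero_smul, zero_add]
      congr 1
      push_cast
      field_simp
    have hcomm : Commute ((-(s / h : ℝ) : ℂ) • (1 : V →L[ℂ] V))
        (((s / h : ℝ) : ℂ) • ((1 : V →L[ℂ] V) + (h : ℂ) • L)) :=
      ((Commute.one_left _).smul_left _)
    let _ : NormedAlgebra ℚ (V →L[ℂ] V) := NormedAlgebra.restrictScalars ℚ ℂ _
    rw [e, NormedSpace.exp_add_of_commute hcomm]
    have e1 : NormedSpace.exp ((-(s / h : ℝ) : ℂ) • (1 : V →L[ℂ] V)) =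
        Complex.exp (-(s / h : ℝ) : ℂ) • (1 : V →L[ℂ] V) := by
      rw [← Algebra.algebraMap_eq_smul_one, ← Algebra.algebraMap_eq_smul_one,
        Complex.exp_eq_exp_ℂ, NormedSpace.algebraMap_exp_comm]
    rw [e1, smul_mul_assoc, one_mul, norm_smul, Complex.norm_exp]
    have h2 := norm_exp_clm_le (((s / h : ℝ) : ℂ) • ((1 : V →L[ℂ] V) + (h : ℂ) • L))
    have hsh : 0 ≤ s / h := by positivity
    have h3 : ‖((s / h : ℝ) : ℂ) • ((1 : V →L[ℂ] V) + (h : ℂ) • L)‖ ≤ s / h * (1 + c * h ^ 2) := by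
      rw [norm_smul, Complex.norm_of_nonneg hsh]
      exact mul_le_mul_of_nonneg_left (H h hh.le) hsh
    rw [Complex.neg_re, Complex.ofReal_re]
    calc _ ≤ Real.exp (-(s / h)) * Real.exp (s / h * (1 + c * h ^ 2)) := by
          gcongr
          exact h2.trans (Real.exp_le_exp.2 h3)
      _ = _ := by rw [← Real.exp_add]; congr 1; field_simp; ring
  have ht : Filter.Tendsto (fun h : ℝ => Real.exp (c * s * h)) (nhdsWithin 0 (Set.Ioi 0))
      (nhds 1) := by
    have : Continuous fun h : ℝ => Real.exp (c * s * h) := by fun_prop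
    have h1 := this.tendsto 0
    simp only [mul_zero, Real.exp_zero] at h1
    exact h1.mono_left nhdsWithin_le_nhds
  exact ge_of_tendsto ht (Filter.eventually_of_mem self_mem_nhdsWithin fun h hh => key h hh)

theorem hasDerivAt_exp_smul_apply (L : V →L[ℂ] V) (X : V) (s : ℝ) :
    HasDerivAt (fun r : ℝ => NormedSpace.exp ((r : ℂ) • L) X)
      (L (NormedSpace.exp ((s : ℂ) • L) X)) s := by
  have h := (hasDerivAt_exp_smul_const' (𝕂 := ℂ) L (s : ℂ)).clm_apply
    (hasDerivAt_const (s : ℂ) X)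
  exact (h.scomp s Complex.ofRealCLM.hasDerivAt).congr_deriv (by simp)

theorem continuous_exp_smul_apply (L : V →L[ℂ] V) (X : V) :
    Continuous (fun r : ℝ => NormedSpace.exp ((r : ℂ) • L) X) :=
  continuous_iff_continuousAt.2 fun s => (hasDerivAt_exp_smul_apply L X s).continuousAt

/-- Zero modes of the generator are fixed by the semigroup. -/
theorem exp_smul_apply_of_apply_eq_zero {L : V →L[ℂ] V} {X : V} (h : L X = 0) (s : ℝ) :
    NormedSpace.exp ((s : ℂ) • L) X = X := by
  have hd : ∀ r : ℝ, HasDerivAt (fun r : ℝ => NormedSpace.exp ((r : ℂ) • L) X) 0 r := by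
    intro r
    have h1 := (hasDerivAt_exp_smul_const (𝕂 := ℂ) L (r : ℂ)).clm_apply
      (hasDerivAt_const (r : ℂ) X)
    exact (h1.scomp r Complex.ofRealCLM.hasDerivAt).congr_deriv (by simp [h])
  have := is_const_of_deriv_eq_zero (fun r => (hd r).differentiableAt) (fun r => (hd r).deriv) s 0
  simpa using this

end Semigroup

/-! ### Time averages -/

section TimeAverage

variable {n : Type*} [Fintype n] [DecidableEq n]

theorem norm_timeAverage_le {L : Matrix n n ℂ →L[ℂ] Matrix n n ℂ} (hL : IsDissipative L) {t : ℝ}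
    (ht : 0 < t) (X : Matrix n n ℂ) : ‖timeAverage L t X‖ ≤ ‖X‖ := by
  unfold timeAverage
  have h := intervalIntegral.norm_integral_le_of_norm_le_const (a := 0) (b := t) (C := ‖X‖)
    (f := fun s : ℝ => NormedSpace.exp ((s : ℂ) • L) X) fun s hs => by
      rw [Set.uIoc_of_le ht.le] at hs
      exact (ContinuousLinearMap.le_opNorm _ _).trans
        (mul_le_of_le_one_left (norm_nonneg _) (hL.norm_exp_le_one hs.1.le))
  rw [sub_zero, abs_of_pos ht] at h
  rw [norm_smul, Complex.norm_of_nonneg (by positivity)]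
  calc _ ≤ 1 / t * (‖X‖ * t) := mul_le_mul_of_nonneg_left h (by positivity)
    _ = _ := by field_simp

theorem apply_timeAverage (L : Matrix n n ℂ →L[ℂ] Matrix n n ℂ) (t : ℝ) (X : Matrix n n ℂ) :
    L (timeAverage L t X) =
      ((1 / t : ℝ) : ℂ) • (NormedSpace.exp ((t : ℂ) • L) X - X) := by
  unfold timeAverage
  have hc := continuous_exp_smul_apply L X
  rw [map_smul, ← ContinuousLinearMap.intervalIntegral_comp_comm L (hc.intervalIntegrable 0 t),
    intervalIntegral.integral_eq_sub_of_hasDerivAt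
      (fun s _ => hasDerivAt_exp_smul_apply L X s)
      ((L.continuous.comp hc).intervalIntegrable 0 t)]
  simp only [Complex.ofReal_zero, zero_smul, NormedSpace.exp_zero]
  rfl

theorem timeAverage_of_apply_eq_zero {L : Matrix n n ℂ →L[ℂ] Matrix n n ℂ} {X : Matrix n n ℂ}
    (h : L X = 0) {t : ℝ} (ht : 0 < t) : timeAverage L t X = X := by
  unfold timeAverage
  simp_rw [exp_smul_apply_of_apply_eq_zero h]
  rw [intervalIntegral.integral_const, sub_zero, ← Complex.coe_smul, smul_smul,
    ← Complex.ofReal_mul, one_div_mul_cancel ht.ne', Complex.ofReal_one, one_smul]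

/-- The functional `X ↦ Tr[Y† X]`. -/
noncomputable def traceFunctional (Y : Matrix n n ℂ) : Matrix n n ℂ →L[ℂ] ℂ :=
  LinearMap.toContinuousLinearMap
    ((Matrix.traceLinearMap n ℂ ℂ).comp (LinearMap.mulLeft ℂ Yᴴ))

theorem traceFunctional_apply (X Y : Matrix n n ℂ) : traceFunctional Y X = (Yᴴ * X).trace := rfl

theorem star_traceFunctional (X Y : Matrix n n ℂ) :
    star (traceFunctional Y X) = traceFunctional X Y := by
  rw [traceFunctional_apply, traceFunctional_apply, ← Matrix.trace_conjTranspose,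
    Matrix.conjTranspose_mul, Matrix.conjTranspose_conjTranspose]

omit [DecidableEq n] in
theorem IsTraceAdjoint.pow {L L' : Matrix n n ℂ →L[ℂ] Matrix n n ℂ} (h : IsTraceAdjoint L L')
    (k : ℕ) : IsTraceAdjoint (L ^ k) (L' ^ k) := by
  induction k with
  | zero => intro X Y; simp
  | succ k ih =>
    intro X Y
    rw [pow_succ', mul_apply_eq_comp, h, ih, ← mul_apply_eq_comp, ← pow_succ]

omit [DecidableEq n] in
theorem IsTraceAdjoint.ofReal_smul {L L' : Matrix n n ℂ →L[ℂ] Matrix n n ℂ}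
    (h : IsTraceAdjoint L L') (s : ℝ) : IsTraceAdjoint ((s : ℂ) • L) ((s : ℂ) • L') := by
  intro X Y
  rw [smul_apply, smul_apply, Matrix.conjTranspose_smul, Matrix.smul_mul, Matrix.mul_smul,
    Matrix.trace_smul, Matrix.trace_smul, h X Y, Complex.star_def, Complex.conj_ofReal]

theorem IsTraceAdjoint.exp {L L' : Matrix n n ℂ →L[ℂ] Matrix n n ℂ} (h : IsTraceAdjoint L L')
    (s : ℝ) : IsTraceAdjoint (NormedSpace.exp ((s : ℂ) • L)) (NormedSpace.exp ((s : ℂ) • L')) := by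
  intro X Y
  have h1 := ((NormedSpace.exp_series_hasSum_exp' (𝕂 := ℂ) ((s : ℂ) • L)).mapL
    (ContinuousLinearMap.apply ℂ (Matrix n n ℂ) Y)).mapL (traceFunctional X)
  have h2 := (((NormedSpace.exp_series_hasSum_exp' (𝕂 := ℂ) ((s : ℂ) • L')).mapL
    (ContinuousLinearMap.apply ℂ (Matrix n n ℂ) X)).mapL (traceFunctional Y)).star
  rw [star_traceFunctional] at h2
  have hk : (fun k : ℕ => star (traceFunctional Y (ContinuousLinearMap.apply ℂ (Matrix n n ℂ) X
      ((k.factorial : ℂ)⁻¹ • ((s : ℂ) • L') ^ k)))) =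
      fun k : ℕ => traceFunctional X (ContinuousLinearMap.apply ℂ (Matrix n n ℂ) Y
        ((k.factorial : ℂ)⁻¹ • ((s : ℂ) • L) ^ k)) := by
    funext k
    change star (traceFunctional Y (((k.factorial : ℂ)⁻¹ • ((s : ℂ) • L') ^ k) X)) =
      traceFunctional X (((k.factorial : ℂ)⁻¹ • ((s : ℂ) • L) ^ k) Y)
    rw [smul_apply, smul_apply, map_smul, map_smul, smul_eq_mul, smul_eq_mul, star_mul',
      star_traceFunctional, traceFunctional_apply, traceFunctional_apply,
      (h.ofReal_smul s).pow k X Y]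
    simp
  rw [hk] at h2
  exact h2.unique h1

theorem IsTraceAdjoint.timeAverage {L L' : Matrix n n ℂ →L[ℂ] Matrix n n ℂ}
    (h : IsTraceAdjoint L L') (t : ℝ) (X Y : Matrix n n ℂ) :
    ((timeAverage L' t X)ᴴ * Y).trace = (Xᴴ * timeAverage L t Y).trace := by
  rw [← traceFunctional_apply, ← traceFunctional_apply, ← star_traceFunctional]
  unfold QuantumGibbs.timeAverage
  rw [map_smul, map_smul, smul_eq_mul, smul_eq_mul, star_mul',
    ← ContinuousLinearMap.intervalIntegral_comp_comm _
      ((continuous_exp_smul_apply L Y).intervalIntegrable 0 t),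
    ← ContinuousLinearMap.intervalIntegral_comp_comm _
      ((continuous_exp_smul_apply L' X).intervalIntegrable 0 t)]
  simp only [Complex.star_def, Complex.conj_ofReal]
  rw [← intervalIntegral.intervalIntegral_conj]
  congr 1
  refine intervalIntegral.integral_congr fun s _ => ?_
  rw [← Complex.star_def, star_traceFunctional, traceFunctional_apply, traceFunctional_apply]
  exact h.exp s X Y

end TimeAverage

/-! ### The Heisenberg semigroup is a contraction -/

section Dissipative

theorem opNorm_le_of_norm_inner_le {E : Type*} [NormedAddCommGroup E]
    [InnerProductSpace ℂ E] {T : E →L[ℂ] E} {C : ℝ} (hC : 0 ≤ C)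
    (h : ∀ u v : E, ‖inner ℂ u (T v)‖ ≤ C * (‖u‖ ^ 2 + ‖v‖ ^ 2) / 2) : ‖T‖ ≤ C := by
  refine T.opNorm_le_bound hC fun v => ?_
  rcases eq_or_ne (T v) 0 with h0 | h0
  · rw [h0, norm_zero]; positivity
  have hw : 0 < ‖T v‖ := norm_pos_iff.2 h0
  have h1 := h (((‖v‖ / ‖T v‖ : ℝ) : ℂ) • T v) v
  rw [inner_smul_left, inner_self_eq_norm_sq_to_K, norm_mul, norm_smul, Complex.conj_ofReal,
    Complex.norm_of_nonneg (by positivity)] at h1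
  have h2 : ‖((‖T v‖ : ℂ) ^ 2)‖ = ‖T v‖ ^ 2 := by simp
  have h3 : ‖v‖ / ‖T v‖ * ‖T v‖ = ‖v‖ := by field_simp
  have h4 : ‖v‖ / ‖T v‖ * ‖T v‖ ^ 2 = ‖v‖ * ‖T v‖ := by field_simp
  rw [h3] at h1
  have h5 : ‖v‖ * ‖T v‖ ≤ C * ‖v‖ * ‖v‖ := by
    rw [← h4]
    calc _ = ‖v‖ / ‖T v‖ * ‖((‖T v‖ : ℂ) ^ 2)‖ := by rw [h2]
      _ ≤ _ := h1
      _ = _ := by ring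
  have hv : 0 < ‖v‖ := by
    rw [norm_pos_iff]; rintro rfl; simp at h0
  nlinarith

variable {E : Type*} [NormedAddCommGroup E] [InnerProductSpace ℂ E]

theorem sum_transitionCoeff_inner_eq {β σ : ℝ} (hβ : 0 < β) (hσ : 0 < σ) (s : Finset ℝ)
    (x y : ℝ → E) :
    Integrable (fun ω : ℝ => (metropolis β σ ω : ℂ) *
      inner ℂ (∑ ν ∈ s, (filterHat σ (ω - ν) : ℂ) • x ν)
        (∑ ν ∈ s, (filterHat σ (ω - ν) : ℂ) • y ν)) ∧
    ∑ ν₁ ∈ s, ∑ ν₂ ∈ s, (transitionCoeff β σ ν₁ ν₂ : ℂ) * inner ℂ (x ν₂) (y ν₁) =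
      ∫ ω : ℝ, (metropolis β σ ω : ℂ) *
        inner ℂ (∑ ν ∈ s, (filterHat σ (ω - ν) : ℂ) • x ν)
          (∑ ν ∈ s, (filterHat σ (ω - ν) : ℂ) • y ν) := by
  have h1 : ∀ ω : ℝ, (metropolis β σ ω : ℂ) *
      inner ℂ (∑ ν ∈ s, (filterHat σ (ω - ν) : ℂ) • x ν)
        (∑ ν ∈ s, (filterHat σ (ω - ν) : ℂ) • y ν) = ∑ ν₁ ∈ s, ∑ ν₂ ∈ s,
      ((metropolis β σ ω * filterHat σ (ω - ν₁) * filterHat σ (ω - ν₂) : ℝ) : ℂ) *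
        inner ℂ (x ν₂) (y ν₁) := by
    intro ω
    simp only [sum_inner, inner_sum, inner_smul_left, inner_smul_right, Complex.conj_ofReal]
    rw [Finset.mul_sum, Finset.sum_comm' (t' := s) (s' := fun _ => s) (by tauto)]
    simp only [Finset.mul_sum]
    rw [Finset.sum_comm]
    refine Finset.sum_congr rfl fun ν₁ _ => Finset.sum_congr rfl fun ν₂ _ => ?_
    push_cast; ring
  have hi : ∀ ν₁ ν₂ : ℝ, Integrable fun ω : ℝ =>
      ((metropolis β σ ω * filterHat σ (ω - ν₁) * filterHat σ (ω - ν₂) : ℝ) : ℂ) *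
        inner ℂ (x ν₂) (y ν₁) := fun ν₁ ν₂ =>
    ((integrable_transitionCoeff hβ hσ ν₁ ν₂).ofReal (𝕜 := ℂ)).mul_const _
  simp_rw [h1]
  refine ⟨integrable_finsetSum _ fun ν₁ _ => integrable_finsetSum _ fun ν₂ _ => hi ν₁ ν₂, ?_⟩
  rw [integral_finsetSum _ fun ν₁ _ => integrable_finsetSum _ fun ν₂ _ => hi ν₁ ν₂]
  refine Finset.sum_congr rfl fun ν₁ _ => ?_
  rw [integral_finsetSum _ fun ν₂ _ => hi ν₁ ν₂]
  refine Finset.sum_congr rfl fun ν₂ _ => ?_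
  rw [integral_mul_const, integral_complex_ofReal]
  rfl

/-- Complete positivity of the transition part, as a Cauchy–Schwarz inequality: its form is an
integral of `γ(ω) ⟨x(ω), T y(ω)⟩` over `ω`. -/
theorem norm_sum_transitionCoeff_inner_le {β σ : ℝ} (hβ : 0 < β) (hσ : 0 < σ) (s : Finset ℝ)
    (x y : ℝ → E) (T : E →L[ℂ] E) :
    ‖∑ ν₁ ∈ s, ∑ ν₂ ∈ s, (transitionCoeff β σ ν₁ ν₂ : ℂ) * inner ℂ (x ν₂) (T (y ν₁))‖ ≤
      ‖T‖ * ((∑ ν₁ ∈ s, ∑ ν₂ ∈ s, (transitionCoeff β σ ν₁ ν₂ : ℂ) * inner ℂ (x ν₂) (x ν₁)).re +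
        (∑ ν₁ ∈ s, ∑ ν₂ ∈ s, (transitionCoeff β σ ν₁ ν₂ : ℂ) * inner ℂ (y ν₂) (y ν₁)).re) / 2 := by
  obtain ⟨-, h1⟩ := sum_transitionCoeff_inner_eq hβ hσ s x (fun ν => T (y ν))
  obtain ⟨ix, hx⟩ := sum_transitionCoeff_inner_eq hβ hσ s x x
  obtain ⟨iy, hy⟩ := sum_transitionCoeff_inner_eq hβ hσ s y y
  obtain ⟨p, hp⟩ : ∃ p : ℝ → E, ∀ ω, ∑ ν ∈ s, (filterHat σ (ω - ν) : ℂ) • x ν = p ω :=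
    ⟨_, fun _ => rfl⟩
  obtain ⟨r, hr⟩ : ∃ r : ℝ → E, ∀ ω, ∑ ν ∈ s, (filterHat σ (ω - ν) : ℂ) • y ν = r ω :=
    ⟨_, fun _ => rfl⟩
  have hsq : ∀ z : ℝ → E, ∀ ω, (metropolis β σ ω : ℂ) * inner ℂ (z ω) (z ω) =
      ((metropolis β σ ω * ‖z ω‖ ^ 2 : ℝ) : ℂ) := by
    intro z ω
    rw [inner_self_eq_norm_sq_to_K]; push_cast; rfl
  simp only [hp, hsq] at ix hx
  simp only [hr, hsq] at iy hy
  simp only [hp] at h1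
  have ix' : Integrable fun ω => metropolis β σ ω * ‖p ω‖ ^ 2 := ix.re
  have iy' : Integrable fun ω => metropolis β σ ω * ‖r ω‖ ^ 2 := iy.re
  rw [h1, hx, hy]
  rw [integral_complex_ofReal, integral_complex_ofReal, Complex.ofReal_re, Complex.ofReal_re,
    ← integral_add ix' iy', mul_div_assoc, ← integral_div, ← integral_const_mul]
  refine norm_integral_le_of_norm_le (((ix'.add iy').div_const 2).const_mul ‖T‖)
    (Filter.Eventually.of_forall fun ω => ?_)
  have hm := metropolis_nonneg β σ ω
  have e : ∑ ν ∈ s, (filterHat σ (ω - ν) : ℂ) • T (y ν) = T (r ω) := by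
    rw [← hr, map_sum]
    exact Finset.sum_congr rfl fun ν _ => (map_smul T _ _).symm
  rw [e, norm_mul, Complex.norm_of_nonneg hm]
  have h2 : ‖inner ℂ (p ω) (T (r ω))‖ ≤ ‖p ω‖ * (‖T‖ * ‖r ω‖) :=
    (norm_inner_le_norm _ _).trans (mul_le_mul_of_nonneg_left (T.le_opNorm _) (norm_nonneg _))
  have h3 : ‖p ω‖ * (‖T‖ * ‖r ω‖) ≤ ‖T‖ * ((‖p ω‖ ^ 2 + ‖r ω‖ ^ 2) / 2) := by
    have := sq_nonneg (‖p ω‖ - ‖r ω‖)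
    have := norm_nonneg T
    nlinarith
  calc _ ≤ metropolis β σ ω * (‖T‖ * ((‖p ω‖ ^ 2 + ‖r ω‖ ^ 2) / 2)) :=
        mul_le_mul_of_nonneg_left (h2.trans h3) hm
    _ = ‖T‖ * ((metropolis β σ ω * ‖p ω‖ ^ 2 + metropolis β σ ω * ‖r ω‖ ^ 2) / 2) := by ring
    _ = _ := rfl

variable {n : Type*} [Fintype n] [DecidableEq n] {H : Matrix n n ℂ}

theorem inner_toEuclideanCLM_conjTranspose_mul (A B : Matrix n n ℂ) (u v : EuclideanSpace ℂ n) :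
    inner ℂ u (Matrix.toEuclideanCLM (n := n) (𝕜 := ℂ) (Aᴴ * B) v) =
      inner ℂ (Matrix.toEuclideanCLM (n := n) (𝕜 := ℂ) A u)
        (Matrix.toEuclideanCLM (n := n) (𝕜 := ℂ) B v) := by
  rw [map_mul, ← Matrix.star_eq_conjTranspose, map_star, mul_apply_eq_comp,
    ContinuousLinearMap.star_eq_adjoint, ContinuousLinearMap.adjoint_inner_right]

/-- Write `L'(X) = Φ(X) + K† X + X K` with `Φ` completely positive. Then `1 + hL'` agrees up to `O(h²)`
with the map `Ψ(X) = (1 + hK)† X (1 + hK) + h Φ(X)`, which is completely positive as well, so that its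
norm is `‖Ψ(1)‖ = ‖1 + h² K† K‖`; here `L'(1) = 0` enters. -/
theorem isDissipative_heisenbergGenerator {β σ : ℝ} (hβ : 0 < β) (hσ : 0 < σ)
    (hH : H.IsHermitian) (A : Matrix n n ℂ) :
    IsDissipative (heisenbergGenerator β σ hH A) := by
  set τ := Matrix.toEuclideanCLM (n := n) (𝕜 := ℂ) with hτ
  set a : ℝ → Matrix n n ℂ := bohrPart hH A with ha
  set Φ : Matrix n n ℂ → Matrix n n ℂ := fun X =>
    ∑ ν₁ ∈ bohr hH, ∑ ν₂ ∈ bohr hH, (transitionCoeff β σ ν₁ ν₂ : ℂ) • ((a ν₂)ᴴ * (X * a ν₁)) with hΦ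
  set K : Matrix n n ℂ := -∑ ν₁ ∈ bohr hH, ∑ ν₂ ∈ bohr hH,
    ((dirichletCoeff β σ ν₁ ν₂ * Real.exp (-β * ν₁ / 2) : ℝ) : ℂ) • ((a ν₂)ᴴ * a ν₁) with hK
  have hKs : Kᴴ = -∑ ν₁ ∈ bohr hH, ∑ ν₂ ∈ bohr hH,
    ((dirichletCoeff β σ ν₁ ν₂ * Real.exp (-β * ν₂ / 2) : ℝ) : ℂ) • ((a ν₂)ᴴ * a ν₁) := by
    rw [hK, Matrix.conjTranspose_neg, Matrix.conjTranspose_sum]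
    simp only [Matrix.conjTranspose_sum, Matrix.conjTranspose_smul, Matrix.conjTranspose_mul,
      Matrix.conjTranspose_conjTranspose, Complex.star_def, Complex.conj_ofReal]
    rw [Finset.sum_comm]
    simp only [dirichletCoeff_comm]
  have hL : ∀ X, heisenbergGenerator β σ hH A X = Φ X + Kᴴ * X + X * K := by
    intro X
    rw [hKs, hK, hΦ, heisenbergGenerator]
    simp only [sum_apply, smul_apply, sub_apply, sandwich_apply, neg_mul, mul_neg, Finset.sum_mul,
      Finset.mul_sum, ← sub_eq_add_neg, ← Finset.sum_sub_distrib, mul_one, one_mul]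
    refine Finset.sum_congr rfl fun ν₁ _ => Finset.sum_congr rfl fun ν₂ _ => ?_
    rw [transitionCoeff_eq_dirichletCoeff hσ]
    simp only [smul_sub, smul_smul, Matrix.smul_mul, Matrix.mul_smul, mul_assoc]
    push_cast
    simp only [neg_mul]
    rfl
  have hΦin : ∀ X u v, inner ℂ u (τ (Φ X) v) = ∑ ν₁ ∈ bohr hH, ∑ ν₂ ∈ bohr hH,
      (transitionCoeff β σ ν₁ ν₂ : ℂ) * inner ℂ (τ (a ν₂) u) (τ X (τ (a ν₁) v)) := by
    intro X u v
    simp only [hΦ, map_sum, map_smul, sum_apply, smul_apply, inner_sum, inner_smul_right]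
    refine Finset.sum_congr rfl fun ν₁ _ => Finset.sum_congr rfl fun ν₂ _ => ?_
    rw [hτ, inner_toEuclideanCLM_conjTranspose_mul, map_mul, mul_apply_eq_comp]
  refine ⟨2 * ‖K‖ ^ 2, by positivity, fun h hh => ?_⟩
  refine ContinuousLinearMap.opNorm_le_bound _ (by positivity) fun X => ?_
  set C : Matrix n n ℂ := 1 + (h : ℂ) • K with hC
  set Ψ : Matrix n n ℂ → Matrix n n ℂ := fun X => Cᴴ * (X * C) + (h : ℂ) • Φ X with hΨ
  have hCs : Cᴴ = 1 + (h : ℂ) • Kᴴ := by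
    rw [hC, Matrix.conjTranspose_add, Matrix.conjTranspose_one, Matrix.conjTranspose_smul,
      Complex.star_def, Complex.conj_ofReal]
  have hΨL : ∀ X, Ψ X = X + (h : ℂ) • heisenbergGenerator β σ hH A X +
      ((h ^ 2 : ℝ) : ℂ) • (Kᴴ * X * K) := by
    intro X
    change Cᴴ * (X * C) + (h : ℂ) • Φ X = _
    rw [hL, hCs, hC]
    simp only [add_mul, mul_add, one_mul, mul_one, Matrix.smul_mul, Matrix.mul_smul,
      smul_add, smul_smul, mul_assoc]
    push_cast
    module
  have hΨin : ∀ X u v, inner ℂ u (τ (Ψ X) v) =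
      inner ℂ (τ C u) (τ X (τ C v)) + h * inner ℂ u (τ (Φ X) v) := by
    intro X u v
    simp only [hΨ, map_add, map_smul, add_apply, smul_apply, inner_add_right, inner_smul_right]
    rw [hτ, inner_toEuclideanCLM_conjTranspose_mul, map_mul, mul_apply_eq_comp]
  have hΨ1 : ∀ u, (‖τ C u‖ ^ 2 + h * (inner ℂ u (τ (Φ 1) u)).re) ≤
      (1 + ‖K‖ ^ 2 * h ^ 2) * ‖u‖ ^ 2 := by
    intro u
    have e1 := congrArg Complex.re (hΨin 1 u u)
    have e2 : ‖τ C u‖ ^ 2 + h * (inner ℂ u (τ (Φ 1) u)).re =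
        ‖u‖ ^ 2 + h ^ 2 * ‖τ K u‖ ^ 2 := by
      have e3 : inner ℂ u (τ (Ψ 1) u) = inner ℂ u u + ((h ^ 2 : ℝ) : ℂ) * inner ℂ (τ K u) (τ K u) := by
        rw [hΨL, heisenbergGenerator_one, smul_zero, add_zero, mul_one, map_add, map_smul, map_one,
          add_apply, smul_apply, inner_add_right, inner_smul_right, hτ,
          inner_toEuclideanCLM_conjTranspose_mul]
        rfl
      rw [e3, map_one] at e1
      rw [show (1 : EuclideanSpace ℂ n →L[ℂ] EuclideanSpace ℂ n) (τ C u) = τ C u from rfl,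
        inner_self_eq_norm_sq_to_K, inner_self_eq_norm_sq_to_K, inner_self_eq_norm_sq_to_K,
        Complex.add_re, Complex.add_re, Complex.re_ofReal_mul, Complex.re_ofReal_mul] at e1
      simp only [RCLike.ofReal_eq_complex_ofReal, ← Complex.ofReal_pow, Complex.ofReal_re] at e1
      exact e1.symm
    rw [e2]
    have h4 : ‖τ K u‖ ≤ ‖K‖ * ‖u‖ := (τ K).le_opNorm u
    have h5 := pow_le_pow_left₀ (norm_nonneg _) h4 2
    rw [mul_pow] at h5
    have h6 := sq_nonneg h
    nlinarith
  have hΨle : ‖Ψ X‖ ≤ ‖X‖ * (1 + ‖K‖ ^ 2 * h ^ 2) := by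
    rw [Matrix.cstar_norm_def]
    refine opNorm_le_of_norm_inner_le (by positivity) fun u v => ?_
    have h1 := norm_sum_transitionCoeff_inner_le hβ hσ (bohr hH) (fun ν => τ (a ν) u)
      (fun ν => τ (a ν) v) (τ X)
    have e1 : ∀ w, inner ℂ w (τ (Φ 1) w) = ∑ ν₁ ∈ bohr hH, ∑ ν₂ ∈ bohr hH,
        (transitionCoeff β σ ν₁ ν₂ : ℂ) * inner ℂ (τ (a ν₂) w) (τ (a ν₁) w) := by
      intro w
      rw [hΦin, map_one]; rfl
    rw [← e1, ← e1, ← hΦin] at h1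
    have hX : ‖τ X‖ = ‖X‖ := rfl
    rw [hX] at h1
    have h2 : ‖inner ℂ (τ C u) (τ X (τ C v))‖ ≤ ‖X‖ * ((‖τ C u‖ ^ 2 + ‖τ C v‖ ^ 2) / 2) := by
      refine (norm_inner_le_norm _ _).trans ?_
      have h3 : ‖τ X (τ C v)‖ ≤ ‖X‖ * ‖τ C v‖ := (τ X).le_opNorm _
      have h4 := mul_le_mul_of_nonneg_left h3 (norm_nonneg (τ C u))
      have := mul_nonneg (norm_nonneg X) (sq_nonneg (‖τ C u‖ - ‖τ C v‖))
      nlinarith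
    have h5 := hΨ1 u
    have h6 := hΨ1 v
    have h7 : ‖(h : ℂ) * inner ℂ u (τ (Φ X) v)‖ = h * ‖inner ℂ u (τ (Φ X) v)‖ := by
      rw [norm_mul, Complex.norm_of_nonneg hh]
    have h8 : ‖inner ℂ u (τ (Ψ X) v)‖ ≤ ‖inner ℂ (τ C u) (τ X (τ C v))‖ +
        h * ‖inner ℂ u (τ (Φ X) v)‖ := by
      rw [hΨin, ← h7]; exact norm_add_le _ _
    have h9 := mul_le_mul_of_nonneg_left h1 hh
    have h10 := mul_le_mul_of_nonneg_left h5 (norm_nonneg X)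
    have h11 := mul_le_mul_of_nonneg_left h6 (norm_nonneg X)
    refine h8.trans ?_
    linarith
  have hK2 : ‖((h ^ 2 : ℝ) : ℂ) • (Kᴴ * X * K)‖ ≤ h ^ 2 * (‖K‖ ^ 2 * ‖X‖) := by
    rw [norm_smul, Complex.norm_of_nonneg (sq_nonneg h)]
    refine mul_le_mul_of_nonneg_left ?_ (sq_nonneg h)
    calc _ ≤ ‖Kᴴ‖ * ‖X‖ * ‖K‖ := (norm_mul_le _ _).trans
          (mul_le_mul_of_nonneg_right (norm_mul_le _ _) (norm_nonneg _))
      _ = _ := by rw [Matrix.l2_opNorm_conjTranspose]; ring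
  have hfin : ((1 : Matrix n n ℂ →L[ℂ] Matrix n n ℂ) + (h : ℂ) • heisenbergGenerator β σ hH A) X =
      Ψ X - ((h ^ 2 : ℝ) : ℂ) • (Kᴴ * X * K) := by
    rw [hΨL, add_sub_cancel_right]; rfl
  rw [hfin]
  refine (norm_sub_le _ _).trans ?_
  linarith

end Dissipative

/-! ### Supports -/

section Locality

variable {Λ : Type*} [Fintype Λ] [DecidableEq Λ]

theorem siteOp_mul_apply (i : Λ) (M : Matrix (Fin 2) (Fin 2) ℂ) (O : Op Λ) (x y : Λ → Fin 2) :
    (siteOp i M * O) x y = ∑ c, M (x i) c * O (Function.update x i c) y := by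
  rw [Matrix.mul_apply]
  have h : ∀ z : Λ → Fin 2, siteOp i M x z * O z y =
      ∑ c, if Function.update x i c = z then M (x i) c * O (Function.update x i c) y else 0 := by
    intro z
    rw [siteOp, Matrix.of_apply]
    split_ifs with hz
    · rw [Finset.sum_eq_single (z i)]
      · have : Function.update x i (z i) = z := by
          ext1 j
          rcases eq_or_ne j i with rfl | hj
          · simp
          · rw [Function.update_of_ne hj, hz j hj]
        rw [if_pos this, this]
      · intro c _ hc
        rw [if_neg]
        rintro rfl
        simp at hc
      · simp
    · rw [zero_mul, Finset.sum_eq_zero]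
      intro c _
      rw [if_neg]
      rintro rfl
      exact hz fun j hj => (Function.update_of_ne hj _ _).symm
  simp_rw [h]
  rw [Finset.sum_comm]
  simp

theorem mul_siteOp_apply (i : Λ) (M : Matrix (Fin 2) (Fin 2) ℂ) (O : Op Λ) (x y : Λ → Fin 2) :
    (O * siteOp i M) x y = ∑ c, O x (Function.update y i c) * M c (y i) := by
  have h := siteOp_mul_apply i Mᵀ Oᵀ y x
  have e : siteOp i Mᵀ = (siteOp i M)ᵀ := by
    ext x y
    simp only [siteOp, Matrix.of_apply, Matrix.transpose_apply, eq_comm]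
  rw [e, ← Matrix.transpose_mul, Matrix.transpose_apply] at h
  rw [h]
  exact Finset.sum_congr rfl fun c _ => mul_comm _ _

theorem siteOp_one (i : Λ) : siteOp i 1 = 1 := by
  ext x y
  simp only [siteOp, Matrix.of_apply, Matrix.one_apply]
  by_cases h : x = y
  · subst h; simp
  · rw [if_neg h]
    split_ifs with h1 h2
    · exact absurd (funext fun j => by
        rcases eq_or_ne j i with rfl | hj
        exacts [h2, h1 j hj]) h
    · rfl
    · rfl

theorem siteOp_mul_siteOp (i : Λ) (M N : Matrix (Fin 2) (Fin 2) ℂ) :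
    siteOp i M * siteOp i N = siteOp i (M * N) := by
  ext x y
  rw [siteOp_mul_apply]
  simp only [siteOp, Matrix.of_apply, Matrix.mul_apply, Function.update_self]
  split_ifs with h
  · refine Finset.sum_congr rfl fun c _ => ?_
    rw [if_pos]
    intro j hj
    rw [Function.update_of_ne hj, h j hj]
  · refine Finset.sum_eq_zero fun c _ => ?_
    rw [if_neg, mul_zero]
    intro h1
    refine h fun j hj => ?_
    rw [← h1 j hj, Function.update_of_ne hj]

theorem conjTranspose_siteOp (i : Λ) (M : Matrix (Fin 2) (Fin 2) ℂ) :
    (siteOp i M)ᴴ = siteOp i Mᴴ := by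
  ext x y
  simp only [siteOp, Matrix.of_apply, Matrix.conjTranspose_apply, eq_comm]
  split_ifs <;> simp

theorem commute_siteOp_siteOp {i j : Λ} (hij : i ≠ j) (M N : Matrix (Fin 2) (Fin 2) ℂ) :
    Commute (siteOp i M) (siteOp j N) := by
  ext x y
  rw [siteOp_mul_apply, mul_siteOp_apply, Finset.sum_eq_single (y i), Finset.sum_eq_single (x i)]
  · simp only [siteOp, Matrix.of_apply, Function.update_of_ne hij.symm]
    rw [mul_comm]
    congr 2
    refine propext (forall₂_congr fun k hk => ?_)
    rcases eq_or_ne k i with rfl | hki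
    · simp
    · simp [Function.update_of_ne hki]
  · intro c _ hc
    simp only [siteOp, Matrix.of_apply]
    rw [if_neg, zero_mul]
    intro h
    have := h i hij
    simp at this
    exact hc this.symm
  · simp
  · intro c _ hc
    simp only [siteOp, Matrix.of_apply]
    rw [if_neg, mul_zero]
    intro h
    have := h i hij
    simp at this
    exact hc this
  · simp

theorem commute_siteOp_of_notMem_support {O : Op Λ} {i : Λ} (h : i ∉ support O)
    (M : Matrix (Fin 2) (Fin 2) ℂ) : Commute O (siteOp i M) := by
  simp only [support, Finset.mem_filter, Finset.mem_univ, true_and, not_exists, not_not] at h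
  exact h M

theorem notMem_support_iff {O : Op Λ} {i : Λ} :
    i ∉ support O ↔ ∀ M : Matrix (Fin 2) (Fin 2) ℂ, Commute O (siteOp i M) := by
  simp [support]

theorem support_siteOp_subset (i : Λ) (M : Matrix (Fin 2) (Fin 2) ℂ) :
    support (siteOp i M) ⊆ {i} := by
  intro j hj
  by_contra hji
  rw [Finset.mem_singleton] at hji
  exact notMem_support_iff.2 (fun N => commute_siteOp_siteOp (Ne.symm hji) M N) hj

theorem support_commutator_subset (O N : Op Λ) :
    support (O * N - N * O) ⊆ support O ∪ support N := by
  intro i hi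
  by_contra h
  rw [Finset.mem_union, not_or] at h
  refine notMem_support_iff.2 (fun M => ?_) hi
  have h1 := commute_siteOp_of_notMem_support h.1 M
  have h2 := commute_siteOp_of_notMem_support h.2 M
  exact (h1.mul_left h2).sub_left (h2.mul_left h1)

theorem siteOp_single_mul_apply (i : Λ) (a b : Fin 2) (O : Op Λ) (x y : Λ → Fin 2) :
    (siteOp i (Matrix.single a b 1) * O) x y =
      if x i = a then O (Function.update x i b) y else 0 := by
  rw [siteOp_mul_apply, Finset.sum_eq_single b]
  · by_cases h : x i = a
    · simp [h]
    · rw [Matrix.single_apply_of_row_ne (Ne.symm h), if_neg h, zero_mul]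
  · intro c _ hc
    rw [Matrix.single_apply_of_col_ne _ _ (Ne.symm hc), zero_mul]
  · simp

theorem mul_siteOp_single_apply (i : Λ) (a b : Fin 2) (O : Op Λ) (x y : Λ → Fin 2) :
    (O * siteOp i (Matrix.single a b 1)) x y =
      if y i = b then O x (Function.update y i a) else 0 := by
  rw [mul_siteOp_apply, Finset.sum_eq_single a]
  · by_cases h : y i = b
    · simp [h]
    · rw [Matrix.single_apply_of_col_ne _ _ (Ne.symm h), if_neg h, mul_zero]
  · intro c _ hc
    rw [Matrix.single_apply_of_row_ne (Ne.symm hc), mul_zero]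
  · simp

/-- Commuting with the matrix units of a qubit makes `O` diagonal on it. -/
theorem apply_eq_zero_of_notMem_support {O : Op Λ} {i : Λ} (h : i ∉ support O)
    {x y : Λ → Fin 2} (hxy : x i ≠ y i) : O x y = 0 := by
  have h1 := congrFun (congrFun (commute_siteOp_of_notMem_support h
    (Matrix.single (y i) (y i) 1)).eq x) y
  rwa [siteOp_single_mul_apply, mul_siteOp_single_apply, if_pos rfl, if_neg hxy,
    Function.update_eq_self] at h1

theorem apply_update_of_notMem_support {O : Op Λ} {i : Λ} (h : i ∉ support O)
    {x y : Λ → Fin 2} (hxy : x i = y i) (c : Fin 2) :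
    O (Function.update x i c) (Function.update y i c) = O x y := by
  have h1 := congrFun (congrFun (commute_siteOp_of_notMem_support h
    (Matrix.single (x i) c 1)).eq x) (Function.update y i c)
  rw [siteOp_single_mul_apply, mul_siteOp_single_apply, if_pos rfl, Function.update_self,
    if_pos rfl, Function.update_idem, hxy, Function.update_eq_self] at h1
  exact h1.symm

/-- The matrix elements of `O` do not depend on the common part of the configurations outside the
support. -/
theorem apply_eq_apply_of_eqOn_support {O : Op Λ} {x y x' y' : Λ → Fin 2}
    (hx : ∀ i ∈ support O, x i = x' i) (hy : ∀ i ∈ support O, y i = y' i)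
    (h : ∀ i ∉ support O, x i = y i) (h' : ∀ i ∉ support O, x' i = y' i) : O x y = O x' y' := by
  have key : ∀ T : Finset Λ, Disjoint T (support O) →
      O (T.piecewise x' x) (T.piecewise y' y) = O x y := by
    intro T
    induction T using Finset.induction_on with
    | empty => intro _; simp
    | insert i T hi ih =>
      intro hd
      rw [Finset.disjoint_insert_left] at hd
      rw [Finset.piecewise_insert, Finset.piecewise_insert, h' i hd.1,
        apply_update_of_notMem_support hd.1, ih hd.2]
      rw [Finset.piecewise_eq_of_notMem _ _ _ hi, Finset.piecewise_eq_of_notMem _ _ _ hi, h i hd.1]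
  rw [← key (support O)ᶜ disjoint_compl_left]
  congr 1 <;> ext1 i
  · by_cases hi : i ∈ support O
    · simp [hi, hx i hi]
    · simp [hi]
  · by_cases hi : i ∈ support O
    · simp [hi, hy i hi]
    · simp [hi]

/-- In the sum for `(O N)(x, y)` a single intermediate configuration survives: the one that equals `y`
on the support of `O` and `x` elsewhere. -/
theorem commute_of_disjoint_support {O N : Op Λ} (hd : Disjoint (support O) (support N)) :
    Commute O N := by
  have key : ∀ {O N : Op Λ}, Disjoint (support O) (support N) → ∀ x y : Λ → Fin 2,
      (O * N) x y = O x ((support O).piecewise y x) * N ((support O).piecewise y x) y := by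
    intro O N hd x y
    rw [Matrix.mul_apply, Finset.sum_eq_single]
    · intro z _ hz
      obtain ⟨i, hi⟩ := Function.ne_iff.1 hz
      by_cases hO : i ∈ support O
      · rw [Finset.piecewise_eq_of_mem _ _ _ hO] at hi
        rw [apply_eq_zero_of_notMem_support (Finset.disjoint_left.1 hd hO) hi, mul_zero]
      · rw [Finset.piecewise_eq_of_notMem _ _ _ hO] at hi
        rw [apply_eq_zero_of_notMem_support hO hi.symm, zero_mul]
    · simp
  ext x y
  rw [key hd, key hd.symm]
  by_cases hxy : ∃ i, i ∉ support O ∧ i ∉ support N ∧ x i ≠ y i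
  · obtain ⟨i, hO, hN, hi⟩ := hxy
    rw [apply_eq_zero_of_notMem_support (O := N) (i := i) hN (y := y) (by simpa [hO] using hi),
      apply_eq_zero_of_notMem_support (O := O) (i := i) hO (y := y) (by simpa [hN] using hi)]
    simp
  · push Not at hxy
    rw [mul_comm]
    have hNO : ∀ i, i ∈ support N → i ∉ support O := fun i h => Finset.disjoint_right.1 hd h
    have hON : ∀ i, i ∈ support O → i ∉ support N := fun i h => Finset.disjoint_left.1 hd h
    congr 1
    · refine apply_eq_apply_of_eqOn_support ?_ ?_ ?_ ?_
      · intro i hi; simp [hNO i hi]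
      · intro i hi; simp [hi]
      · intro i hi
        by_cases hO : i ∈ support O
        · simp [hO]
        · simpa [hO] using hxy i hO hi
      · intro i hi; simp [hi]
    · refine apply_eq_apply_of_eqOn_support ?_ ?_ ?_ ?_
      · intro i hi; simp [hON i hi]
      · intro i hi; simp [hi]
      · intro i hi; simp [hi]
      · intro i hi
        by_cases hN : i ∈ support N
        · simp [hN]
        · simpa [hN] using hxy i hi hN

theorem conjTranspose_pauli (k : Fin 3) : (pauli k)ᴴ = pauli k := by
  fin_cases k <;> ext i j <;> fin_cases i <;> fin_cases j <;> simp [pauli]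

theorem pauli_mul_self (k : Fin 3) : pauli k * pauli k = 1 := by
  fin_cases k <;> ext i j <;> fin_cases i <;> fin_cases j <;> simp [pauli, Matrix.mul_apply]

theorem isHermitian_siteOp_pauli (i : Λ) (k : Fin 3) : (siteOp i (pauli k)).IsHermitian := by
  rw [Matrix.IsHermitian, conjTranspose_siteOp, conjTranspose_pauli]

theorem siteOp_pauli_mul_self (i : Λ) (k : Fin 3) :
    siteOp i (pauli k) * siteOp i (pauli k) = 1 := by
  rw [siteOp_mul_siteOp, pauli_mul_self, siteOp_one]

theorem siteOp_pauli_mem_unitary (i : Λ) (k : Fin 3) :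
    siteOp i (pauli k) ∈ unitary (Op Λ) := by
  rw [Unitary.mem_iff, Matrix.star_eq_conjTranspose, (isHermitian_siteOp_pauli i k).eq,
    siteOp_pauli_mul_self]
  exact ⟨rfl, rfl⟩

end Locality

/-! ### Imaginary-time evolution of local operators -/

section AdjointAction

theorem exp_add_clm_of_commute {V : Type*} [NormedAddCommGroup V] [NormedSpace ℂ V]
    [CompleteSpace V] {S T : V →L[ℂ] V} (h : Commute S T) :
    NormedSpace.exp (S + T) = NormedSpace.exp S * NormedSpace.exp T := by
  let _ : NormedAlgebra ℚ (V →L[ℂ] V) := NormedAlgebra.restrictScalars ℚ ℂ _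
  exact NormedSpace.exp_add_of_commute h

theorem smul_clm_pow_apply {V : Type*} [NormedAddCommGroup V] [NormedSpace ℂ V] (z : ℂ)
    (T : V →L[ℂ] V) (k : ℕ) (X : V) : ((z • T) ^ k) X = z ^ k • (T ^ k) X := by
  rw [smul_pow, smul_apply]

variable {n : Type*} [Fintype n] [DecidableEq n]

/-- The superoperator `X ↦ H X - X H`. -/
noncomputable def adjointAction (H : Matrix n n ℂ) : Matrix n n ℂ →L[ℂ] Matrix n n ℂ :=
  sandwich H 1 - sandwich 1 H

theorem adjointAction_apply (H X : Matrix n n ℂ) : adjointAction H X = H * X - X * H := by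
  simp [adjointAction]

theorem sandwich_left_pow_apply (a : Matrix n n ℂ) (X : Matrix n n ℂ) (k : ℕ) :
    (sandwich a 1 ^ k) X = a ^ k * X := by
  induction k with
  | zero => simp
  | succ k ih => rw [pow_succ', mul_apply_eq_comp, ih, sandwich_apply, mul_one, pow_succ', mul_assoc]

theorem sandwich_right_pow_apply (a : Matrix n n ℂ) (X : Matrix n n ℂ) (k : ℕ) :
    (sandwich 1 a ^ k) X = X * a ^ k := by
  induction k with
  | zero => simp
  | succ k ih => rw [pow_succ', mul_apply_eq_comp, ih, sandwich_apply, one_mul, pow_succ, mul_assoc]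

theorem hasSum_exp_clm_apply (L : Matrix n n ℂ →L[ℂ] Matrix n n ℂ) (X : Matrix n n ℂ) :
    HasSum (fun k : ℕ => ((k.factorial : ℂ)⁻¹) • (L ^ k) X) (NormedSpace.exp L X) := by
  have h := NormedSpace.exp_series_hasSum_exp' (𝕂 := ℂ) L
  exact h.mapL (ContinuousLinearMap.apply ℂ (Matrix n n ℂ) X)

theorem exp_sandwich_left_apply (a X : Matrix n n ℂ) :
    NormedSpace.exp (sandwich a 1) X = NormedSpace.exp a * X := by
  refine (hasSum_exp_clm_apply (sandwich a 1) X).unique ?_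
  have h := (NormedSpace.exp_series_hasSum_exp' (𝕂 := ℂ) a).mul_right X
  simpa only [sandwich_left_pow_apply, Matrix.smul_mul] using h

theorem exp_sandwich_right_apply (a X : Matrix n n ℂ) :
    NormedSpace.exp (sandwich 1 a) X = X * NormedSpace.exp a := by
  refine (hasSum_exp_clm_apply (sandwich 1 a) X).unique ?_
  have h := (NormedSpace.exp_series_hasSum_exp' (𝕂 := ℂ) a).mul_left X
  simpa only [sandwich_right_pow_apply, Matrix.mul_smul] using h

theorem exp_mul_mul_exp_neg (H X : Matrix n n ℂ) (z : ℂ) :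
    NormedSpace.exp (z • H) * X * NormedSpace.exp ((-z) • H) =
      NormedSpace.exp (z • adjointAction H) X := by
  have e : z • adjointAction H = sandwich (z • H) 1 + sandwich 1 ((-z) • H) := by
    ext1 X
    simp only [smul_apply, add_apply, adjointAction_apply, sandwich_apply, mul_one, one_mul,
      Matrix.smul_mul, Matrix.mul_smul]
    module
  have hc : Commute (sandwich (z • H) 1) (sandwich 1 ((-z) • H)) := by
    ext1 X
    simp only [mul_apply_eq_comp, sandwich_apply, mul_one, one_mul, mul_assoc]
  rw [e, exp_add_clm_of_commute hc, mul_apply_eq_comp, exp_sandwich_right_apply,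
    exp_sandwich_left_apply, mul_assoc]

/-- The power series of `e^{zH} X e^{-zH}` in `z` converges geometrically. -/
theorem norm_exp_mul_mul_exp_neg_le {H X : Matrix n n ℂ} {D : ℝ} (hD : 0 ≤ D)
    (h : ∀ k : ℕ, ‖(adjointAction H ^ k) X‖ ≤ D ^ k * k.factorial) {z : ℂ}
    (hz : ‖z‖ * D ≤ 1 / 2) :
    ‖NormedSpace.exp (z • H) * X * NormedSpace.exp ((-z) • H)‖ ≤ 2 := by
  rw [exp_mul_mul_exp_neg]
  have hs := hasSum_exp_clm_apply (z • adjointAction H) X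
  rw [← hs.tsum_eq]
  refine tsum_of_norm_bounded hasSum_geometric_two fun k => ?_
  have hk : (0 : ℝ) < k.factorial := by exact_mod_cast k.factorial_pos
  rw [smul_clm_pow_apply, norm_smul, norm_smul, norm_pow, norm_inv, Complex.norm_natCast]
  calc (k.factorial : ℝ)⁻¹ * (‖z‖ ^ k * ‖(adjointAction H ^ k) X‖)
      ≤ (k.factorial : ℝ)⁻¹ * (‖z‖ ^ k * (D ^ k * k.factorial)) := by gcongr; exact h k
    _ = (‖z‖ * D) ^ k := by rw [mul_pow]; field_simp
    _ ≤ (1 / 2) ^ k := pow_le_pow_left₀ (by positivity) hz k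

end AdjointAction

namespace LocalHamiltonian

variable {Λ Γ : Type*} [Fintype Λ] [DecidableEq Λ] [Fintype Γ]

theorem adjointAction_total_apply (h : LocalHamiltonian Λ Γ) (N : Op Λ) {W : Finset Γ}
    (hW : ∀ γ ∉ W, Disjoint (support (h.term γ)) (support N)) :
    adjointAction h.total N = ∑ γ ∈ W, (h.term γ * N - N * h.term γ) := by
  rw [adjointAction_apply, total, Finset.sum_mul, Finset.mul_sum, ← Finset.sum_sub_distrib]
  refine (Finset.sum_subset (Finset.subset_univ W) fun γ _ hγ => ?_).symm
  rw [(commute_of_disjoint_support (hW γ hγ)).eq, sub_self]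

omit [Fintype Γ] in
theorem norm_term_commutator_le (h : LocalHamiltonian Λ Γ) (γ : Γ) (N : Op Λ) :
    ‖h.term γ * N - N * h.term γ‖ ≤ 2 * ‖N‖ := by
  have h1 : ‖h.term γ * N‖ ≤ ‖h.term γ‖ * ‖N‖ := norm_mul_le _ _
  have h2 : ‖N * h.term γ‖ ≤ ‖N‖ * ‖h.term γ‖ := norm_mul_le _ _
  have h3 := h.norm_le_one γ
  have h4 := norm_nonneg N
  calc _ ≤ _ := norm_sub_le _ _
    _ ≤ 2 * ‖N‖ := by nlinarith

/-- Cluster bound: each commutator with `H` touches at most `d` terms for every term of the cluster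
that carries `N`, and enlarges the cluster by one of them. -/
theorem norm_adjointAction_pow_le (h : LocalHamiltonian Λ Γ) {d : ℕ} (hd : ∀ γ, h.degree γ ≤ d)
    (k : ℕ) : ∀ (U : Finset Γ) (N : Op Λ), support N ⊆ U.biUnion (fun γ => support (h.term γ)) →
      ‖(adjointAction h.total ^ k) N‖ ≤ (2 * d) ^ k * (U.card.ascFactorial k) * ‖N‖ := by
  classical
  induction k with
  | zero => intro U N _; simp
  | succ k ih =>
    intro U N hU
    set W : Finset Γ := U.biUnion fun γ' => Finset.univ.filter fun γ =>
      (support (h.term γ') ∩ support (h.term γ)).Nonempty with hW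
    have hWc : W.card ≤ U.card * d := Finset.card_biUnion_le_card_mul _ _ _ fun γ _ => hd γ
    have hdis : ∀ γ ∉ W, Disjoint (support (h.term γ)) (support N) := by
      intro γ hγ
      rw [Finset.disjoint_left]
      intro i hi hN
      obtain ⟨γ', hγ', hi'⟩ := Finset.mem_biUnion.1 (hU hN)
      exact hγ (Finset.mem_biUnion.2 ⟨γ', hγ', Finset.mem_filter.2
        ⟨Finset.mem_univ _, i, Finset.mem_inter.2 ⟨hi', hi⟩⟩⟩)
    rw [pow_succ, mul_apply_eq_comp, h.adjointAction_total_apply N hdis, map_sum]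
    have hstep : ∀ γ ∈ W, ‖(adjointAction h.total ^ k) (h.term γ * N - N * h.term γ)‖ ≤
        (2 * d) ^ k * ((U.card + 1).ascFactorial k) * (2 * ‖N‖) := by
      intro γ _
      have hs : support (h.term γ * N - N * h.term γ) ⊆
          (insert γ U).biUnion (fun γ => support (h.term γ)) := by
        rw [Finset.biUnion_insert]
        exact (support_commutator_subset _ _).trans (Finset.union_subset_union_right hU)
      have hm : (insert γ U).card.ascFactorial k ≤ (U.card + 1).ascFactorial k := by
        exact Nat.ascFactorial_le k (Finset.card_insert_le γ U)
      have hm' : ((insert γ U).card.ascFactorial k : ℝ) ≤ (U.card + 1).ascFactorial k := by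
        exact_mod_cast hm
      refine (ih _ _ hs).trans ?_
      gcongr
      exact h.norm_term_commutator_le γ N
    refine (norm_sum_le_of_le W hstep).trans ?_
    rw [Finset.sum_const, nsmul_eq_mul]
    have e : (U.card : ℝ) * ((U.card + 1).ascFactorial k) = U.card.ascFactorial (k + 1) := by
      have := Nat.succ_ascFactorial U.card k
      rw [Nat.ascFactorial_succ]
      exact_mod_cast this
    have hWc' : (W.card : ℝ) ≤ U.card * d := by exact_mod_cast hWc
    calc (W.card : ℝ) * ((2 * d) ^ k * ((U.card + 1).ascFactorial k) * (2 * ‖N‖))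
        ≤ (U.card * d) * ((2 * d) ^ k * ((U.card + 1).ascFactorial k) * (2 * ‖N‖)) := by gcongr
      _ = (2 * d) ^ (k + 1) * (U.card * ((U.card + 1).ascFactorial k)) * ‖N‖ := by ring
      _ = _ := by rw [e]

theorem norm_adjointAction_pow_siteOp_le (h : LocalHamiltonian Λ Γ) {d : ℕ}
    (hd : ∀ γ, h.degree γ ≤ d) (i : Λ) {M : Matrix (Fin 2) (Fin 2) ℂ} (hM : ‖siteOp i M‖ ≤ 1)
    (k : ℕ) : ‖(adjointAction h.total ^ k) (siteOp i M)‖ ≤ (2 * d : ℝ) ^ k * k.factorial := by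
  classical
  cases k with
  | zero => simpa using hM
  | succ k =>
    set W : Finset Γ := Finset.univ.filter fun γ => i ∈ support (h.term γ) with hW
    have hWc : W.card ≤ d := by
      rcases W.eq_empty_or_nonempty with h0 | ⟨γ₀, hγ₀⟩
      · simp [h0]
      · refine (Finset.card_le_card fun γ hγ => ?_).trans (hd γ₀)
        rw [hW, Finset.mem_filter] at hγ hγ₀
        exact Finset.mem_filter.2 ⟨Finset.mem_univ _, i, Finset.mem_inter.2 ⟨hγ₀.2, hγ.2⟩⟩
    have hdis : ∀ γ ∉ W, Disjoint (support (h.term γ)) (support (siteOp i M)) := by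
      intro γ hγ
      refine Finset.disjoint_of_subset_right (support_siteOp_subset i M) ?_
      rw [Finset.disjoint_singleton_right]
      exact fun hi => hγ (Finset.mem_filter.2 ⟨Finset.mem_univ _, hi⟩)
    rw [pow_succ, mul_apply_eq_comp, h.adjointAction_total_apply _ hdis, map_sum]
    have hstep : ∀ γ ∈ W, ‖(adjointAction h.total ^ k)
        (h.term γ * siteOp i M - siteOp i M * h.term γ)‖ ≤ (2 * d) ^ k * k.factorial * 2 := by
      intro γ hγ
      have hs : support (h.term γ * siteOp i M - siteOp i M * h.term γ) ⊆
          ({γ} : Finset Γ).biUnion (fun γ => support (h.term γ)) := by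
        rw [Finset.singleton_biUnion]
        refine (support_commutator_subset _ _).trans (Finset.union_subset subset_rfl ?_)
        refine (support_siteOp_subset i M).trans (Finset.singleton_subset_iff.2 ?_)
        exact (Finset.mem_filter.1 hγ).2
      have h1 := h.norm_adjointAction_pow_le hd k {γ} _ hs
      rw [Finset.card_singleton, Nat.one_ascFactorial] at h1
      refine h1.trans ?_
      gcongr
      exact (h.norm_term_commutator_le γ _).trans (by linarith)
    refine (norm_sum_le_of_le W hstep).trans ?_
    rw [Finset.sum_const, nsmul_eq_mul]
    have hWc' : (W.card : ℝ) ≤ d := by exact_mod_cast hWc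
    calc (W.card : ℝ) * ((2 * d) ^ k * k.factorial * 2)
        ≤ d * ((2 * d) ^ k * k.factorial * 2) := by gcongr
      _ = (2 * d) ^ (k + 1) * k.factorial := by ring
      _ ≤ _ := by
        gcongr
        exact k.le_succ

theorem norm_exp_mul_siteOp_pauli_mul_exp_le (h : LocalHamiltonian Λ Γ) {d : ℕ} (hd1 : 1 ≤ d)
    (hd : ∀ γ, h.degree γ ≤ d) (i : Λ) (k : Fin 3) {κ : ℝ} (hκ : |κ| ≤ beta₀ d) :
    ‖NormedSpace.exp ((κ : ℂ) • h.total) * siteOp i (pauli k) *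
      NormedSpace.exp ((-(κ : ℂ)) • h.total)‖ ≤ 2 := by
  have h1 : ‖siteOp i (pauli k)‖ ≤ 1 :=
    CStarRing.norm_of_mem_unitary (siteOp_pauli_mem_unitary i k) |>.le
  refine norm_exp_mul_mul_exp_neg_le (D := 2 * d) (by positivity)
    (h.norm_adjointAction_pow_siteOp_le hd i h1) ?_
  rw [Complex.norm_real, Real.norm_eq_abs]
  have hd0 : (0 : ℝ) < d := by exact_mod_cast hd1
  calc |κ| * (2 * d) ≤ beta₀ d * (2 * d) := by gcongr
    _ = 1 / 2 := by rw [beta₀]; field_simp; norm_num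

end LocalHamiltonian

/-! ### Duality of the trace norm -/

section TraceNorm

variable {n : Type*} [Fintype n] [DecidableEq n]

/-- Duality of the trace norm and the operator norm: the polar decomposition gives a contraction
that attains the trace norm. -/
theorem exists_trace_mul_eq_traceNorm (M : Matrix n n ℂ) :
    ∃ O : Matrix n n ℂ, ‖O‖ ≤ 1 ∧ (Oᴴ * M).trace.re = traceNorm M := by
  set P : Matrix n n ℂ := CFC.abs M with hP
  have hP0 : 0 ≤ P := CFC.abs_nonneg M
  have hPs : IsSelfAdjoint P := hP0.isSelfAdjoint
  have hPP : P * P = Mᴴ * M := by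
    rw [hP, CFC.abs_mul_abs, Matrix.star_eq_conjTranspose]
  set Q : Matrix n n ℂ := cfc (fun x : ℝ => x⁻¹) P with hQ
  have hcont : ∀ f : ℝ → ℝ, ContinuousOn f (spectrum ℝ P) := fun f =>
    (Matrix.finite_real_spectrum).continuousOn f
  have hQs : IsSelfAdjoint Q := cfc_predicate _ _
  have hid : cfc (fun x : ℝ => x) P = P := cfc_id' ℝ P
  have hPQ' : P * Q = cfc (fun x : ℝ => x * x⁻¹) P := by
    rw [cfc_mul _ _ P (hcont _) (hcont _), hid]
  have hQP' : Q * P = cfc (fun x : ℝ => x⁻¹ * x) P := by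
    rw [cfc_mul _ _ P (hcont _) (hcont _), hid]
  have hQP : Q * P * P = P := by
    have e : Q * P * P = cfc (fun x : ℝ => x⁻¹ * x * x) P := by
      rw [cfc_mul _ _ P (hcont _) (hcont _), hid, hQP']
    rw [e]
    conv_rhs => rw [← hid]
    refine cfc_congr fun x _ => ?_
    rcases eq_or_ne x 0 with rfl | hx
    · simp
    · simp [hx]
  have hcomm : Q * P = P * Q := by
    rw [hPQ', hQP']
    exact cfc_congr fun x _ => mul_comm _ _
  refine ⟨M * Q, ?_, ?_⟩
  · have h1 : (M * Q)ᴴ * (M * Q) = (P * Q) * (P * Q) := by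
      rw [Matrix.conjTranspose_mul, ← Matrix.star_eq_conjTranspose Q, hQs.star_eq, mul_assoc,
        ← mul_assoc Mᴴ, ← hPP, ← hcomm]
      simp only [mul_assoc]
      rw [hcomm]
    have h2 : ‖P * Q‖ ≤ 1 := by
      rw [hPQ']
      refine norm_cfc_le zero_le_one fun x _ => ?_
      rcases eq_or_ne x 0 with rfl | hx
      · simp
      · simp [hx]
    have h3 : ‖M * Q‖ * ‖M * Q‖ ≤ 1 := by
      rw [← Matrix.l2_opNorm_conjTranspose_mul_self, h1]
      refine (norm_mul_le _ _).trans ?_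
      have := norm_nonneg (P * Q)
      nlinarith
    nlinarith [norm_nonneg (M * Q)]
  · rw [Matrix.conjTranspose_mul, ← Matrix.star_eq_conjTranspose Q, hQs.star_eq, mul_assoc, ← hPP,
      ← mul_assoc, hQP, traceNorm]

end TraceNorm

/-! ### Erasure as a mixture of Pauli strings -/

section Refresh

variable {Λ : Type*} [Fintype Λ] [DecidableEq Λ]

/-- The sum over the configurations of `A` in the partial trace, written as a sum over the
configurations of all qubits: this avoids subtypes in the induction on `A`. -/
theorem refresh_apply (A : Finset Λ) (M : Op Λ) (x y : Λ → Fin 2) :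
    refresh A M x y = if ∀ i ∈ A, x i = y i then
      ((2 : ℂ) ^ Fintype.card Λ)⁻¹ * ∑ z : Λ → Fin 2, M (A.piecewise z x) (A.piecewise z y)
      else 0 := by
  have h1 : ∑ z : Λ → Fin 2, M (A.piecewise z x) (A.piecewise z y) =
      (2 : ℂ) ^ (Fintype.card Λ - A.card) * partialTrace A M (fun i => x i) (fun i => y i) := by
    rw [partialTrace, Matrix.of_apply,
      ← (Equiv.piEquivPiSubtypeProd (fun i => i ∈ A) (fun _ => Fin 2)).symm.sum_comp,
      Fintype.sum_prod_type, Finset.mul_sum]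
    refine Finset.sum_congr rfl fun z _ => ?_
    have h2 : ∀ w : {i // i ∉ A} → Fin 2, ∀ x : Λ → Fin 2,
        A.piecewise ((Equiv.piEquivPiSubtypeProd (fun i => i ∈ A) (fun _ => Fin 2)).symm (z, w)) x =
          glue A z (fun i => x i) := by
      intro w x
      ext1 i
      by_cases h : i ∈ A <;> simp [glue, h, Equiv.piEquivPiSubtypeProd]
    simp only [h2]
    rw [Finset.sum_const, nsmul_eq_mul, Finset.card_univ, Fintype.card_fun, Fintype.card_fin,
      Fintype.card_subtype_compl, Fintype.card_coe]
    push_cast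
    rfl
  have h3 : (2 : ℂ) ^ Fintype.card Λ = 2 ^ (Fintype.card Λ - A.card) * 2 ^ A.card := by
    rw [← pow_add, Nat.sub_add_cancel A.card_le_univ]
  rw [refresh, tensorOp, Matrix.of_apply, maximallyMixed, Matrix.smul_apply, Matrix.one_apply, h1,
    h3]
  have h4 : ((fun i : {i // i ∈ A} => x i) = fun i : {i // i ∈ A} => y i) ↔ ∀ i ∈ A, x i = y i :=
    ⟨fun h i hi => congrFun h ⟨i, hi⟩, fun h => funext fun i => h i i.2⟩
  by_cases h : ∀ i ∈ A, x i = y i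
  · rw [if_pos h, if_pos (h4.2 h)]
    have : (2 : ℂ) ^ (Fintype.card Λ - A.card) ≠ 0 := pow_ne_zero _ two_ne_zero
    simp only [smul_eq_mul]
    field_simp
  · rw [if_neg h, if_neg (fun h' => h (h4.1 h'))]
    simp

/-- Averaging over the identity and the three Pauli matrices erases a qubit. -/
theorem pauli_twirl_apply (i : Λ) (M : Op Λ) (x y : Λ → Fin 2) :
    (M + ∑ k, siteOp i (pauli k) * M * siteOp i (pauli k)) x y =
      if x i = y i then 2 * ∑ c, M (Function.update x i c) (Function.update y i c) else 0 := by
  have hx : ∀ c, x i = c → Function.update x i c = x := fun c h => by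
    rw [← h, Function.update_eq_self]
  have hy : ∀ c, y i = c → Function.update y i c = y := fun c h => by
    rw [← h, Function.update_eq_self]
  have hc : ∀ c : Fin 2, c = 0 ∨ c = 1 := by decide
  rcases hc (x i) with h | h <;> rcases hc (y i) with h' | h' <;>
  · rw [Matrix.add_apply, Matrix.sum_apply]
    simp only [mul_siteOp_apply, siteOp_mul_apply, Fin.sum_univ_two, Fin.sum_univ_three, h, h',
      pauli, hx _ h, hy _ h', Matrix.cons_val_zero, Matrix.cons_val_one, Matrix.cons_val,
      Matrix.of_apply]
    simp
    try ring_nf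
    try simp
    try ring_nf

/-- Each configuration arises from two pairs `(c, z)`. -/
theorem sum_sum_update_eq (i : Λ) (G : (Λ → Fin 2) → ℂ) :
    ∑ c, ∑ z : Λ → Fin 2, G (Function.update z i c) = 2 * ∑ z, G z := by
  let e : (Λ → Fin 2) ≃ (Λ → Fin 2) := Function.Involutive.toPerm
    (fun z => Function.update z i (z i + 1)) (fun z => by
      have : ∀ c : Fin 2, c + 1 + 1 = c := by decide
      simp [this])
  have h : ∀ z : Λ → Fin 2, ∑ c, G (Function.update z i c) = G z + G (e z) := by
    intro z
    have hc : ∀ c : Fin 2, c = 0 ∨ c = 1 := by decide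
    have he : e z = Function.update z i (z i + 1) := rfl
    rw [he, Fin.sum_univ_two]
    rcases hc (z i) with h | h
    · rw [h, ← h, Function.update_eq_self, h, zero_add]
    · have h1 : Function.update z i 1 = z := by rw [← h, Function.update_eq_self]
      rw [h, h1, add_comm]
      rfl
  rw [Finset.sum_comm]
  simp_rw [h]
  rw [Finset.sum_add_distrib, e.sum_comp, two_mul]

theorem refresh_empty (M : Op Λ) : refresh ∅ M = M := by
  ext x y
  rw [refresh_apply]
  simp

theorem refresh_insert {i : Λ} {A : Finset Λ} (hi : i ∉ A) (M : Op Λ) :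
    refresh (insert i A) M =
      (1 / 4 : ℝ) • (refresh A M + ∑ k, siteOp i (pauli k) * refresh A M * siteOp i (pauli k)) := by
  ext x y
  rw [Matrix.smul_apply, pauli_twirl_apply, refresh_apply]
  by_cases h : x i = y i
  · rw [if_pos h]
    have h1 : ∀ c, refresh A M (Function.update x i c) (Function.update y i c) =
        if ∀ j ∈ A, x j = y j then ((2 : ℂ) ^ Fintype.card Λ)⁻¹ *
          ∑ z : Λ → Fin 2, M ((insert i A).piecewise (Function.update z i c) x)
            ((insert i A).piecewise (Function.update z i c) y) else 0 := by
      intro c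
      rw [refresh_apply]
      have e1 : (∀ j ∈ A, Function.update x i c j = Function.update y i c j) ↔
          ∀ j ∈ A, x j = y j := forall₂_congr fun j hj => by
        have : j ≠ i := fun h => hi (h ▸ hj)
        rw [Function.update_of_ne this, Function.update_of_ne this]
      have e2 : ∀ z w : Λ → Fin 2, A.piecewise z (Function.update w i c) =
          (insert i A).piecewise (Function.update z i c) w := by
        intro z w
        ext1 j
        rcases eq_or_ne j i with rfl | hj
        · simp [hi]
        · by_cases hA : j ∈ A <;> simp [hA, hj]
      simp only [e1, e2]
    simp only [h1]
    by_cases hA : ∀ j ∈ A, x j = y j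
    · rw [if_pos (by simpa [h] using hA)]
      simp only [if_pos hA]
      rw [← Finset.mul_sum, sum_sum_update_eq i (fun z =>
        M ((insert i A).piecewise z x) ((insert i A).piecewise z y)), Complex.real_smul]
      push_cast
      ring
    · rw [if_neg fun h' => hA fun j hj => h' j (Finset.mem_insert_of_mem hj)]
      simp [hA]
  · rw [if_neg h, if_neg fun h' => h (h' i (Finset.mem_insert_self i A)), smul_zero]

/-- The product `a₁ ⋯ a_k` of single-qubit Pauli matrices listed by `l`. -/
noncomputable def pauliString (l : List (Λ × Fin 3)) : Op Λ :=
  (l.map fun p => siteOp p.1 (pauli p.2)).prod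

theorem pauliString_nil : pauliString ([] : List (Λ × Fin 3)) = 1 := rfl

theorem pauliString_cons (p : Λ × Fin 3) (l : List (Λ × Fin 3)) :
    pauliString (p :: l) = siteOp p.1 (pauli p.2) * pauliString l := rfl

theorem pauliString_mem_unitary (l : List (Λ × Fin 3)) : pauliString l ∈ unitary (Op Λ) := by
  induction l with
  | nil => exact one_mem _
  | cons p l ih => exact mul_mem (siteOp_pauli_mem_unitary p.1 p.2) ih

/-- Erasing the qubits of `A` is a mixture of conjugations by products of jumps. -/
theorem refresh_mem_convexHull (A : Finset Λ) (M : Op Λ) :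
    refresh A M ∈ convexHull ℝ {N : Op Λ | ∃ l : List (Λ × Fin 3), l.length ≤ A.card ∧
      (∀ p ∈ l, p.1 ∈ A) ∧ N = pauliString l * M * (pauliString l)ᴴ} := by
  induction A using Finset.induction_on with
  | empty =>
    rw [refresh_empty]
    refine subset_convexHull ℝ _ ⟨[], by simp, by simp, by simp [pauliString_nil]⟩
  | insert i A hi ih =>
    rw [refresh_insert hi]
    set S : Set (Op Λ) := {N : Op Λ | ∃ l : List (Λ × Fin 3), l.length ≤ (insert i A).card ∧
      (∀ p ∈ l, p.1 ∈ insert i A) ∧ N = pauliString l * M * (pauliString l)ᴴ} with hS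
    have hconv : Convex ℝ (convexHull ℝ S) := convex_convexHull ℝ S
    have h0 : refresh A M ∈ convexHull ℝ S := by
      refine convexHull_mono ?_ ih
      rintro N ⟨l, hl, hm, rfl⟩
      exact ⟨l, hl.trans (Finset.card_le_card (Finset.subset_insert i A)),
        fun p hp => Finset.mem_insert_of_mem (hm p hp), rfl⟩
    have hk : ∀ k : Fin 3, siteOp i (pauli k) * refresh A M * siteOp i (pauli k) ∈
        convexHull ℝ S := by
      intro k
      let T : Op Λ →ₗ[ℝ] Op Λ :=
        { toFun := fun X => siteOp i (pauli k) * X * siteOp i (pauli k)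
          map_add' := fun X Y => by rw [mul_add, add_mul]
          map_smul' := fun r X => by simp }
      have h1 := Set.mem_image_of_mem T ih
      rw [T.image_convexHull] at h1
      refine convexHull_mono ?_ h1
      rintro _ ⟨N, ⟨l, hl, hm, rfl⟩, rfl⟩
      refine ⟨(i, k) :: l, ?_, ?_, ?_⟩
      · rw [List.length_cons, Finset.card_insert_of_notMem hi]; omega
      · intro p hp
        rcases List.mem_cons.1 hp with rfl | hp
        · exact Finset.mem_insert_self _ _
        · exact Finset.mem_insert_of_mem (hm p hp)
      · change siteOp i (pauli k) * _ * siteOp i (pauli k) = _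
        rw [pauliString_cons, Matrix.conjTranspose_mul,
          (isHermitian_siteOp_pauli i k).eq]
        simp only [mul_assoc]
    have e : (1 / 4 : ℝ) • (refresh A M +
        ∑ k, siteOp i (pauli k) * refresh A M * siteOp i (pauli k)) =
        (1 / 2 : ℝ) • ((1 / 2 : ℝ) • refresh A M +
            (1 / 2 : ℝ) • (siteOp i (pauli 0) * refresh A M * siteOp i (pauli 0))) +
          (1 / 2 : ℝ) • ((1 / 2 : ℝ) • (siteOp i (pauli 1) * refresh A M * siteOp i (pauli 1)) +
            (1 / 2 : ℝ) • (siteOp i (pauli 2) * refresh A M * siteOp i (pauli 2))) := by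
      rw [Fin.sum_univ_three]
      module
    rw [e]
    have hh : (0 : ℝ) ≤ 1 / 2 := by norm_num
    have h2 : (1 / 2 : ℝ) + 1 / 2 = 1 := by norm_num
    exact hconv (hconv h0 (hk 0) hh hh h2) (hconv (hk 1) (hk 2) hh hh h2) hh hh h2

end Refresh

/-! ### The generator of a region -/

namespace LocalHamiltonian

variable {Λ Γ : Type*} [Fintype Λ] [DecidableEq Λ] [Fintype Γ]

/-- The generator `∑_{i ∈ A} (L'_{X_i} + L'_{Y_i} + L'_{Z_i})` in the Heisenberg picture. -/
noncomputable def heisenbergGenerator (h : LocalHamiltonian Λ Γ) (β : ℝ) (A : Finset Λ) :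
    Op Λ →L[ℂ] Op Λ :=
  ∑ i ∈ A, ∑ k : Fin 3,
    QuantumGibbs.heisenbergGenerator β (1 / β) h.total_isHermitian (siteOp i (pauli k))

theorem isTraceAdjoint_generator (h : LocalHamiltonian Λ Γ) {β : ℝ} (hβ : 0 < β) (A : Finset Λ) :
    IsTraceAdjoint (h.generator β A) (h.heisenbergGenerator β A) :=
  IsTraceAdjoint.sum fun _ _ => IsTraceAdjoint.sum fun _ _ =>
    isTraceAdjoint_lindbladian hβ (one_div_pos.2 hβ) _ _

theorem isDissipative_heisenbergGenerator (h : LocalHamiltonian Λ Γ) {β : ℝ} (hβ : 0 < β)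
    (A : Finset Λ) : IsDissipative (h.heisenbergGenerator β A) :=
  IsDissipative.sum fun _ _ => IsDissipative.sum fun _ _ =>
    QuantumGibbs.isDissipative_heisenbergGenerator hβ (one_div_pos.2 hβ) _ _

theorem kmsInner_heisenbergGenerator_symm (h : LocalHamiltonian Λ Γ) (β : ℝ) (A : Finset Λ)
    (X Y : Op Λ) :
    kmsInner (gibbs β h.total) X (h.heisenbergGenerator β A Y) =
      kmsInner (gibbs β h.total) (h.heisenbergGenerator β A X) Y := by
  have hH := h.total_isHermitian
  rw [← star_kmsInner hH β Y (h.heisenbergGenerator β A X)]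
  simp only [heisenbergGenerator, sum_apply, kmsInner_sum_right, star_sum]
  refine Finset.sum_congr rfl fun i _ => Finset.sum_congr rfl fun k _ => ?_
  rw [star_kmsInner hH, QuantumGibbs.kmsInner_heisenbergGenerator_symm β (1 / β) hH
    (isHermitian_siteOp_pauli i k)]

theorem isKMSDetailedBalanced_generator (h : LocalHamiltonian Λ Γ) {β : ℝ} (hβ : 0 < β)
    (A : Finset Λ) : IsKMSDetailedBalanced (gibbs β h.total) (h.generator β A) := by
  intro X Y
  have hL := h.isTraceAdjoint_generator hβ A
  rw [hL.hsAdjoint_eq, hL.hsAdjoint_eq, h.kmsInner_heisenbergGenerator_symm]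

theorem heisenbergGenerator_one (h : LocalHamiltonian Λ Γ) (β : ℝ) (A : Finset Λ) :
    h.heisenbergGenerator β A 1 = 0 := by
  rw [heisenbergGenerator, sum_apply]
  refine Finset.sum_eq_zero fun i _ => ?_
  rw [sum_apply]
  exact Finset.sum_eq_zero fun k _ => QuantumGibbs.heisenbergGenerator_one _ _ _ _

open scoped ComplexOrder in
/-- Detailed balance makes the Gibbs state stationary. -/
theorem generator_gibbs (h : LocalHamiltonian Λ Γ) {β : ℝ} (hβ : 0 < β) (A : Finset Λ) :
    h.generator β A (gibbs β h.total) = 0 := by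
  have hH := h.total_isHermitian
  have hL := h.isTraceAdjoint_generator hβ A
  have key : ∀ X, (Xᴴ * h.generator β A (gibbs β h.total)).trace = 0 := by
    intro X
    have h1 := h.kmsInner_heisenbergGenerator_symm β A X 1
    rw [heisenbergGenerator_one] at h1
    simp only [kmsInner, mul_zero, zero_mul, Matrix.trace_zero, mul_one] at h1
    rw [← hL X, h1, mul_assoc, sqrt_gibbs hH, gibbsPow_mul_gibbsPow, add_halves, gibbsPow_one hH]
  exact Matrix.trace_conjTranspose_mul_self_eq_zero_iff.1 (key _)

/-- The Dirichlet form of a time average decays like `1 / t`, for each of the jumps. -/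
theorem dirichletForm_timeAverage_le (h : LocalHamiltonian Λ Γ) {β : ℝ} (hβ : 0 < β)
    {A : Finset Λ} {t : ℝ} (ht : 0 < t) {O : Op Λ} (hO : ‖O‖ ≤ 1) {i : Λ} (hi : i ∈ A)
    (k : Fin 3) :
    dirichletForm β (1 / β) h.total_isHermitian (siteOp i (pauli k))
      (timeAverage (h.heisenbergGenerator β A) t O) ≤ 2 / t := by
  have hH := h.total_isHermitian
  have hσ : 0 < 1 / β := one_div_pos.2 hβ
  have hd := h.isDissipative_heisenbergGenerator hβ A
  set X := timeAverage (h.heisenbergGenerator β A) t O with hX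
  have hX1 : ‖X‖ ≤ 1 := (norm_timeAverage_le hd ht O).trans hO
  have hsum : ∑ i ∈ A, ∑ k : Fin 3, dirichletForm β (1 / β) hH (siteOp i (pauli k)) X =
      -(kmsInner (gibbs β h.total) X (h.heisenbergGenerator β A X)).re := by
    simp only [dirichletForm, heisenbergGenerator, sum_apply, kmsInner_sum_right, Complex.re_sum,
      Finset.sum_neg_distrib]
  have hnn : ∀ i k, 0 ≤ dirichletForm β (1 / β) hH (siteOp i (pauli k)) X := fun i k =>
    dirichletForm_nonneg hβ hσ hH (isHermitian_siteOp_pauli i k) X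
  have h1 : dirichletForm β (1 / β) hH (siteOp i (pauli k)) X ≤
      ∑ i ∈ A, ∑ k : Fin 3, dirichletForm β (1 / β) hH (siteOp i (pauli k)) X :=
    (Finset.single_le_sum (f := fun k => dirichletForm β (1 / β) hH (siteOp i (pauli k)) X)
      (fun k _ => hnn i k) (Finset.mem_univ k)).trans
    (Finset.single_le_sum (f := fun i => ∑ k : Fin 3,
      dirichletForm β (1 / β) hH (siteOp i (pauli k)) X)
      (fun i _ => Finset.sum_nonneg fun k _ => hnn i k) hi)
  have hLX : ‖h.heisenbergGenerator β A X‖ ≤ 2 / t := by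
    have h2 : ‖NormedSpace.exp ((t : ℂ) • h.heisenbergGenerator β A) O‖ ≤ 1 :=
      (ContinuousLinearMap.le_opNorm _ _).trans
        (mul_le_one₀ (hd.norm_exp_le_one ht.le) (norm_nonneg _) hO)
    rw [hX, apply_timeAverage, norm_smul, Complex.norm_of_nonneg (by positivity)]
    calc 1 / t * _ ≤ 1 / t * 2 := by
          gcongr
          exact (norm_sub_le _ _).trans (by linarith)
      _ = 2 / t := by ring
  refine h1.trans ?_
  rw [hsum]
  calc -(kmsInner (gibbs β h.total) X (h.heisenbergGenerator β A X)).re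
      ≤ ‖kmsInner (gibbs β h.total) X (h.heisenbergGenerator β A X)‖ :=
        (neg_le_abs _).trans (Complex.abs_re_le_norm _)
    _ ≤ kmsNorm β h.total X * kmsNorm β h.total (h.heisenbergGenerator β A X) :=
        norm_kmsInner_le hH β _ _
    _ ≤ 1 * (2 / t) := by
        refine mul_le_mul ((kmsNorm_le_norm hH β X).trans hX1)
          ((kmsNorm_le_norm hH β _).trans hLX) (kmsNorm_nonneg _ _ _) zero_le_one
    _ = 2 / t := one_mul _

end LocalHamiltonian

/-! ### From recovery to commutators -/

section Telescope

variable {Λ : Type*} [Fintype Λ] [DecidableEq Λ]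

/-- Conjugation by a Pauli string is undone one factor at a time, at the cost of one commutator with
a jump per factor. -/
theorem norm_trace_mul_sub_pauliString_conj_le {ρ X : Op Λ} {S : Set (Λ × Fin 3)} {m : ℕ} {B : ℝ}
    (hB : ∀ p ∈ S, ∀ l : List (Λ × Fin 3), l.length < m → (∀ q ∈ l, q ∈ S) →
      ‖(pauliString l * ρ * ((pauliString l)ᴴ * siteOp p.1 (pauli p.2)) *
        (siteOp p.1 (pauli p.2) * X - X * siteOp p.1 (pauli p.2))).trace‖ ≤ B)
    (l : List (Λ × Fin 3)) (hl : l.length ≤ m) (hS : ∀ p ∈ l, p ∈ S) :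
    ‖(ρ * (X - (pauliString l)ᴴ * X * pauliString l)).trace‖ ≤ l.length * B := by
  induction l with
  | nil => simp [pauliString_nil]
  | cons p l ih =>
    rw [List.length_cons] at hl
    set P := pauliString l with hP
    set a := siteOp p.1 (pauli p.2) with ha
    have haa : a * a = 1 := siteOp_pauli_mul_self p.1 p.2
    have e : ρ * (X - (pauliString (p :: l))ᴴ * X * pauliString (p :: l)) =
        ρ * (X - Pᴴ * X * P) + ρ * (Pᴴ * a * (a * X - X * a)) * P := by
      have h1 : a * (a * X - X * a) = X - a * X * a := by
        rw [mul_sub, ← mul_assoc, haa, one_mul, mul_assoc]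
      rw [pauliString_cons, Matrix.conjTranspose_mul, (isHermitian_siteOp_pauli p.1 p.2).eq,
        ← hP, ← ha, mul_assoc Pᴴ a (_ - _), h1]
      noncomm_ring
    rw [e, Matrix.trace_add, List.length_cons]
    have h2 := ih (by omega) fun q hq => hS q (List.mem_cons_of_mem _ hq)
    have h3 := hB p (hS p List.mem_cons_self) l (by omega)
      fun q hq => hS q (List.mem_cons_of_mem _ hq)
    have e2 : (ρ * (Pᴴ * a * (a * X - X * a)) * P).trace =
        (P * ρ * (Pᴴ * a) * (a * X - X * a)).trace := by
      rw [Matrix.trace_mul_comm]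
      simp only [mul_assoc]
    rw [e2]
    refine (norm_add_le _ _).trans ?_
    push_cast
    linarith

end Telescope

namespace LocalHamiltonian

variable {Λ Γ : Type*} [Fintype Λ] [DecidableEq Λ] [Fintype Γ]

/-- By duality the recovery error is governed by commutators of the jumps with the time averages of
observables. -/
theorem recoveryError_le (h : LocalHamiltonian Λ Γ) {β t B : ℝ} (hβ : 0 < β) (ht : 0 < t)
    (hB0 : 0 ≤ B) {A : Finset Λ}
    (hB : ∀ X : Op Λ, ‖X‖ ≤ 1 → ∀ p : Λ × Fin 3, p.1 ∈ A →
      dirichletForm β (1 / β) h.total_isHermitian (siteOp p.1 (pauli p.2)) X ≤ 2 / t →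
      ∀ l : List (Λ × Fin 3), l.length < A.card →
      ‖(pauliString l * gibbs β h.total * ((pauliString l)ᴴ * siteOp p.1 (pauli p.2)) *
        (siteOp p.1 (pauli p.2) * X - X * siteOp p.1 (pauli p.2))).trace‖ ≤ B) :
    h.recoveryError β A t ≤ A.card * B := by
  have hH := h.total_isHermitian
  have hL := h.isTraceAdjoint_generator hβ A
  set ρ := gibbs β h.total with hρ
  have hρs : ρᴴ = ρ := by
    rw [hρ, ← gibbsPow_one hH, conjTranspose_gibbsPow hH]
  have hρt : timeAverage (h.generator β A) t ρ = ρ :=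
    timeAverage_of_apply_eq_zero (h.generator_gibbs hβ A) ht
  obtain ⟨O, hO, hOD⟩ := exists_trace_mul_eq_traceNorm
    (timeAverage (h.generator β A) t (refresh A ρ) - ρ)
  rw [recoveryError, ← hOD, mul_sub, Matrix.trace_sub]
  nth_rewrite 2 [← hρt]
  rw [← hL.timeAverage, ← hL.timeAverage]
  set X := timeAverage (h.heisenbergGenerator β A) t O with hX
  have hX1 : ‖X‖ ≤ 1 :=
    (norm_timeAverage_le (h.isDissipative_heisenbergGenerator hβ A) ht O).trans hO
  have hconv : Convex ℝ {N : Op Λ | ‖(Xᴴ * N).trace - (Xᴴ * ρ).trace‖ ≤ A.card * B} := by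
    have h1 := (convex_closedBall ((Xᴴ * ρ).trace) (A.card * B)).linear_preimage
      ((traceFunctional X).toLinearMap.restrictScalars ℝ)
    have h2 : {N : Op Λ | ‖(Xᴴ * N).trace - (Xᴴ * ρ).trace‖ ≤ A.card * B} =
        ((traceFunctional X).toLinearMap.restrictScalars ℝ) ⁻¹'
          Metric.closedBall ((Xᴴ * ρ).trace) (A.card * B) := by
      refine Set.ext fun N => ?_
      rw [Set.mem_preimage, mem_closedBall_iff_norm]
      rfl
    rw [h2]
    exact h1
  have hmem := convexHull_min ?_ hconv (refresh_mem_convexHull A ρ)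
  · exact (Complex.re_le_norm _).trans hmem
  · rintro N ⟨l, hl, hlA, rfl⟩
    have h1 := norm_trace_mul_sub_pauliString_conj_le (ρ := ρ) (X := X)
      (S := {p | p.1 ∈ A}) (m := A.card) (B := B) (fun p hp l hl _ => hB X hX1 p hp
        (h.dirichletForm_timeAverage_le hβ ht hO hp p.2) l hl) l hl hlA
    have e : (Xᴴ * (pauliString l * ρ * (pauliString l)ᴴ)).trace - (Xᴴ * ρ).trace =
        -star ((ρ * (X - (pauliString l)ᴴ * X * pauliString l)).trace) := by
      rw [← Matrix.trace_conjTranspose, Matrix.conjTranspose_mul, Matrix.conjTranspose_sub,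
        Matrix.conjTranspose_mul, Matrix.conjTranspose_mul, Matrix.conjTranspose_conjTranspose, hρs,
        sub_mul, Matrix.trace_sub, neg_sub]
      congr 1
      rw [← mul_assoc, Matrix.trace_mul_comm]
      simp only [mul_assoc]
    change ‖_ - _‖ ≤ _
    rw [e, norm_neg, norm_star]
    refine h1.trans ?_
    have : (l.length : ℝ) ≤ A.card := by exact_mod_cast hl
    gcongr

/-- Imaginary-time evolution up to `β₀` at most doubles each factor of a Pauli string. -/
theorem norm_exp_mul_pauliString_mul_exp_le (h : LocalHamiltonian Λ Γ) {d : ℕ} (hd1 : 1 ≤ d)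
    (hd : ∀ γ, h.degree γ ≤ d) {κ : ℝ} (hκ : |κ| ≤ beta₀ d) (l : List (Λ × Fin 3)) :
    ‖NormedSpace.exp ((κ : ℂ) • h.total) * pauliString l *
      NormedSpace.exp ((-(κ : ℂ)) • h.total)‖ ≤ 2 ^ l.length := by
  have h1 : NormedSpace.exp ((-(κ : ℂ)) • h.total) * NormedSpace.exp ((κ : ℂ) • h.total) = 1 := by
    have := exp_smul_mul_exp_neg_smul h.total (-(κ : ℂ))
    rwa [neg_neg] at this
  induction l with
  | nil =>
    rw [pauliString_nil, mul_one, exp_smul_mul_exp_neg_smul]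
    simp
  | cons p l ih =>
    have e : NormedSpace.exp ((κ : ℂ) • h.total) * pauliString (p :: l) *
        NormedSpace.exp ((-(κ : ℂ)) • h.total) =
        (NormedSpace.exp ((κ : ℂ) • h.total) * siteOp p.1 (pauli p.2) *
          NormedSpace.exp ((-(κ : ℂ)) • h.total)) *
        (NormedSpace.exp ((κ : ℂ) • h.total) * pauliString l *
          NormedSpace.exp ((-(κ : ℂ)) • h.total)) := by
      simp only [mul_assoc]
      rw [← mul_assoc (NormedSpace.exp ((-(κ : ℂ)) • h.total)) (NormedSpace.exp _), h1, one_mul,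
        pauliString_cons, mul_assoc]
    rw [e, List.length_cons, pow_succ']
    exact (norm_mul_le _ _).trans (mul_le_mul
      (h.norm_exp_mul_siteOp_pauli_mul_exp_le hd1 hd p.1 p.2 hκ) ih (norm_nonneg _) zero_le_two)

theorem norm_exp_mul_conjTranspose_pauliString_mul_exp_le (h : LocalHamiltonian Λ Γ) {d : ℕ}
    (hd1 : 1 ≤ d) (hd : ∀ γ, h.degree γ ≤ d) {κ : ℝ} (hκ : |κ| ≤ beta₀ d)
    (l : List (Λ × Fin 3)) (p : Λ × Fin 3) :
    ‖NormedSpace.exp ((κ : ℂ) • h.total) * ((pauliString l)ᴴ * siteOp p.1 (pauli p.2)) *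
      NormedSpace.exp ((-(κ : ℂ)) • h.total)‖ ≤ 2 ^ (l.length + 1) := by
  have hH := h.total_isHermitian
  have h1 : NormedSpace.exp ((-(κ : ℂ)) • h.total) * NormedSpace.exp ((κ : ℂ) • h.total) = 1 := by
    have := exp_smul_mul_exp_neg_smul h.total (-(κ : ℂ))
    rwa [neg_neg] at this
  have e : NormedSpace.exp ((κ : ℂ) • h.total) * ((pauliString l)ᴴ * siteOp p.1 (pauli p.2)) *
        NormedSpace.exp ((-(κ : ℂ)) • h.total) =
        (NormedSpace.exp (((-κ : ℝ) : ℂ) • h.total) * pauliString l *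
          NormedSpace.exp ((-((-κ : ℝ) : ℂ)) • h.total))ᴴ *
        (NormedSpace.exp ((κ : ℂ) • h.total) * siteOp p.1 (pauli p.2) *
          NormedSpace.exp ((-(κ : ℂ)) • h.total)) := by
    rw [Matrix.conjTranspose_mul, Matrix.conjTranspose_mul, conjTranspose_exp_smul hH,
      conjTranspose_exp_smul hH]
    simp only [Complex.ofReal_neg, neg_neg, star_neg, Complex.star_def, Complex.conj_ofReal]
    simp only [mul_assoc]
    rw [← mul_assoc (NormedSpace.exp ((-(κ : ℂ)) • h.total)) (NormedSpace.exp _), h1, one_mul]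
  rw [e, pow_succ]
  refine (norm_mul_le _ _).trans (mul_le_mul ?_
    (h.norm_exp_mul_siteOp_pauli_mul_exp_le hd1 hd p.1 p.2 hκ) (norm_nonneg _) (by positivity))
  rw [Matrix.l2_opNorm_conjTranspose]
  exact h.norm_exp_mul_pauliString_mul_exp_le hd1 hd (by rwa [abs_neg]) l

end LocalHamiltonian

section Norms

variable {Λ : Type*} [Fintype Λ] [DecidableEq Λ]

theorem norm_pauliString_le_one (l : List (Λ × Fin 3)) : ‖pauliString l‖ ≤ 1 :=
  (CStarRing.norm_of_mem_unitary (pauliString_mem_unitary l)).le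

theorem norm_siteOp_pauli_le_one (p : Λ × Fin 3) : ‖siteOp p.1 (pauli p.2)‖ ≤ 1 :=
  (CStarRing.norm_of_mem_unitary (siteOp_pauli_mem_unitary p.1 p.2)).le

theorem norm_conjTranspose_pauliString_mul_le_one (l : List (Λ × Fin 3)) (p : Λ × Fin 3) :
    ‖(pauliString l)ᴴ * siteOp p.1 (pauli p.2)‖ ≤ 1 := by
  refine (norm_mul_le _ _).trans ?_
  rw [Matrix.l2_opNorm_conjTranspose]
  exact mul_le_one₀ (norm_pauliString_le_one l) (norm_nonneg _) (norm_siteOp_pauli_le_one p)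

theorem norm_siteOp_pauli_commutator_le_two (p : Λ × Fin 3) {X : Op Λ} (hX : ‖X‖ ≤ 1) :
    ‖siteOp p.1 (pauli p.2) * X - X * siteOp p.1 (pauli p.2)‖ ≤ 2 := by
  set a := siteOp p.1 (pauli p.2) with ha
  have h2 := norm_mul_le a X
  have h3 := norm_mul_le X a
  have h4 := mul_le_one₀ (norm_siteOp_pauli_le_one p) (norm_nonneg _) hX
  have h5 := norm_sub_le (a * X) (X * a)
  nlinarith

end Norms

/-! ### The two temperature regimes -/

section LowTemperature

variable {n : Type*} [Fintype n] [DecidableEq n] {H : Matrix n n ℂ}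

/-- Below the temperature `1 / (4b)` the operators `Q` and `R` cannot be moved through `ρ^{1/4}`
directly, but their parts in a window of Bohr frequencies can. -/
theorem norm_trace_mul_gibbs_mul_mul_le_window [Nonempty n] {β σ b : ℝ} (hσ : 0 < σ)
    (hb : 0 < b) (hbβ : b < β / 4) (hH : H.IsHermitian) {Q R : Matrix n n ℂ} {M N : ℝ}
    (hQ1 : ‖Q‖ ≤ 1) (hR1 : ‖R‖ ≤ 1) (hM1 : 1 ≤ M) (hN1 : 1 ≤ N)
    (hQ : ∀ κ : ℝ, |κ| ≤ b →
      ‖NormedSpace.exp ((κ : ℂ) • H) * Q * NormedSpace.exp ((-(κ : ℂ)) • H)‖ ≤ M)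
    (hR : ∀ κ : ℝ, |κ| ≤ b →
      ‖NormedSpace.exp ((κ : ℂ) • H) * R * NormedSpace.exp ((-(κ : ℂ)) • H)‖ ≤ N)
    {Ω : ℝ} (hΩ : 0 ≤ Ω) (Y : Matrix n n ℂ) :
    ‖(Q * gibbs β H * R * Y).trace‖ ≤ M * N *
      (((∫ x, sechFilter β σ x)⁻¹ * (Real.exp (σ ^ 2 * (β / 4 + b) ^ 2) * filterHat σ 0) *
          (2 / (β / 4 - b))) ^ 2 * Real.exp (2 * (β / 4 - b) * Ω) * kmsNorm β H Y +
        ((∫ x, sechFilter β σ x)⁻¹ * (Real.exp (σ ^ 2 * b ^ 2) * filterHat σ 0) * (2 / b)) *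
          (2 + (∫ x, sechFilter β σ x)⁻¹ * (Real.exp (σ ^ 2 * b ^ 2) * filterHat σ 0) * (2 / b)) *
            Real.exp (-b * Ω) * ‖Y‖) := by
  have hc := integral_sechFilter_pos hσ β
  have hf := filterHat_nonneg σ 0
  set K₁ := (∫ x, sechFilter β σ x)⁻¹ * (Real.exp (σ ^ 2 * (β / 4 + b) ^ 2) * filterHat σ 0) *
    (2 / (β / 4 - b)) with hK₁
  set K₂ := (∫ x, sechFilter β σ x)⁻¹ * (Real.exp (σ ^ 2 * b ^ 2) * filterHat σ 0) * (2 / b)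
    with hK₂
  have hb4 : 0 < β / 4 - b := sub_pos.2 hbβ
  have hK₁0 : 0 ≤ K₁ := by positivity
  have hK₂0 : 0 ≤ K₂ := by positivity
  set E := Real.exp (-b * Ω) with hE
  have hE0 : 0 ≤ E := (Real.exp_pos _).le
  have hE1 : E ≤ 1 := Real.exp_le_one_iff.2 (by nlinarith)
  set Q' := window β σ hH Ω Q with hQ'
  set R' := window β σ hH Ω R with hR'
  have hβ4 : 0 < β / 4 := hb.trans hbβ
  have hQd : ‖Q - Q'‖ ≤ K₂ * M * E := norm_sub_window_le hσ hH hb hQ β hΩ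
  have hRd : ‖R - R'‖ ≤ K₂ * N * E := norm_sub_window_le hσ hH hb hR β hΩ
  have hQw : ‖NormedSpace.exp (((β / 4 : ℝ) : ℂ) • H) * Q' *
      NormedSpace.exp ((-((β / 4 : ℝ) : ℂ)) • H)‖ ≤ K₁ * M * Real.exp ((β / 4 - b) * Ω) := by
    have := norm_exp_mul_window_mul_exp_le hσ hH hb.le (zero_le_one.trans hM1) hQ β (θ := β / 4)
      (Ω := Ω) (by rwa [abs_of_pos hβ4]) hΩ
    rwa [abs_of_pos hβ4] at this
  have hRw : ‖NormedSpace.exp (((-(β / 4) : ℝ) : ℂ) • H) * R' *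
      NormedSpace.exp ((-((-(β / 4) : ℝ) : ℂ)) • H)‖ ≤ K₁ * N * Real.exp ((β / 4 - b) * Ω) := by
    have := norm_exp_mul_window_mul_exp_le hσ hH hb.le (zero_le_one.trans hN1) hR β
      (θ := -(β / 4)) (Ω := Ω) (by rwa [abs_neg, abs_of_pos hβ4]) hΩ
    rwa [abs_neg, abs_of_pos hβ4] at this
  have hQ'1 : ‖Q'‖ ≤ (1 + K₂) * M := by
    have h1 : ‖Q'‖ ≤ ‖Q‖ + ‖Q - Q'‖ := by
      have := norm_sub_le Q (Q - Q')
      rwa [sub_sub_cancel] at this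
    have h2 : K₂ * M * E ≤ K₂ * M := mul_le_of_le_one_right (by positivity) hE1
    linarith
  have e : Q * gibbs β H * R * Y = Q' * gibbs β H * R' * Y + (Q - Q') * gibbs β H * R * Y +
      Q' * gibbs β H * (R - R') * Y := by
    noncomm_ring
  have h1 : ‖(Q' * gibbs β H * R' * Y).trace‖ ≤
      M * N * (K₁ ^ 2 * Real.exp (2 * (β / 4 - b) * Ω) * kmsNorm β H Y) := by
    refine (norm_trace_mul_gibbs_mul_mul_le_kmsNorm hH β Q' R' Y).trans ?_
    have hY := kmsNorm_nonneg β H Y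
    calc _ ≤ (K₁ * M * Real.exp ((β / 4 - b) * Ω)) * (K₁ * N * Real.exp ((β / 4 - b) * Ω)) *
          kmsNorm β H Y := by gcongr
      _ = _ := by
        rw [show 2 * (β / 4 - b) * Ω = (β / 4 - b) * Ω + (β / 4 - b) * Ω by ring, Real.exp_add]
        ring
  have h2 : ‖((Q - Q') * gibbs β H * R * Y).trace‖ ≤ M * N * (K₂ * E * ‖Y‖) := by
    refine (norm_trace_mul_gibbs_mul_mul_le hH β _ _ _).trans ?_
    calc _ ≤ (K₂ * M * E) * N * ‖Y‖ := by
          gcongr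
          exact hR1.trans hN1
      _ = _ := by ring
  have h3 : ‖(Q' * gibbs β H * (R - R') * Y).trace‖ ≤ M * N * ((1 + K₂) * K₂ * E * ‖Y‖) := by
    refine (norm_trace_mul_gibbs_mul_mul_le hH β _ _ _).trans ?_
    calc _ ≤ ((1 + K₂) * M) * (K₂ * N * E) * ‖Y‖ := by gcongr
      _ = _ := by ring
  rw [e, Matrix.trace_add, Matrix.trace_add]
  refine (norm_add₃_le).trans ((add_le_add (add_le_add h1 h2) h3).trans (le_of_eq ?_))
  ring

end LowTemperature

theorem beta₀_pos {d : ℕ} (hd : 1 ≤ d) : 0 < beta₀ d := by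
  have : (0 : ℝ) < d := by exact_mod_cast hd
  unfold beta₀
  positivity

namespace LocalHamiltonian

section

variable {Λ Γ : Type*} [Fintype Λ] [DecidableEq Λ] [Fintype Γ]

theorem recoveryError_le_of_norm_trace_le (h : LocalHamiltonian Λ Γ) {β C lam : ℝ} (hβ : 0 < β)
    (hlam : 0 ≤ lam) {t : ℝ} (ht : 0 < t) (A : Finset Λ)
    (hC : 1 ≤ t → ∀ X : Op Λ, ‖X‖ ≤ 1 → ∀ p : Λ × Fin 3,
      dirichletForm β (1 / β) h.total_isHermitian (siteOp p.1 (pauli p.2)) X ≤ 2 / t →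
      ∀ l : List (Λ × Fin 3),
      ‖(pauliString l * gibbs β h.total * ((pauliString l)ᴴ * siteOp p.1 (pauli p.2)) *
        (siteOp p.1 (pauli p.2) * X - X * siteOp p.1 (pauli p.2))).trace‖ ≤
        2 ^ l.length * 2 ^ (l.length + 1) * (C * t ^ (-lam))) :
    h.recoveryError β A t ≤ (A.card : ℝ) ^ 2 * 2 ^ (2 * A.card) * (max C 2 * t ^ (-lam)) := by
  have hH := h.total_isHermitian
  have ht0 : 0 < t ^ (-lam) := Real.rpow_pos_of_pos ht _
  have hm : 0 < max C 2 := lt_max_of_lt_right two_pos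
  have h1 := h.recoveryError_le hβ ht (B := 2 ^ (2 * A.card) * (max C 2 * t ^ (-lam)))
    (by positivity) (A := A) fun X hX p _ hp l hl => ?_
  · refine h1.trans ?_
    have h2 : (A.card : ℝ) ≤ (A.card : ℝ) ^ 2 := by
      exact_mod_cast Nat.le_self_pow two_ne_zero _
    rw [mul_assoc]
    gcongr
  · rcases le_total 1 t with h1t | ht1
    · refine (hC h1t X hX p hp l).trans ?_
      rw [← pow_add]
      have h2 : l.length + (l.length + 1) ≤ 2 * A.card := by omega
      calc (2 : ℝ) ^ (l.length + (l.length + 1)) * (C * t ^ (-lam))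
          ≤ 2 ^ (l.length + (l.length + 1)) * (max C 2 * t ^ (-lam)) := by
            gcongr
            exact le_max_left _ _
        _ ≤ _ := by
            gcongr
            exact one_le_two
    -- For `t ≤ 1` the bound is trivial, as the left-hand side never exceeds two.
    · have hP := norm_pauliString_le_one l
      have hPa := norm_conjTranspose_pauliString_mul_le_one l p
      have hY := norm_siteOp_pauli_commutator_le_two p hX
      set a := siteOp p.1 (pauli p.2) with ha'
      have h6 : ‖pauliString l‖ * ‖(pauliString l)ᴴ * a‖ ≤ 1 := mul_le_one₀ hP (norm_nonneg _) hPa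
      have h7 : (1 : ℝ) ≤ t ^ (-lam) :=
        Real.one_le_rpow_of_pos_of_le_one_of_nonpos ht ht1 (neg_nonpos.2 hlam)
      have h8 : (1 : ℝ) ≤ 2 ^ (2 * A.card) := one_le_pow₀ one_le_two
      have h9 : (2 : ℝ) ≤ max C 2 := le_max_right _ _
      calc _ ≤ ‖pauliString l‖ * ‖(pauliString l)ᴴ * a‖ * ‖a * X - X * a‖ :=
            norm_trace_mul_gibbs_mul_mul_le hH β _ _ _
        _ ≤ 1 * (2 * 1) := by
            rw [mul_one]
            exact mul_le_mul h6 hY (norm_nonneg _) zero_le_one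
        _ ≤ 2 ^ (2 * A.card) * (max C 2 * t ^ (-lam)) := by gcongr

end

/-- At high temperature imaginary-time evolution by `β / 4` is controlled directly. -/
theorem exists_recoveryError_le_of_le {d : ℕ} (hd1 : 1 ≤ d) {β : ℝ} (hβ : 0 < β)
    (hβd : β ≤ 4 * beta₀ d) :
    ∃ C : ℝ, 0 < C ∧ ∀ (Λ : Type u) (Γ : Type v) [Fintype Λ] [DecidableEq Λ] [Fintype Γ]
      (h : LocalHamiltonian Λ Γ) (A : Finset Λ) (t : ℝ), (∀ γ, h.degree γ ≤ d) → 0 < t →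
      h.recoveryError β A t ≤ (A.card : ℝ) ^ 2 * 2 ^ (2 * A.card) *
        (C * t ^ (-(2 * beta₀ d / (β + 5 * beta₀ d)))) := by
  have hb := beta₀_pos hd1
  have hσ : 0 < 1 / β := one_div_pos.2 hβ
  obtain ⟨C, hC0, hC⟩ := exists_kmsNorm_commutator_le.{u} hβ hσ hb zero_le_two
  refine ⟨max C 2, lt_max_of_lt_right two_pos, fun Λ Γ _ _ _ h A t hd ht => ?_⟩
  have hH := h.total_isHermitian
  refine h.recoveryError_le_of_norm_trace_le hβ (by positivity) ht A fun h1t X hX p hp l => ?_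
  have h1 := hC _ h.total hH _ X t (isHermitian_siteOp_pauli p.1 p.2) hX h1t
    (fun κ hκ => h.norm_exp_mul_siteOp_pauli_mul_exp_le hd1 hd p.1 p.2 hκ) hp
  have hβ4 : |β / 4| ≤ beta₀ d := by rw [abs_of_pos (by positivity)]; linarith
  refine (norm_trace_mul_gibbs_mul_mul_le_kmsNorm hH β _ _ _).trans ?_
  have h2 := h.norm_exp_mul_pauliString_mul_exp_le hd1 hd hβ4 l
  have h3 := h.norm_exp_mul_conjTranspose_pauliString_mul_exp_le hd1 hd
    (κ := -(β / 4)) (by rwa [abs_neg]) l p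
  exact mul_le_mul (mul_le_mul h2 h3 (norm_nonneg _) (by positivity)) h1 (kmsNorm_nonneg _ _ _)
    (by positivity)

/-- At low temperature the width of the frequency window is chosen to balance its two errors. -/
theorem exists_recoveryError_le_of_lt {d : ℕ} (hd1 : 1 ≤ d) {β : ℝ} (hβ : 0 < β)
    (hβd : 4 * beta₀ d < β) :
    ∃ C : ℝ, 0 < C ∧ ∀ (Λ : Type u) (Γ : Type v) [Fintype Λ] [DecidableEq Λ] [Fintype Γ]
      (h : LocalHamiltonian Λ Γ) (A : Finset Λ) (t : ℝ), (∀ γ, h.degree γ ≤ d) → 0 < t →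
      h.recoveryError β A t ≤ (A.card : ℝ) ^ 2 * 2 ^ (2 * A.card) *
        (C * t ^ (-(128 * beta₀ d ^ 4 / (β ^ 3 * (β + 5 * beta₀ d))))) := by
  have hb := beta₀_pos hd1
  have hσ : 0 < 1 / β := one_div_pos.2 hβ
  have hbβ : beta₀ d < β / 4 := by linarith
  obtain ⟨C, hC0, hC⟩ := exists_kmsNorm_commutator_le.{u} hβ hσ hb zero_le_two
  have hc := integral_sechFilter_pos hσ β
  have hf := filterHat_nonneg (1 / β) 0
  set b := beta₀ d with hbdef
  set K₁ := (∫ x, sechFilter β (1 / β) x)⁻¹ *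
    (Real.exp ((1 / β) ^ 2 * (β / 4 + b) ^ 2) * filterHat (1 / β) 0) * (2 / (β / 4 - b)) with hK₁
  set K₂ := (∫ x, sechFilter β (1 / β) x)⁻¹ *
    (Real.exp ((1 / β) ^ 2 * b ^ 2) * filterHat (1 / β) 0) * (2 / b) with hK₂
  have hK₂0 : 0 ≤ K₂ := by positivity
  set lam₁ := 2 * b / (β + 5 * b) with hlam₁
  have hlam₁0 : 0 < lam₁ := by positivity
  set s := 2 * (β / 4 - b) + b with hs
  have hs0 : 0 < s := by rw [hs]; linarith
  refine ⟨max (K₁ ^ 2 * C + K₂ * (2 + K₂) * 2) 2, lt_max_of_lt_right two_pos,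
    fun Λ Γ _ _ _ h A t hd ht => ?_⟩
  have hH := h.total_isHermitian
  refine h.recoveryError_le_of_norm_trace_le hβ (by positivity) ht A fun h1t X hX p hp l => ?_
  have h1 := hC _ h.total hH _ X t (isHermitian_siteOp_pauli p.1 p.2) hX h1t
    (fun κ hκ => h.norm_exp_mul_siteOp_pauli_mul_exp_le hd1 hd p.1 p.2 hκ) hp
  have hP := norm_pauliString_le_one l
  have hPa := norm_conjTranspose_pauliString_mul_le_one l p
  have hY := norm_siteOp_pauli_commutator_le_two p hX
  set a := siteOp p.1 (pauli p.2) with ha'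
  -- The two errors `e^{2(β/4 - b)Ω} t^{-lam₁}` and `e^{-bΩ}` agree for this `Ω`.
  set Ω := lam₁ * Real.log t / s with hΩ
  have hlog : 0 ≤ Real.log t := Real.log_nonneg h1t
  have hΩ0 : 0 ≤ Ω := by positivity
  have h2 := norm_trace_mul_gibbs_mul_mul_le_window hσ hb hbβ hH hP hPa
    (one_le_pow₀ one_le_two) (one_le_pow₀ one_le_two)
    (fun κ hκ => h.norm_exp_mul_pauliString_mul_exp_le hd1 hd hκ l)
    (fun κ hκ => h.norm_exp_mul_conjTranspose_pauliString_mul_exp_le hd1 hd hκ l p) hΩ0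
    (a * X - X * a)
  refine h2.trans (mul_le_mul_of_nonneg_left ?_ (by positivity))
  -- In terms of `x = β/(4b) > 1` this is the inequality `2x - 1 ≤ x³`.
  have hexp : 128 * b ^ 4 / (β ^ 3 * (β + 5 * b)) ≤ b * lam₁ / s := by
    have e1 : 128 * b ^ 4 / (β ^ 3 * (β + 5 * b)) = lam₁ * (64 * b ^ 3 / β ^ 3) := by
      rw [hlam₁]; field_simp; ring
    have e2 : 64 * b ^ 3 / β ^ 3 ≤ b / s := by
      rw [div_le_div_iff₀ (by positivity) hs0, hs]
      have h3 : 0 < (β - 4 * b) := by linarith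
      have h4 : 0 ≤ b * ((β - 4 * b) * (β ^ 2 + 4 * b * β - 16 * b ^ 2)) := by
        have : 0 ≤ β ^ 2 + 4 * b * β - 16 * b ^ 2 := by nlinarith
        positivity
      nlinarith
    rw [e1, show b * lam₁ / s = lam₁ * (b / s) by ring]
    exact mul_le_mul_of_nonneg_left e2 hlam₁0.le
  have hE : Real.exp (-b * Ω) = t ^ (-(b * lam₁ / s)) := by
    rw [Real.rpow_def_of_pos ht, hΩ]; congr 1; ring
  have hE' : Real.exp (2 * (β / 4 - b) * Ω) * t ^ (-lam₁) = t ^ (-(b * lam₁ / s)) := by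
    rw [Real.rpow_def_of_pos ht, Real.rpow_def_of_pos ht, ← Real.exp_add, hΩ]
    congr 1
    have : 2 * (β / 4 - b) = s - b := by rw [hs]; ring
    rw [this]
    field_simp
    ring
  have hle : t ^ (-(b * lam₁ / s)) ≤ t ^ (-(128 * b ^ 4 / (β ^ 3 * (β + 5 * b)))) :=
    Real.rpow_le_rpow_of_exponent_le h1t (neg_le_neg hexp)
  calc K₁ ^ 2 * Real.exp (2 * (β / 4 - b) * Ω) * kmsNorm β h.total (a * X - X * a) +
        K₂ * (2 + K₂) * Real.exp (-b * Ω) * ‖a * X - X * a‖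
      ≤ K₁ ^ 2 * Real.exp (2 * (β / 4 - b) * Ω) * (C * t ^ (-lam₁)) +
        K₂ * (2 + K₂) * Real.exp (-b * Ω) * 2 := by gcongr
    _ = (K₁ ^ 2 * C) * (Real.exp (2 * (β / 4 - b) * Ω) * t ^ (-lam₁)) +
        K₂ * (2 + K₂) * 2 * Real.exp (-b * Ω) := by ring
    _ = (K₁ ^ 2 * C + K₂ * (2 + K₂) * 2) * t ^ (-(b * lam₁ / s)) := by rw [hE, hE']; ring
    _ ≤ _ := by gcongr

end LocalHamiltonian

end QuantumGibbs

theorem theorem1 :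
    -- the Lindbladian is exactly KMS detailed balanced
    (∀ (Λ : Type u) (Γ : Type v) [Fintype Λ] [DecidableEq Λ] [Fintype Γ] (h : LocalHamiltonian Λ Γ)
      (β : ℝ) (A : Finset Λ), 0 < β →
        IsKMSDetailedBalanced (gibbs β h.total) (h.generator β A)) ∧
    -- the bounds in the two temperature regimes
    (∃ r r' : ℝ → ℕ → ℝ,
      ∀ (Λ : Type u) (Γ : Type v) [Fintype Λ] [DecidableEq Λ] [Fintype Γ] (h : LocalHamiltonian Λ Γ)
        (d : ℕ) (β : ℝ) (A : Finset Λ) (t : ℝ),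
        1 ≤ d → (∀ γ, h.degree γ ≤ d) → 0 < β → 0 < t →
        (4 * beta₀ d < β →
          h.recoveryError β A t ≤ (A.card : ℝ) ^ 2 * 2 ^ (2 * A.card) *
            (r β d * t ^ (-(128 * beta₀ d ^ 4 / (β ^ 3 * (β + 5 * beta₀ d)))))) ∧
        (β ≤ 4 * beta₀ d →
          h.recoveryError β A t ≤ (A.card : ℝ) ^ 2 * 2 ^ (2 * A.card) *
            (r' β d * t ^ (-(2 * beta₀ d / (β + 5 * beta₀ d)))))) ∧
    -- the simplified bound
    (∀ (d : ℕ) (β : ℝ), 1 ≤ d → 0 < β →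
      ∃ r μ lam : ℝ, 0 < r ∧ 0 < μ ∧ 0 < lam ∧ lam < 1 ∧
        ∀ (Λ : Type u) (Γ : Type v) [Fintype Λ] [DecidableEq Λ] [Fintype Γ] (h : LocalHamiltonian Λ Γ)
          (A : Finset Λ) (t : ℝ), (∀ γ, h.degree γ ≤ d) → 0 < t →
          h.recoveryError β A t ≤ r * Real.exp (μ * A.card) * t ^ (-lam)) := by
  refine ⟨?_, ?_, ?_⟩
  · intro Λ Γ _ _ _ h β A hβ
    exact h.isKMSDetailedBalanced_generator hβ A
  · have hr : ∀ (β : ℝ) (d : ℕ), ∃ C : ℝ, 1 ≤ d → 0 < β → 4 * beta₀ d < β →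
        ∀ (Λ : Type u) (Γ : Type v) [Fintype Λ] [DecidableEq Λ] [Fintype Γ]
          (h : LocalHamiltonian Λ Γ) (A : Finset Λ) (t : ℝ), (∀ γ, h.degree γ ≤ d) → 0 < t →
          h.recoveryError β A t ≤ (A.card : ℝ) ^ 2 * 2 ^ (2 * A.card) *
            (C * t ^ (-(128 * beta₀ d ^ 4 / (β ^ 3 * (β + 5 * beta₀ d))))) := by
      intro β d
      by_cases hd : 1 ≤ d ∧ 0 < β ∧ 4 * beta₀ d < β
      · obtain ⟨C, -, hC⟩ :=
          LocalHamiltonian.exists_recoveryError_le_of_lt.{u, v} hd.1 hd.2.1 hd.2.2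
        exact ⟨C, fun _ _ _ => hC⟩
      · exact ⟨0, fun h1 h2 h3 => absurd ⟨h1, h2, h3⟩ hd⟩
    have hr' : ∀ (β : ℝ) (d : ℕ), ∃ C : ℝ, 1 ≤ d → 0 < β → β ≤ 4 * beta₀ d →
        ∀ (Λ : Type u) (Γ : Type v) [Fintype Λ] [DecidableEq Λ] [Fintype Γ]
          (h : LocalHamiltonian Λ Γ) (A : Finset Λ) (t : ℝ), (∀ γ, h.degree γ ≤ d) → 0 < t →
          h.recoveryError β A t ≤ (A.card : ℝ) ^ 2 * 2 ^ (2 * A.card) *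
            (C * t ^ (-(2 * beta₀ d / (β + 5 * beta₀ d)))) := by
      intro β d
      by_cases hd : 1 ≤ d ∧ 0 < β ∧ β ≤ 4 * beta₀ d
      · obtain ⟨C, -, hC⟩ :=
          LocalHamiltonian.exists_recoveryError_le_of_le.{u, v} hd.1 hd.2.1 hd.2.2
        exact ⟨C, fun _ _ _ => hC⟩
      · exact ⟨0, fun h1 h2 h3 => absurd ⟨h1, h2, h3⟩ hd⟩
    choose r hr using hr
    choose r' hr' using hr'
    exact ⟨r, r', fun Λ Γ _ _ _ h d β A t hd1 hd hβ ht =>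
      ⟨fun hlt => hr β d hd1 hβ hlt Λ Γ h A t hd ht,
        fun hle => hr' β d hd1 hβ hle Λ Γ h A t hd ht⟩⟩
  · intro d β hd1 hβ
    have hb := beta₀_pos hd1
    have hcard : ∀ m : ℕ, (m : ℝ) ^ 2 * 2 ^ (2 * m) ≤ Real.exp (4 * m) := by
      intro m
      have h1 : (m : ℝ) ≤ Real.exp m := by linarith [Real.add_one_le_exp (m : ℝ)]
      have h2 : (2 : ℝ) ^ m ≤ Real.exp m := by
        rw [← Real.exp_one_pow m]
        exact pow_le_pow_left₀ zero_le_two (by linarith [Real.add_one_le_exp (1 : ℝ)]) m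
      calc (m : ℝ) ^ 2 * 2 ^ (2 * m) = (m : ℝ) ^ 2 * (2 ^ m) ^ 2 := by rw [mul_comm 2 m, pow_mul]
        _ ≤ Real.exp m ^ 2 * Real.exp m ^ 2 := by gcongr
        _ = Real.exp (4 * m) := by rw [← pow_add, ← Real.exp_nat_mul]; norm_num
    have hfinal : ∀ lam : ℝ, 0 < lam → lam < 1 → (∃ C : ℝ, 0 < C ∧
        ∀ (Λ : Type u) (Γ : Type v) [Fintype Λ] [DecidableEq Λ] [Fintype Γ]
          (h : LocalHamiltonian Λ Γ) (A : Finset Λ) (t : ℝ), (∀ γ, h.degree γ ≤ d) → 0 < t →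
          h.recoveryError β A t ≤ (A.card : ℝ) ^ 2 * 2 ^ (2 * A.card) * (C * t ^ (-lam))) →
        ∃ r μ lam : ℝ, 0 < r ∧ 0 < μ ∧ 0 < lam ∧ lam < 1 ∧
        ∀ (Λ : Type u) (Γ : Type v) [Fintype Λ] [DecidableEq Λ] [Fintype Γ]
          (h : LocalHamiltonian Λ Γ) (A : Finset Λ) (t : ℝ), (∀ γ, h.degree γ ≤ d) → 0 < t →
          h.recoveryError β A t ≤ r * Real.exp (μ * A.card) * t ^ (-lam) := by
      rintro lam h0 h1 ⟨C, hC0, hC⟩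
      refine ⟨C, 4, lam, hC0, by norm_num, h0, h1, fun Λ Γ _ _ _ h A t hd ht => ?_⟩
      have h2 : 0 < t ^ (-lam) := Real.rpow_pos_of_pos ht _
      calc _ ≤ _ := hC Λ Γ h A t hd ht
        _ ≤ Real.exp (4 * A.card) * (C * t ^ (-lam)) := by
          gcongr
          exact hcard A.card
        _ = _ := by ring
    rcases lt_or_ge (4 * beta₀ d) β with hlt | hle
    · refine hfinal (128 * beta₀ d ^ 4 / (β ^ 3 * (β + 5 * beta₀ d))) (by positivity) ?_
        (LocalHamiltonian.exists_recoveryError_le_of_lt hd1 hβ hlt)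
      rw [div_lt_one (by positivity)]
      have h1 : (4 * beta₀ d) ^ 3 < β ^ 3 := pow_lt_pow_left₀ hlt (by positivity) (by norm_num)
      have h2 : (4 * beta₀ d) ^ 3 * (5 * beta₀ d) < β ^ 3 * (β + 5 * beta₀ d) :=
        mul_lt_mul h1 (by linarith) (by positivity) (by positivity)
      have h3 : 0 < beta₀ d ^ 4 := by positivity
      nlinarith
    · refine hfinal (2 * beta₀ d / (β + 5 * beta₀ d)) (by positivity) ?_
        (LocalHamiltonian.exists_recoveryError_le_of_le hd1 hβ hle)
      rw [div_lt_one (by positivity)]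
      linarith
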